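/- Let $n\ge 2$ and let $\mu=(\mu_1\ge\cdots\ge\mu_n;\ \mu_{n+1}\ge\cdots\ge\mu_{2n})$ and $\nu=(\nu_1\ge\cdots\ge\nu_n;\ \nu_{n+1}\ge\cdots\ge\nu_{2n})$ be sequences of integers that are pure with weights $w$ and $w'$, that is, $\mu_i+\mu_{2n+1-i}=w$ and $\nu_i+\nu_{2n+1-i}=w'$ for $1\le i\le n$. Put $$\kappa=\frac{w+w'}{2},\qquad k_\eta=\sum_{i=1}^n(\mu_i+\nu_i),\qquad M^s_{\mu,\nu}=\max_{\substack{i+j=s\\ 1\le i,j\le n}}(\mu_i+\nu_j),\qquad m^s_{\mu,\nu}=\min_{\substack{i+j=s\\ 1\le i,j\le n}}(\mu_i+\nu_j).$$ Let $G_{\mathbb C}=\mathrm{GL}_n(\mathbb C)\times\mathrm{GL}_n(\mathbb C)$ and let $F_\mu$, $F_\nu$ be the irreducible algebraic representations of $G_{\mathbb C}$ with highest weights $\mu$, $\nu$ (with respect to upper triangular matrices). For $k\in\mathbb Z$ let $\det^k$ be the irreducible algebraic representation of $\mathrm{GL}_n(\mathbb C)$ with highest weight $(k,\dots,k)$; for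 $a\in\mathbb Z$ let $\mathrm{Sym}^a$ be the one with highest weight $(a,0,\dots,0)$ if $a\ge 0$ and $(0,\dots,0,a)$ if $a<0$. Write $(\rho;\sigma)$ for the outer tensor product of two representations of $\mathrm{GL}_n(\mathbb C)$. Let $j\in\mathbb Z$. (i) Suppose that $1-2\kappa+\frac{k_\eta}{n}\le j\le-\frac{k_\eta}{n}$, and let $$V_j=\bigl(\textstyle\det^{-j}\otimes\mathrm{Sym}^{nj+k_\eta};\ \mathrm{Sym}^{nj-n-k_\eta+2n\kappa}\otimes\det^{1-j}\bigr).$$ Then $\dim\mathrm{Hom}_{G_{\mathbb C}}(F_\mu^\vee\otimes F_\nu^\vee\otimes V_j,\mathbb C)\le 1$, and equality holds if and only if $$-m^{n}_{\mu,\nu}\le j\le -M^{n+1}_{\mu,\nu}\quad\text{and}\quad 1-2\kappa+M^{n+1}_{\mu,\nu}\le j\le 1-2\kappa+m^{n}_{\mu,\nu}.$$ (ii) Suppose that $1-\frac{k_\eta}{n}\le j\le-2\kappa+\frac{k_\eta}{n}$, and let $$V_j=\bigl(\mathrm{Sym}^{nj+k_\eta-n}\otimes\textstyle\det^{1-j};\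 \det^{-j}\otimes\mathrm{Sym}^{nj+2n\kappa-k_\eta}\bigr).$$ Then $\dim\mathrm{Hom}_{G_{\mathbb C}}(F_\mu^\vee\otimes F_\nu^\vee\otimes V_j,\mathbb C)\le 1$, and equality holds if and only if $$1-m^{n+1}_{\mu,\nu}\le j\le 1-M^{n+2}_{\mu,\nu}\quad\text{and}\quad M^{n+2}_{\mu,\nu}-2\kappa\le j\le -2\kappa+m^{n+1}_{\mu,\nu}.$$ -/

import Mathlib

open scoped TensorProduct MatrixGroups

noncomputable section

namespace GLCompat

/-- `GL_n(ℂ)`. -/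
abbrev GLn (n : ℕ) : Type := GL (Fin n) ℂ

/-- The algebra of regular functions on `GL_n(ℂ)`: it is generated by the matrix entries and by
`det⁻¹`. -/
def regularFunctions (n : ℕ) : Subalgebra ℂ (GLn n → ℂ) :=
  Algebra.adjoin ℂ
    (Set.range (fun (p : Fin n × Fin n) (g : GLn n) => (g : Matrix (Fin n) (Fin n) ℂ) p.1 p.2) ∪
      {fun g : GLn n => ((g : Matrix (Fin n) (Fin n) ℂ).det)⁻¹})

/-- The algebra of regular functions on `GL_n(ℂ) × GL_n(ℂ)`: it is generated by the regular
functions of the first and of the second variable. -/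
def regularFunctionsProd (n : ℕ) : Subalgebra ℂ (GLn n × GLn n → ℂ) :=
  Algebra.adjoin ℂ
    ((fun f (g : GLn n × GLn n) => f g.1) '' (regularFunctions n : Set (GLn n → ℂ)) ∪
      (fun f (g : GLn n × GLn n) => f g.2) '' (regularFunctions n : Set (GLn n → ℂ)))

/-- A representation is algebraic, with respect to the algebra `A` of regular functions on the
group, if it is finite dimensional and all its matrix coefficients are regular. -/
def IsAlgebraic {G : Type*} [Group G] (A : Subalgebra ℂ (G → ℂ))
    {V : Type*} [AddCommGroup V] [Module ℂ V] (ρ : Representation ℂ G V) : Prop :=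
  FiniteDimensional ℂ V ∧
    ∀ (l : Module.Dual ℂ V) (v : V), (fun g : G => l (ρ g v)) ∈ A

/-- `b` lies in the Borel subgroup `B_n(ℂ) = T_n(ℂ) U_n(ℂ)` of upper triangular matrices. -/
def IsUpper {n : ℕ} (b : GLn n) : Prop :=
  (b : Matrix (Fin n) (Fin n) ℂ).BlockTriangular id

/-- The character `b ↦ ∏ i, (b i i) ^ (wt i)` of the group of upper triangular matrices; it is the
algebraic character `wt` on `T_n(ℂ)` and it is trivial on `U_n(ℂ)`. -/
def borelChar {n : ℕ} (wt : Fin n → ℤ) (b : GLn n) : ℂ :=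
  ∏ i, ((b : Matrix (Fin n) (Fin n) ℂ) i i) ^ (wt i)

/-- `ρ` is the irreducible algebraic representation of `GL_n(ℂ)` with highest weight `wt`: it is
irreducible and algebraic and contains a nonzero vector that is fixed by `U_n(ℂ)` and on which
`T_n(ℂ)` acts by `wt`. These properties determine `ρ` up to isomorphism. -/
structure IsIrrepGL {n : ℕ} (wt : Fin n → ℤ) {V : Type*} [AddCommGroup V] [Module ℂ V]
    (ρ : Representation ℂ (GLn n) V) : Prop where
  algebraic : IsAlgebraic (regularFunctions n) ρ
  irreducible : ρ.IsIrreducible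
  highestWeight : ∃ v : V, v ≠ 0 ∧ ∀ b : GLn n, IsUpper b → ρ b v = borelChar wt b • v

/-- A dominant weight `(μ₁ ≥ ⋯ ≥ μₙ; μₙ₊₁ ≥ ⋯ ≥ μ₂ₙ)` of `GL_n(ℂ) × GL_n(ℂ)`, stored as its two
halves: `left i` is `μ_{i+1}` and `right i` is `μ_{n+i+1}` for `i : Fin n`. -/
structure DominantWeight (n : ℕ) where
  left : Fin n → ℤ
  right : Fin n → ℤ
  left_antitone : Antitone left
  right_antitone : Antitone right

/-- `μ` is pure with weight `w`:
`μ₁ + μ₂ₙ = μ₂ + μ₂ₙ₋₁ = ⋯ = μₙ + μₙ₊₁ = w`. -/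
def DominantWeight.IsPure {n : ℕ} (μ : DominantWeight n) (w : ℤ) : Prop :=
  ∀ i : Fin n, μ.left i + μ.right i.rev = w

/-- `ρ` is `F_μ`, the irreducible algebraic representation of `GL_n(ℂ) × GL_n(ℂ)` with highest
weight `μ`. -/
structure IsIrrepGLProd {n : ℕ} (μ : DominantWeight n) {V : Type*} [AddCommGroup V] [Module ℂ V]
    (ρ : Representation ℂ (GLn n × GLn n) V) : Prop where
  algebraic : IsAlgebraic (regularFunctionsProd n) ρ
  irreducible : ρ.IsIrreducible
  highestWeight : ∃ v : V, v ≠ 0 ∧ ∀ b₁ b₂ : GLn n, IsUpper b₁ → IsUpper b₂ →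
    ρ (b₁, b₂) v = (borelChar μ.left b₁ * borelChar μ.right b₂) • v

/-- The highest weight `(k, k, …, k)` of `det ^ k`. -/
def detWeight (n : ℕ) (k : ℤ) : Fin n → ℤ := fun _ => k

/-- The highest weight of `Sym ^ a`: `(a, 0, …, 0)` if `a ≥ 0` and `(0, …, 0, a)` if `a < 0`. -/
def symWeight (n : ℕ) (a : ℤ) : Fin n → ℤ := fun i =>
  if 0 ≤ a then (if (i : ℕ) = 0 then a else 0) else (if (i : ℕ) + 1 = n then a else 0)

/-- `ρ` is `det ^ k`, the representation of `GL_n(ℂ)` with highest weight `(k, …, k)`. -/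
def IsDetPow {n : ℕ} (k : ℤ) {V : Type*} [AddCommGroup V] [Module ℂ V]
    (ρ : Representation ℂ (GLn n) V) : Prop :=
  IsIrrepGL (detWeight n k) ρ

/-- `ρ` is `Sym ^ a`, for a possibly negative integer `a`. -/
def IsSymPow {n : ℕ} (a : ℤ) {V : Type*} [AddCommGroup V] [Module ℂ V]
    (ρ : Representation ℂ (GLn n) V) : Prop :=
  IsIrrepGL (symWeight n a) ρ

/-- The representation `(ρ; σ)` of `GL_n(ℂ) × GL_n(ℂ)`: the outer tensor product of two
representations of `GL_n(ℂ)`. -/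
def outerTensor {n : ℕ} {V W : Type*} [AddCommGroup V] [Module ℂ V] [AddCommGroup W] [Module ℂ W]
    (ρ : Representation ℂ (GLn n) V) (σ : Representation ℂ (GLn n) W) :
    Representation ℂ (GLn n × GLn n) (V ⊗[ℂ] W) :=
  Representation.tprod (MonoidHom.comp ρ (MonoidHom.fst (GLn n) (GLn n)))
    (MonoidHom.comp σ (MonoidHom.snd (GLn n) (GLn n)))

/-- The dimension of `Hom_{GL_n(ℂ) × GL_n(ℂ)} (F₁^∨ ⊗ F₂^∨ ⊗ V, ℂ)`, where the group acts trivially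
on `ℂ`. -/
def homDim {n : ℕ} {F₁ F₂ V : Type*} [AddCommGroup F₁] [Module ℂ F₁] [AddCommGroup F₂]
    [Module ℂ F₂] [AddCommGroup V] [Module ℂ V]
    (ρ₁ : Representation ℂ (GLn n × GLn n) F₁) (ρ₂ : Representation ℂ (GLn n × GLn n) F₂)
    (τ : Representation ℂ (GLn n × GLn n) V) : ℕ :=
  Module.finrank ℂ (Representation.IntertwiningMap ((ρ₁.dual.tprod ρ₂.dual).tprod τ)
    (Representation.trivial ℂ (GLn n × GLn n) ℂ))

/-- The set of the numbers `μ_i + ν_j` with `1 ≤ i, j ≤ n` and `i + j = s`. -/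
def sumSet {n : ℕ} (μ ν : DominantWeight n) (s : ℕ) : Set ℤ :=
  {x | ∃ i j : Fin n, ((i : ℕ) + 1) + ((j : ℕ) + 1) = s ∧ x = μ.left i + ν.left j}

/-- `M_{μ,ν}^s`, the maximum of `μ_i + ν_j` over `1 ≤ i, j ≤ n` with `i + j = s`. It is used for
`s = n, n + 1, n + 2` and `n ≥ 2`, where the set is finite and nonempty. -/
def maxSum {n : ℕ} (μ ν : DominantWeight n) (s : ℕ) : ℤ := sSup (sumSet μ ν s)

/-- `m_{μ,ν}^s`, the minimum of `μ_i + ν_j` over `1 ≤ i, j ≤ n` with `i + j = s`. -/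
def minSum {n : ℕ} (μ ν : DominantWeight n) (s : ℕ) : ℤ := sInf (sumSet μ ν s)

/-- `k_η = ∑_{i=1}^n (μ_i + ν_i)`. -/
def kEta {n : ℕ} (μ ν : DominantWeight n) : ℤ := ∑ i, (μ.left i + ν.left i)

/-- `κ = (w + w') / 2`, where `w` and `w'` are the weights of `μ` and `ν`. -/
def kappa (w w' : ℤ) : ℚ := ((w : ℚ) + (w' : ℚ)) / 2

end GLCompat

end

/-! Why the theorem holds. The range of `j` fixes the signs of the two symmetric powers in `V_j`:
one exponent is nonnegative, the other nonpositive. After transpose inverse on the factor where it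
is nonnegative, both factors of `V_j` have the form `det^k ⊗ Sym^(-a)` with `a ≥ 0`. Purity rewrites
the weights of the right halves through `μ_i` and `ν_i`. What remains on each factor is the Pieri
rule: for weights `λ`, `λ'` with `a = nk - |λ| - |λ'|`, invariant forms on `F_λ^∨ ⊗ F_λ'^∨ ⊗ det^k ⊗
Sym^(-a)` form a space of dimension at most one, and it is nonzero exactly when `λ_i + λ'_{n+1-i} ≤
k` for all `i` and `k ≤ λ_i + λ'_j` for `i + j = n`. Families of matrices indexed by a finite type
`S` treat both factors at once.

The tool is a Borel-Weil theorem: for a cyclic highest weight representation with highest weight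
vector `v`, every regular function of the right weight is a matrix coefficient `g ↦ l (ρ g v)`
(`mem_of_weight`, `IsHighestWeight.exists_functional_eq`). It rests on the Fischer inner product on
polynomials in matrix entries, for which translation by `k` is adjoint to translation by the
conjugate transpose of `k`, and on the density of the big cell (lower times upper triangular), which
makes the normalised lowest weight polynomial unique.

Bound. Let `l` and `m` be extremal functionals on `F` and `F'` for opposite Borel subgroups. An
invariant form `A` is determined by the regular function `f(g) = A(l ⊗ m ⊗ τ(g) v₀)`. The diagonal
torus on the left and the mirabolic subgroup on the right act on `f` by characters and have an open
orbit, where the entries `y_i` of the last row of `g⁻¹` are nonzero. Hence `f` is a constant times a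
power of `det g` times the monomial with exponents `α_i = k - λ_i - λ'_{n+1-i}` in the `y_i`
(`coefficient_eq`), and the constant determines `A` (`coefficient_ne_zero`).

Necessity. Regularity of `f` forces `α_i ≥ 0`. Following `f` along a unipotent one-parameter curve
to infinity, with growth controlled by the weight of `l`, forces `α_j ≤ λ_i - λ_j` for `i < j`; the
case `j = i + 1` is the other inequality.

Existence. A product of powers of determinants mixing initial columns of `g₁`, a vector `x`, and
initial columns of `g₂` has the required weights, and the inequalities say precisely that the
exponents can be chosen nonnegative (`exists_pieri_exponents`). Setting `x` to the last row of `g⁻¹`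
and pairing with matrix coefficients of `F ⊗ F'` under the bilinear Fischer form gives functions of
the weight of the target; Borel-Weil turns them into an invariant form
(`PieriSetup.exists_ne_zero`). -/

noncomputable section

namespace GLCompat

open MvPolynomial

/-! ### The Fischer form on polynomials -/

section Fischer

variable {ι : Type*}

/-- The product of the factorials of the exponents of a monomial. -/
def multiFactorial (m : ι →₀ ℕ) : ℕ := m.prod fun _ k => k.factorial

theorem multiFactorial_pos (m : ι →₀ ℕ) : 0 < multiFactorial m :=
  Finset.prod_pos fun _ _ => Nat.factorial_pos _

theorem multiFactorial_add_single (m : ι →₀ ℕ) (i : ι) :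
    multiFactorial (m + Finsupp.single i 1) = (m i + 1) * multiFactorial m := by
  classical
  have h1 : multiFactorial (m + Finsupp.single i 1) =
      ∏ j ∈ insert i m.support, ((m + Finsupp.single i 1 : ι →₀ ℕ) j).factorial := by
    refine Finsupp.prod_of_support_subset _ ?_ _ (by simp)
    intro j hj
    by_cases hji : j = i
    · simp [hji]
    · have : m j ≠ 0 := by
        simpa [Finsupp.single_apply, Ne.symm hji] using hj
      simp [this]
  have h2 : multiFactorial m = ∏ j ∈ insert i m.support, (m j).factorial :=
    Finsupp.prod_of_support_subset _ (Finset.subset_insert _ _) _ (by simp)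
  rw [h1, h2, ← Finset.mul_prod_erase _ _ (Finset.mem_insert_self i m.support),
    ← Finset.mul_prod_erase _ (fun j => (m j).factorial) (Finset.mem_insert_self i m.support),
    ← mul_assoc]
  congr 1
  · simp [Nat.factorial_succ]
  · refine Finset.prod_congr rfl fun j hj => ?_
    have : j ≠ i := (Finset.mem_erase.mp hj).1
    simp [this.symm]

/-- The bilinear Fischer form `⟨p, q⟩ = ∑ m, m! * p_m * q_m`. -/
def fischer : MvPolynomial ι ℂ →ₗ[ℂ] MvPolynomial ι ℂ →ₗ[ℂ] ℂ :=
  (basisMonomials ι ℂ).constr ℂ fun m => (multiFactorial m : ℂ) • lcoeff ℂ m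

theorem fischer_monomial (m : ι →₀ ℕ) (c : ℂ) (q : MvPolynomial ι ℂ) :
    fischer (monomial m c) q = c * (multiFactorial m * coeff m q) := by
  have h : (monomial m c : MvPolynomial ι ℂ) = c • basisMonomials ι ℂ m := by
    simp [coe_basisMonomials, smul_monomial]
  rw [h, map_smul, fischer, Module.Basis.constr_basis]
  simp [lcoeff]

theorem fischer_eq_sum (p q : MvPolynomial ι ℂ) :
    fischer p q = ∑ m ∈ p.support, multiFactorial m * coeff m p * coeff m q := by
  conv_lhs => rw [p.as_sum]
  rw [map_sum, LinearMap.sum_apply]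
  refine Finset.sum_congr rfl fun m _ => ?_
  rw [fischer_monomial]
  ring

theorem fischer_eq_sum_of_subset (p q : MvPolynomial ι ℂ) {s : Finset (ι →₀ ℕ)}
    (hs : p.support ⊆ s) :
    fischer p q = ∑ m ∈ s, multiFactorial m * coeff m p * coeff m q := by
  rw [fischer_eq_sum]
  refine Finset.sum_subset hs fun m _ hm => ?_
  rw [notMem_support_iff.mp hm]
  simp

/-- The factorial weights are chosen for this adjunction: raising the exponent of `X i` multiplies
the weight by the factor that differentiation produces. -/
theorem fischer_X_mul (i : ι) (p q : MvPolynomial ι ℂ) :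
    fischer (p * X i) q = fischer p (pderiv i q) := by
  induction p using MvPolynomial.induction_on' with
  | monomial m c =>
    rw [X, monomial_mul, mul_one, fischer_monomial, fischer_monomial, coeff_pderiv,
      multiFactorial_add_single]
    push_cast
    ring
  | add p p' h h' => rw [add_mul, map_add, map_add, LinearMap.add_apply, LinearMap.add_apply, h, h']

theorem fischer_C (c : ℂ) (q : MvPolynomial ι ℂ) : fischer (C c) q = c * coeff 0 q := by
  rw [C_apply, fischer_monomial]
  simp [multiFactorial]

variable [Fintype ι]

/-- The linear substitution `X i ↦ ∑ j, M i j * X j`. -/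
def subst (M : Matrix ι ι ℂ) : MvPolynomial ι ℂ →ₐ[ℂ] MvPolynomial ι ℂ :=
  aeval fun i => ∑ j, C (M i j) * X j

theorem eval_subst (M : Matrix ι ι ℂ) (x : ι → ℂ) (p : MvPolynomial ι ℂ) :
    eval x (subst M p) = eval (M.mulVec x) p := by
  rw [subst, aeval_def, ← MvPolynomial.coe_eval₂Hom]
  rw [← RingHom.comp_apply]
  congr 1
  ext i
  · simp
  · simp [Matrix.mulVec, dotProduct]

theorem coeff_zero_subst (M : Matrix ι ι ℂ) (p : MvPolynomial ι ℂ) :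
    coeff 0 (subst M p) = coeff 0 p := by
  have h := eval_subst M 0 p
  rw [Matrix.mulVec_zero] at h
  simpa [← constantCoeff_eq, eval_zero] using h

theorem pderiv_subst (M : Matrix ι ι ℂ) (i : ι) (q : MvPolynomial ι ℂ) :
    pderiv i (subst M q) = ∑ j, C (M j i) * subst M (pderiv j q) := by
  classical
  induction q using MvPolynomial.induction_on with
  | C c => simp [subst]
  | add p p' h h' => simp only [map_add, h, h', mul_add, Finset.sum_add_distrib]
  | mul_X p k h =>
    have hX : pderiv i (subst M (X k)) = C (M k i) := by
      simp [subst, Pi.single_apply, pderiv_X]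
    rw [map_mul, Derivation.leibniz, hX, h, smul_eq_mul, smul_eq_mul]
    have hj : ∀ j, C (M j i) * subst M (pderiv j (p * X k)) =
        (if j = k then subst M p * C (M k i) else 0) +
          subst M (X k) * (C (M j i) * subst M (pderiv j p)) := by
      intro j
      rw [Derivation.leibniz, smul_eq_mul, smul_eq_mul, map_add, map_mul, map_mul]
      split_ifs with hjk
      · subst hjk
        rw [pderiv_X_self, map_one]
        ring
      · rw [pderiv_X_of_ne (Ne.symm hjk), map_zero]
        ring
    rw [Finset.sum_congr rfl fun j _ => hj j, Finset.sum_add_distrib, Finset.sum_ite_eq',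
      if_pos (Finset.mem_univ k), ← Finset.mul_sum]

/-- Induction on the degree of `p`: multiplication by a variable is moved across as a derivative,
and the chain rule `pderiv_subst` supplies exactly the transposed matrix. -/
theorem fischer_subst (M : Matrix ι ι ℂ) (p q : MvPolynomial ι ℂ) :
    fischer (subst M p) q = fischer p (subst M.transpose q) := by
  induction p using MvPolynomial.induction_on generalizing q with
  | C c => 
    rw [show subst M (C c) = C c by simp [subst], fischer_C, fischer_C, coeff_zero_subst]
  | add p p' h h' => simp only [map_add, LinearMap.add_apply, h, h']
  | mul_X p k h =>
    rw [map_mul, fischer_X_mul, pderiv_subst]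
    simp only [map_sum]
    rw [show subst M (X k) = ∑ j, C (M k j) * X j by simp [subst], Finset.mul_sum, map_sum,
      LinearMap.sum_apply]
    refine Finset.sum_congr rfl fun j _ => ?_
    rw [show subst M p * (C (M k j) * X j) = M k j • (subst M p * X j) by
      rw [smul_eq_C_mul]; ring, ← smul_eq_C_mul, map_smul, map_smul, LinearMap.smul_apply,
      fischer_X_mul, h, Matrix.transpose_apply]

end Fischer

/-! ### The positive definite Hermitian version of the Fischer form. -/

section Hermitian

variable {ι : Type*}

/-- Complex conjugation of the coefficients of a polynomial. -/
def conjPoly : MvPolynomial ι ℂ →+* MvPolynomial ι ℂ := map (starRingEnd ℂ)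

theorem conjPoly_smul (c : ℂ) (p : MvPolynomial ι ℂ) :
    conjPoly (c • p) = (starRingEnd ℂ c) • conjPoly p := by
  simp [conjPoly, smul_eq_C_mul]

/-- The Hermitian Fischer form. -/
def hermitianFischer (p q : MvPolynomial ι ℂ) : ℂ := fischer (conjPoly p) q

theorem hermitianFischer_eq_sum (p q : MvPolynomial ι ℂ) {s : Finset (ι →₀ ℕ)}
    (hs : p.support ⊆ s) :
    hermitianFischer p q =
      ∑ m ∈ s, multiFactorial m * (starRingEnd ℂ) (coeff m p) * coeff m q := by
  rw [hermitianFischer, fischer_eq_sum_of_subset (s := s)]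
  · simp [conjPoly, coeff_map]
  · exact (support_map_subset _ _).trans hs

theorem hermitianFischer_self (p : MvPolynomial ι ℂ) :
    hermitianFischer p p =
      ((∑ m ∈ p.support, multiFactorial m * Complex.normSq (coeff m p) : ℝ) : ℂ) := by
  rw [hermitianFischer_eq_sum p p subset_rfl]
  push_cast
  refine Finset.sum_congr rfl fun m _ => ?_
  rw [mul_assoc, Complex.normSq_eq_conj_mul_self]

theorem hermitianFischer_self_eq_zero {p : MvPolynomial ι ℂ} (h : hermitianFischer p p = 0) :
    p = 0 := by
  rw [hermitianFischer_self] at h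
  have h' := Complex.ofReal_eq_zero.mp h
  rw [Finset.sum_eq_zero_iff_of_nonneg
    (fun m _ => mul_nonneg (Nat.cast_nonneg _) (Complex.normSq_nonneg _))] at h'
  by_contra hp
  obtain ⟨m, hm⟩ := support_nonempty.mpr hp
  have := h' m hm
  rw [mul_eq_zero] at this
  rcases this with h0 | h0
  · exact (multiFactorial_pos m).ne' (by exact_mod_cast h0)
  · exact (mem_support_iff.mp hm) (Complex.normSq_eq_zero.mp h0)

theorem hermitianFischer_conj_symm (p q : MvPolynomial ι ℂ) :
    (starRingEnd ℂ) (hermitianFischer q p) = hermitianFischer p q := by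
  classical
  rw [hermitianFischer_eq_sum q p (Finset.subset_union_right (s₁ := p.support)),
    hermitianFischer_eq_sum p q (Finset.subset_union_left (s₂ := q.support)), map_sum]
  refine Finset.sum_congr rfl fun m _ => ?_
  simp
  ring

/-- The Hermitian Fischer form as an inner product on a space of polynomials. -/
@[reducible] def fischerCore (N : Submodule ℂ (MvPolynomial ι ℂ)) :
    InnerProductSpace.Core ℂ N where
  inner p q := hermitianFischer (p : MvPolynomial ι ℂ) q
  conj_inner_symm p q := hermitianFischer_conj_symm _ _
  re_inner_nonneg p := by
    rw [hermitianFischer_self, RCLike.re_eq_complex_re, Complex.ofReal_re]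
    exact Finset.sum_nonneg fun m _ => mul_nonneg (Nat.cast_nonneg _) (Complex.normSq_nonneg _)
  add_left p q r := by simp [hermitianFischer]
  smul_left p q r := by simp [hermitianFischer, conjPoly_smul]
  definite p h := Subtype.ext (hermitianFischer_self_eq_zero h)

/-- Riesz representation, with the norm installed locally so that polynomial spaces carry no global
one. -/
theorem _root_.InnerProductSpace.Core.exists_inner_eq {V : Type*} [AddCommGroup V] [Module ℂ V]
    [FiniteDimensional ℂ V] (c : InnerProductSpace.Core ℂ V) (φ : V →ₗ[ℂ] ℂ) :
    ∃ K, ∀ P, c.inner K P = φ P := by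
  let i1 : NormedAddCommGroup V := c.toNormedAddCommGroup
  let i2 : InnerProductSpace ℂ V := InnerProductSpace.ofCore c.toCore
  have : CompleteSpace V := FiniteDimensional.complete ℂ V
  exact ⟨(InnerProductSpace.toDual ℂ V).symm (LinearMap.toContinuousLinearMap φ), fun P =>
    InnerProductSpace.toDual_symm_apply (x := P) (y := LinearMap.toContinuousLinearMap φ)⟩

theorem exists_hermitianFischer_eq (N : Submodule ℂ (MvPolynomial ι ℂ)) [FiniteDimensional ℂ N]
    (φ : MvPolynomial ι ℂ →ₗ[ℂ] ℂ) : ∃ K ∈ N, ∀ P ∈ N, hermitianFischer K P = φ P := by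
  obtain ⟨K, hK⟩ := (fischerCore N).exists_inner_eq (φ ∘ₗ N.subtype)
  exact ⟨K, K.2, fun P hP => hK ⟨P, hP⟩⟩

theorem exists_hermitianFischer_proj (N : Submodule ℂ (MvPolynomial ι ℂ))
    [FiniteDimensional ℂ N] (P : MvPolynomial ι ℂ) :
    ∃ K ∈ N, ∀ Q ∈ N, hermitianFischer (P - K) Q = 0 := by
  obtain ⟨K, hK, h⟩ := exists_hermitianFischer_eq N (fischer (conjPoly P))
  refine ⟨K, hK, fun Q hQ => ?_⟩
  have := h Q hQ
  simp only [hermitianFischer, map_sub, LinearMap.sub_apply] at this ⊢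
  rw [this, sub_self]

theorem conjPoly_subst [Fintype ι] (M : Matrix ι ι ℂ) (p : MvPolynomial ι ℂ) :
    conjPoly (subst M p) = subst (M.map (starRingEnd ℂ)) (conjPoly p) := by
  induction p using MvPolynomial.induction_on with
  | C c => simp [subst, conjPoly]
  | add p q h h' => simp [h, h']
  | mul_X p i h => rw [map_mul, map_mul, h, map_mul, map_mul]; simp [subst, conjPoly]

theorem hermitianFischer_subst [Fintype ι] (M : Matrix ι ι ℂ) (p q : MvPolynomial ι ℂ) :
    hermitianFischer (subst M p) q = hermitianFischer p (subst M.conjTranspose q) := by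
  rw [hermitianFischer, conjPoly_subst, fischer_subst, hermitianFischer]
  rfl

/-- Keeps the span of all translates of one polynomial inside a space of bounded degree, hence
finite dimensional. -/
theorem totalDegree_subst_le [Fintype ι] (M : Matrix ι ι ℂ) (p : MvPolynomial ι ℂ) :
    (subst M p).totalDegree ≤ p.totalDegree := by
  rw [subst, aeval_def, eval₂_eq]
  refine (totalDegree_finsetSum _ _).trans (Finset.sup_le fun m hm => ?_)
  refine (totalDegree_mul _ _).trans ?_
  rw [algebraMap_eq, totalDegree_C, zero_add]
  refine (totalDegree_finsetProd _ _).trans ?_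
  refine le_trans (Finset.sum_le_sum (g := fun i => m i) fun i _ => ?_) (le_totalDegree hm)
  refine (totalDegree_pow _ _).trans ?_
  refine (Nat.mul_le_mul_left (m i) ?_).trans (mul_one _).le
  refine (totalDegree_finsetSum _ _).trans (Finset.sup_le fun j _ => ?_)
  refine (totalDegree_mul _ _).trans ?_
  rw [totalDegree_C, zero_add]
  exact (totalDegree_X _).le

end Hermitian

/-! ### Regular functions on finite powers of `GL_n(ℂ)` -/

section Regular

variable {S S' : Type*} {n : ℕ}

/-- Polynomials in the entries of an `S`-indexed family of matrices. -/
abbrev MatPoly (S : Type*) (n : ℕ) : Type _ := MvPolynomial (S × Fin n × Fin n) ℂ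

/-- The entries of a family of matrices. -/
def entries (M : S → Matrix (Fin n) (Fin n) ℂ) : S × Fin n × Fin n → ℂ :=
  fun p => M p.1 p.2.1 p.2.2

/-- The value of a polynomial at a family of invertible matrices. -/
def evalG (g : S → GLn n) : MatPoly S n →ₐ[ℂ] ℂ :=
  aeval (entries fun s => (g s : Matrix (Fin n) (Fin n) ℂ))

theorem evalG_eq_eval (g : S → GLn n) (P : MatPoly S n) :
    evalG g P = eval (entries fun s => (g s : Matrix (Fin n) (Fin n) ℂ)) P := by
  rw [evalG, aeval_eq_eval]

@[simp] theorem evalG_X (g : S → GLn n) (p : S × Fin n × Fin n) :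
    evalG g (X p) = (g p.1 : Matrix (Fin n) (Fin n) ℂ) p.2.1 p.2.2 := by
  simp [evalG, entries]

@[simp] theorem evalG_C (g : S → GLn n) (c : ℂ) : evalG g (C c) = c := by simp [evalG]

/-- The algebra of regular functions on `S → GL_n(ℂ)`. -/
def Reg (S : Type*) (n : ℕ) : Subalgebra ℂ ((S → GLn n) → ℂ) :=
  Algebra.adjoin ℂ
    (Set.range (fun (p : S × Fin n × Fin n) (g : S → GLn n) =>
        (g p.1 : Matrix (Fin n) (Fin n) ℂ) p.2.1 p.2.2) ∪
      Set.range fun (s : S) (g : S → GLn n) => ((g s : Matrix (Fin n) (Fin n) ℂ).det)⁻¹)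

theorem entry_mem_Reg (s : S) (i j : Fin n) :
    (fun g : S → GLn n => (g s : Matrix (Fin n) (Fin n) ℂ) i j) ∈ Reg S n :=
  Algebra.subset_adjoin (Or.inl ⟨(s, i, j), rfl⟩)

theorem det_inv_mem_Reg (s : S) :
    (fun g : S → GLn n => ((g s : Matrix (Fin n) (Fin n) ℂ).det)⁻¹) ∈ Reg S n :=
  Algebra.subset_adjoin (Or.inr ⟨s, rfl⟩)

theorem const_mem_Reg (c : ℂ) : (fun _ : S → GLn n => c) ∈ Reg S n :=
  (Reg S n).algebraMap_mem c

theorem sum_mem_Reg {κ : Type*} (T : Finset κ) (f : κ → (S → GLn n) → ℂ)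
    (h : ∀ i ∈ T, f i ∈ Reg S n) : (fun g => ∑ i ∈ T, f i g) ∈ Reg S n := by
  have := Subalgebra.sum_mem (Reg S n) h
  convert this using 1
  ext g
  simp

theorem prod_mem_Reg {κ : Type*} (T : Finset κ) (f : κ → (S → GLn n) → ℂ)
    (h : ∀ i ∈ T, f i ∈ Reg S n) : (fun g => ∏ i ∈ T, f i g) ∈ Reg S n := by
  have := Subalgebra.prod_mem (Reg S n) h
  convert this using 1
  ext g
  simp

theorem mul_mem_Reg {f f' : (S → GLn n) → ℂ} (h : f ∈ Reg S n) (h' : f' ∈ Reg S n) :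
    (fun g => f g * f' g) ∈ Reg S n :=
  Subalgebra.mul_mem _ h h'

theorem pow_mem_Reg {f : (S → GLn n) → ℂ} (h : f ∈ Reg S n) (k : ℕ) :
    (fun g => f g ^ k) ∈ Reg S n :=
  Subalgebra.pow_mem _ h k

theorem det_mem_Reg_of_entries {m : Type*} [Fintype m] [DecidableEq m]
    (M : (S → GLn n) → Matrix m m ℂ) (h : ∀ i j, (fun g => M g i j) ∈ Reg S n) :
    (fun g => (M g).det) ∈ Reg S n := by
  simp only [Matrix.det_apply']
  exact sum_mem_Reg _ _ fun σ _ => mul_mem_Reg (const_mem_Reg _) (prod_mem_Reg _ _ fun i _ => h _ _)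

theorem det_mem_Reg (s : S) :
    (fun g : S → GLn n => (g s : Matrix (Fin n) (Fin n) ℂ).det) ∈ Reg S n :=
  det_mem_Reg_of_entries _ fun i j => entry_mem_Reg s i j

theorem GLn.det_ne_zero (g : GLn n) : (g : Matrix (Fin n) (Fin n) ℂ).det ≠ 0 :=
  ((Matrix.isUnit_iff_isUnit_det _).mp g.isUnit).ne_zero

theorem det_zpow_mem_Reg (s : S) (k : ℤ) :
    (fun g : S → GLn n => (g s : Matrix (Fin n) (Fin n) ℂ).det ^ k) ∈ Reg S n := by
  obtain ⟨m, rfl | rfl⟩ := k.eq_nat_or_neg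
  · simpa using pow_mem_Reg (det_mem_Reg s) m
  · simpa using pow_mem_Reg (det_inv_mem_Reg s) m

/-- Cramer's rule: an entry of the inverse is a minor divided by the determinant. -/
theorem inv_entry_mem_Reg (s : S) (i j : Fin n) :
    (fun g : S → GLn n => ((g s)⁻¹ : GLn n).1 i j) ∈ Reg S n := by
  have h : (fun g : S → GLn n => ((g s)⁻¹ : GLn n).1 i j) = fun g =>
      ((g s : Matrix (Fin n) (Fin n) ℂ).det)⁻¹ *
        ((g s : Matrix (Fin n) (Fin n) ℂ).updateRow j (Pi.single i 1)).det := by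
    ext g
    rw [Matrix.coe_units_inv, Matrix.inv_def, Ring.inverse_eq_inv']
    simp [Matrix.adjugate_apply]
  rw [h]
  refine mul_mem_Reg (det_inv_mem_Reg s) (det_mem_Reg_of_entries _ fun a b => ?_)
  by_cases hab : a = j
  · subst hab
    simpa using const_mem_Reg _
  · simpa [Matrix.updateRow_ne hab] using entry_mem_Reg s a b

theorem Reg_comp {φ : (S → GLn n) → (S' → GLn n)}
    (h1 : ∀ s i j, (fun g => (φ g s : Matrix (Fin n) (Fin n) ℂ) i j) ∈ Reg S n)
    (h2 : ∀ s, (fun g => ((φ g s : Matrix (Fin n) (Fin n) ℂ).det)⁻¹) ∈ Reg S n)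
    {f : (S' → GLn n) → ℂ} (hf : f ∈ Reg S' n) : (fun g => f (φ g)) ∈ Reg S n := by
  induction hf using Algebra.adjoin_induction with
  | mem f hf =>
    rcases hf with ⟨p, rfl⟩ | ⟨s, rfl⟩
    · exact h1 _ _ _
    · exact h2 s
  | algebraMap c => exact const_mem_Reg c
  | add f f' _ _ h h' => exact Subalgebra.add_mem _ h h'
  | mul f f' _ _ h h' => exact Subalgebra.mul_mem _ h h'

theorem Reg_mul_left (k : S → GLn n) {f : (S → GLn n) → ℂ} (hf : f ∈ Reg S n) :
    (fun g => f (k * g)) ∈ Reg S n := by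
  refine Reg_comp (φ := fun g => k * g) (fun s i j => ?_) (fun s => ?_) hf
  · simp only [Pi.mul_apply, Units.val_mul, Matrix.mul_apply]
    exact sum_mem_Reg _ _ fun l _ => mul_mem_Reg (const_mem_Reg _) (entry_mem_Reg _ _ _)
  · simp only [Pi.mul_apply, Units.val_mul, Matrix.det_mul, mul_inv]
    exact mul_mem_Reg (const_mem_Reg _) (det_inv_mem_Reg _)

theorem Reg_mul_right (k : S → GLn n) {f : (S → GLn n) → ℂ} (hf : f ∈ Reg S n) :
    (fun g => f (g * k)) ∈ Reg S n := by
  refine Reg_comp (φ := fun g => g * k) (fun s i j => ?_) (fun s => ?_) hf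
  · simp only [Pi.mul_apply, Units.val_mul, Matrix.mul_apply]
    exact sum_mem_Reg _ _ fun l _ => mul_mem_Reg (entry_mem_Reg _ _ _) (const_mem_Reg _)
  · simp only [Pi.mul_apply, Units.val_mul, Matrix.det_mul, mul_inv]
    exact mul_mem_Reg (det_inv_mem_Reg _) (const_mem_Reg _)

theorem Reg_reindex (e : S' → S) {f : (S' → GLn n) → ℂ} (hf : f ∈ Reg S' n) :
    (fun g : S → GLn n => f fun s => g (e s)) ∈ Reg S n :=
  Reg_comp (φ := fun g s => g (e s)) (fun _ _ _ => entry_mem_Reg _ _ _)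
    (fun _ => det_inv_mem_Reg _) hf

theorem evalG_mem_Reg (P : MatPoly S n) : (fun g => evalG g P) ∈ Reg S n := by
  induction P using MvPolynomial.induction_on with
  | C c => simpa using const_mem_Reg c
  | add p q h h' =>
    simp only [map_add]
    exact Subalgebra.add_mem _ h h'
  | mul_X p i h =>
    simp only [map_mul, evalG_X]
    exact mul_mem_Reg h (entry_mem_Reg _ _ _)

/-- The only topology needed: along a curve with continuous entries a regular function is
continuous, because determinants do not vanish on invertible matrices. Limit arguments thus need no
topology on the group. -/
theorem continuous_of_mem_Reg {Z : Type*} [TopologicalSpace Z] (γ : Z → S → GLn n)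
    (h1 : ∀ s i j, Continuous fun z => (γ z s : Matrix (Fin n) (Fin n) ℂ) i j)
    {f : (S → GLn n) → ℂ} (hf : f ∈ Reg S n) : Continuous fun z => f (γ z) := by
  induction hf using Algebra.adjoin_induction with
  | mem f hf =>
    rcases hf with ⟨p, rfl⟩ | ⟨s, rfl⟩
    · exact h1 _ _ _
    · refine Continuous.inv₀ ?_ fun z => GLn.det_ne_zero _
      exact Continuous.matrix_det (continuous_matrix fun i j => h1 s i j)
  | algebraMap c => exact continuous_const
  | add f f' _ _ h h' => exact h.add h'
  | mul f f' _ _ h h' => exact h.mul h'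

variable [Fintype S]

/-- The product of the determinants of a family of invertible matrices. -/
def detG (g : S → GLn n) : ℂ := ∏ s, (g s : Matrix (Fin n) (Fin n) ℂ).det

theorem detG_ne_zero (g : S → GLn n) : detG g ≠ 0 :=
  Finset.prod_ne_zero_iff.mpr fun s _ => GLn.det_ne_zero (g s)

theorem detG_mul (g h : S → GLn n) : detG (g * h) = detG g * detG h := by
  simp [detG, Finset.prod_mul_distrib]

/-- `detG` as a polynomial. -/
def detPoly (S : Type*) [Fintype S] (n : ℕ) : MatPoly S n :=
  ∏ s, (Matrix.of fun i j : Fin n => (X (s, i, j) : MatPoly S n)).det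

theorem eval_detPoly (x : S × Fin n × Fin n → ℂ) :
    eval x (detPoly S n) = ∏ s, (Matrix.of fun i j : Fin n => x (s, i, j)).det := by
  rw [detPoly, map_prod]
  refine Finset.prod_congr rfl fun s _ => ?_
  rw [RingHom.map_det]
  congr 1
  ext i j
  simp

theorem evalG_detPoly (g : S → GLn n) : evalG g (detPoly S n) = detG g := by
  rw [evalG_eq_eval, eval_detPoly]
  rfl

theorem detPoly_ne_zero : detPoly S n ≠ 0 := by
  intro h
  have := evalG_detPoly (1 : S → GLn n)
  rw [h, map_zero] at this
  exact detG_ne_zero _ this.symm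

/-- Multiplying by the determinant polynomial makes the product vanish at singular points too, so it
is the zero polynomial; polynomials form a domain. -/
theorem eq_zero_of_evalG {P : MatPoly S n} (h : ∀ g, evalG g P = 0) : P = 0 := by
  have h0 : P * detPoly S n = 0 := by
    refine MvPolynomial.funext fun x => ?_
    rw [map_mul, map_zero]
    by_cases hx : eval x (detPoly S n) = 0
    · rw [hx, mul_zero]
    · rw [eval_detPoly, ← ne_eq, Finset.prod_ne_zero_iff] at hx
      have := h fun s => Matrix.GeneralLinearGroup.mkOfDetNeZero _ (hx s (Finset.mem_univ s))
      rw [evalG_eq_eval] at this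
      rw [show eval x P = 0 from this, zero_mul]
  exact (mul_eq_zero.mp h0).resolve_right detPoly_ne_zero

theorem eq_of_evalG {P Q : MatPoly S n} (h : ∀ g, evalG g P = evalG g Q) : P = Q :=
  sub_eq_zero.mp (eq_zero_of_evalG fun g => by rw [map_sub, h, sub_self])

/-- Clearing denominators. All sufficiently large exponents are allowed, so that several functions
can share one power of the determinant. -/
theorem exists_poly_of_mem_Reg {f : (S → GLn n) → ℂ} (hf : f ∈ Reg S n) :
    ∃ K : ℕ, ∀ K' ≥ K, ∃ P : MatPoly S n, ∀ g, detG g ^ K' * f g = evalG g P := by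
  suffices h : ∃ (K : ℕ) (P : MatPoly S n), ∀ g, detG g ^ K * f g = evalG g P by
    obtain ⟨K, P, h⟩ := h
    refine ⟨K, fun K' hK' => ⟨detPoly S n ^ (K' - K) * P, fun g => ?_⟩⟩
    rw [map_mul, map_pow, evalG_detPoly, ← h, ← mul_assoc, ← pow_add, Nat.sub_add_cancel hK']
  classical
  induction hf using Algebra.adjoin_induction with
  | mem f hf =>
    rcases hf with ⟨p, rfl⟩ | ⟨s, rfl⟩
    · exact ⟨0, X p, fun g => by simp⟩
    · refine ⟨1, ∏ t ∈ Finset.univ.erase s,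
        (Matrix.of fun i j : Fin n => (X (t, i, j) : MatPoly S n)).det, fun g => ?_⟩
      rw [pow_one, detG, ← Finset.prod_erase_mul _ _ (Finset.mem_univ s), mul_assoc,
        mul_inv_cancel₀ (GLn.det_ne_zero (g s)), mul_one, map_prod]
      refine Finset.prod_congr rfl fun t _ => ?_
      rw [AlgHom.map_det]
      congr 1
      ext i j
      simp
  | algebraMap c => exact ⟨0, C c, fun g => by simp⟩
  | add f f' _ _ h h' =>
    obtain ⟨K, P, h⟩ := h
    obtain ⟨K', P', h'⟩ := h'
    refine ⟨K + K', detPoly S n ^ K' * P + detPoly S n ^ K * P', fun g => ?_⟩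
    simp only [map_add, map_mul, map_pow, evalG_detPoly, ← h, ← h', Pi.add_apply]
    ring
  | mul f f' _ _ h h' =>
    obtain ⟨K, P, h⟩ := h
    obtain ⟨K', P', h'⟩ := h'
    refine ⟨K + K', P * P', fun g => ?_⟩
    simp only [map_mul, ← h, ← h', Pi.mul_apply]
    ring

theorem Reg_eq_zero_or_eq_zero {f f' : (S → GLn n) → ℂ} (hf : f ∈ Reg S n) (hf' : f' ∈ Reg S n)
    (h : ∀ g, f g * f' g = 0) : (∀ g, f g = 0) ∨ ∀ g, f' g = 0 := by
  obtain ⟨K, hK⟩ := exists_poly_of_mem_Reg hf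
  obtain ⟨P, hP⟩ := hK K le_rfl
  obtain ⟨K', hK'⟩ := exists_poly_of_mem_Reg hf'
  obtain ⟨P', hP'⟩ := hK' K' le_rfl
  have h0 : P * P' = 0 := eq_zero_of_evalG fun g => by
    rw [map_mul, ← hP, ← hP', mul_mul_mul_comm, h, mul_zero]
  rcases mul_eq_zero.mp h0 with h1 | h1
  · left
    intro g
    have := hP g
    rw [h1, map_zero] at this
    exact (mul_eq_zero.mp this).resolve_left (pow_ne_zero _ (detG_ne_zero g))
  · right
    intro g
    have := hP' g
    rw [h1, map_zero] at this
    exact (mul_eq_zero.mp this).resolve_left (pow_ne_zero _ (detG_ne_zero g))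

end Regular

/-! ### Translations of polynomials in matrix entries and their adjoints. -/

section Translate

variable {S : Type*} {n : ℕ} [DecidableEq S]

/-- The matrix of left multiplication by a family of matrices on families of matrices. -/
def leftMulMatrix (k : S → Matrix (Fin n) (Fin n) ℂ) :
    Matrix (S × Fin n × Fin n) (S × Fin n × Fin n) ℂ :=
  fun p q => if p.1 = q.1 ∧ p.2.2 = q.2.2 then k p.1 p.2.1 q.2.1 else 0

theorem leftMulMatrix_transpose (k : S → Matrix (Fin n) (Fin n) ℂ) :
    (leftMulMatrix k).transpose = leftMulMatrix fun s => (k s).transpose := by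
  ext ⟨s, i, j⟩ ⟨t, l, m⟩
  simp only [Matrix.transpose_apply, leftMulMatrix, eq_comm (a := t), eq_comm (a := m)]
  split_ifs with h
  · rw [h.1]
  · rfl

theorem leftMulMatrix_conjTranspose (k : S → Matrix (Fin n) (Fin n) ℂ) :
    (leftMulMatrix k).conjTranspose = leftMulMatrix fun s => (k s).conjTranspose := by
  ext ⟨s, i, j⟩ ⟨t, l, m⟩
  simp only [Matrix.conjTranspose_apply, leftMulMatrix, eq_comm (a := t), eq_comm (a := m)]
  split_ifs with h
  · rw [h.1]
  · simp

variable [Fintype S]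

theorem leftMulMatrix_mulVec (k M : S → Matrix (Fin n) (Fin n) ℂ) :
    (leftMulMatrix k).mulVec (entries M) = entries fun s => k s * M s := by
  ext ⟨s, i, j⟩
  simp only [Matrix.mulVec, dotProduct, leftMulMatrix, entries, Fintype.sum_prod_type,
    Matrix.mul_apply, ite_and, ite_mul, zero_mul]
  rw [Finset.sum_eq_single s]
  · exact Finset.sum_congr rfl fun l _ => by simp
  · intro t _ hts
    simp [hts.symm]
  · simp

/-- Left translation of polynomials. -/
def translate (k : S → GLn n) : MatPoly S n →ₐ[ℂ] MatPoly S n :=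
  subst (leftMulMatrix fun s => (k s : Matrix (Fin n) (Fin n) ℂ))

theorem evalG_translate (k g : S → GLn n) (P : MatPoly S n) :
    evalG g (translate k P) = evalG (k * g) P := by
  rw [evalG_eq_eval, translate, eval_subst, leftMulMatrix_mulVec, evalG_eq_eval]
  rfl

/-- The transpose of an invertible matrix. -/
def GLn.transpose (g : GLn n) : GLn n where
  val := (g : Matrix (Fin n) (Fin n) ℂ).transpose
  inv := ((g⁻¹ : GLn n) : Matrix (Fin n) (Fin n) ℂ).transpose
  val_inv := by rw [← Matrix.transpose_mul, ← Units.val_mul, inv_mul_cancel]; simp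
  inv_val := by rw [← Matrix.transpose_mul, ← Units.val_mul, mul_inv_cancel]; simp

/-- The conjugate transpose of an invertible matrix. -/
def GLn.conjTranspose (g : GLn n) : GLn n where
  val := (g : Matrix (Fin n) (Fin n) ℂ).conjTranspose
  inv := ((g⁻¹ : GLn n) : Matrix (Fin n) (Fin n) ℂ).conjTranspose
  val_inv := by rw [← Matrix.conjTranspose_mul, ← Units.val_mul, inv_mul_cancel]; simp
  inv_val := by rw [← Matrix.conjTranspose_mul, ← Units.val_mul, mul_inv_cancel]; simp

theorem fischer_translate (k : S → GLn n) (P Q : MatPoly S n) :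
    fischer (translate k P) Q = fischer P (translate (fun s => (k s).transpose) Q) := by
  rw [translate, fischer_subst, leftMulMatrix_transpose]
  rfl

theorem hermitianFischer_translate (k : S → GLn n) (P Q : MatPoly S n) :
    hermitianFischer (translate k P) Q =
      hermitianFischer P (translate (fun s => (k s).conjTranspose) Q) := by
  rw [translate, hermitianFischer_subst, leftMulMatrix_conjTranspose]
  rfl

theorem translate_mul (k k' : S → GLn n) (P : MatPoly S n) :
    translate k (translate k' P) = translate (k' * k) P :=
  eq_of_evalG fun g => by simp only [evalG_translate, mul_assoc]

theorem translate_one (P : MatPoly S n) : translate 1 P = P :=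
  eq_of_evalG fun g => by rw [evalG_translate, one_mul]

end Translate

/-! ### Density of the big cell -/

section BigCell

variable {n : ℕ}

/-- `a` is a lower triangular matrix. -/
def IsLower (a : GLn n) : Prop :=
  (a : Matrix (Fin n) (Fin n) ℂ).BlockTriangular OrderDual.toDual

theorem IsUpper.apply_eq_zero {b : GLn n} (h : IsUpper b) {i j : Fin n} (hij : j < i) :
    (b : Matrix (Fin n) (Fin n) ℂ) i j = 0 := h hij

theorem IsLower.apply_eq_zero {b : GLn n} (h : IsLower b) {i j : Fin n} (hij : i < j) :
    (b : Matrix (Fin n) (Fin n) ℂ) i j = 0 := h hij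

theorem IsUpper.mul {a b : GLn n} (ha : IsUpper a) (hb : IsUpper b) : IsUpper (a * b) :=
  Matrix.BlockTriangular.mul ha hb

theorem IsLower.mul {a b : GLn n} (ha : IsLower a) (hb : IsLower b) : IsLower (a * b) :=
  Matrix.BlockTriangular.mul ha hb

theorem isUpper_one : IsUpper (1 : GLn n) := Matrix.blockTriangular_one

theorem isLower_one : IsLower (1 : GLn n) := Matrix.blockTriangular_one

theorem IsUpper.det {b : GLn n} (h : IsUpper b) :
    (b : Matrix (Fin n) (Fin n) ℂ).det = ∏ i, (b : Matrix (Fin n) (Fin n) ℂ) i i :=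
  Matrix.det_of_isUpperTriangular h

theorem IsLower.det {b : GLn n} (h : IsLower b) :
    (b : Matrix (Fin n) (Fin n) ℂ).det = ∏ i, (b : Matrix (Fin n) (Fin n) ℂ) i i :=
  Matrix.det_of_isLowerTriangular _ h

theorem IsUpper.diag_ne_zero {b : GLn n} (h : IsUpper b) (i : Fin n) :
    (b : Matrix (Fin n) (Fin n) ℂ) i i ≠ 0 := by
  have := GLn.det_ne_zero b
  rw [h.det, Finset.prod_ne_zero_iff] at this
  exact this i (Finset.mem_univ i)

theorem IsLower.diag_ne_zero {b : GLn n} (h : IsLower b) (i : Fin n) :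
    (b : Matrix (Fin n) (Fin n) ℂ) i i ≠ 0 := by
  have := GLn.det_ne_zero b
  rw [h.det, Finset.prod_ne_zero_iff] at this
  exact this i (Finset.mem_univ i)

/-- The transvection `1 + c E_{ij}` as an invertible matrix. -/
def transv {i j : Fin n} (h : i ≠ j) (c : ℂ) : GLn n where
  val := Matrix.transvection i j c
  inv := Matrix.transvection i j (-c)
  val_inv := by rw [Matrix.transvection_mul_transvection_same _ _ h]; simp
  inv_val := by rw [Matrix.transvection_mul_transvection_same _ _ h]; simp

theorem transv_apply {i j : Fin n} (h : i ≠ j) (c : ℂ) (p q : Fin n) :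
    (transv h c : Matrix (Fin n) (Fin n) ℂ) p q =
      (if p = q then 1 else 0) + (if p = i ∧ q = j then c else 0) := by
  simp [transv, Matrix.transvection, Matrix.one_apply, Matrix.single_apply, eq_comm]

theorem transv_mul_apply {i j : Fin n} (h : i ≠ j) (c : ℂ) (M : Matrix (Fin n) (Fin n) ℂ)
    (p q : Fin n) : ((transv h c : Matrix (Fin n) (Fin n) ℂ) * M) p q =
      M p q + (if p = i then c * M j q else 0) := by
  split_ifs with hp
  · subst hp
    exact Matrix.transvection_mul_apply_same _ _ _ _ _
  · rw [add_zero]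
    exact Matrix.transvection_mul_apply_of_ne _ _ _ _ hp _ _

theorem mul_transv_apply {i j : Fin n} (h : i ≠ j) (c : ℂ) (M : Matrix (Fin n) (Fin n) ℂ)
    (p q : Fin n) : (M * (transv h c : Matrix (Fin n) (Fin n) ℂ)) p q =
      M p q + (if q = j then c * M p i else 0) := by
  split_ifs with hp
  · subst hp
    exact Matrix.mul_transvection_apply_same _ _ _ _ _
  · rw [add_zero]
    exact Matrix.mul_transvection_apply_of_ne _ _ _ _ hp _ _

theorem transv_inv {i j : Fin n} (h : i ≠ j) (c : ℂ) : (transv h c)⁻¹ = transv h (-c) := by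
  refine inv_eq_of_mul_eq_one_left (Units.ext ?_)
  exact (transv h c).inv_val

theorem isUpper_transv {i j : Fin n} (h : i < j) (c : ℂ) : IsUpper (transv h.ne c) := by
  intro p q hpq
  have hpq : q < p := hpq
  rw [transv_apply, if_neg hpq.ne', if_neg, add_zero]
  rintro ⟨rfl, rfl⟩
  exact lt_asymm h hpq

theorem isLower_transv {i j : Fin n} (h : j < i) (c : ℂ) : IsLower (transv h.ne' c) := by
  intro p q hpq
  have hpq : p < q := hpq
  rw [transv_apply, if_neg hpq.ne, if_neg, add_zero]
  rintro ⟨rfl, rfl⟩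
  exact lt_asymm h hpq

theorem one_add_commutator {R : Type*} [Ring R] {x y : R} (hxx : x * x = 0) (hyy : y * y = 0)
    (hyx : y * x = 0) : (1 + x) * (1 + y) * ((1 + -x) * (1 + -y)) = 1 + x * y := by
  have h1 : (1 + x) * (1 + y) * ((1 + -x) * (1 + -y)) = 1 + x * y - x * x + x * x * y - y * x -
      y * y + y * x * y - x * (y * x) - x * (y * y) + x * (y * x) * y := by noncomm_ring
  rw [h1, hxx, hyy, hyx]
  simp

/-- Reduces an arbitrary transvection to shorter ones: the commutator of `1 + c E_ik` and `1 + E_kj`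
is `1 + c E_ij`. -/
theorem transv_commutator {i k j : Fin n} (hik : i ≠ k) (hkj : k ≠ j) (hij : i ≠ j) (c : ℂ) :
    transv hij c = transv hik c * transv hkj 1 * (transv hik (-c) * transv hkj (-1)) := by
  refine Units.ext ?_
  have h := one_add_commutator (x := Matrix.single i k c) (y := Matrix.single k j (1 : ℂ))
    (Matrix.single_mul_single_of_ne _ _ _ _ hik.symm _)
    (Matrix.single_mul_single_of_ne _ _ _ _ hkj.symm _)
    (Matrix.single_mul_single_of_ne _ _ _ _ hij.symm _)
  rw [Matrix.single_mul_single_same, mul_one] at h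
  simp only [Units.val_mul, transv, Matrix.transvection]
  rw [← h]
  congr 2 <;> exact congrArg _ (Matrix.single_neg _ _ _)

/-- A simple transvection times a lower triangular matrix lies in the big cell, up to a simple
transvection on the right, as soon as the relevant pivot is nonzero. -/
theorem isLower_transv_mul {i j : Fin n} (h : (i : ℕ) + 1 = j) (hij : i ≠ j) {a : GLn n}
    (ha : IsLower a) (c : ℂ)
    (hd : (a : Matrix (Fin n) (Fin n) ℂ) i i + c * (a : Matrix (Fin n) (Fin n) ℂ) j i ≠ 0) :
    ∃ t : ℂ, IsLower (transv hij c * a * transv hij (-t)) := by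
  -- Row `i` of the product with the transvection has entries `a i i + c * a j i` and `c * a j j` in
  -- columns `i` and `j`; `t` is their ratio, so subtracting `t` times column `i` from column `j`
  -- clears the only entry above the diagonal.
  refine ⟨c * (a : Matrix (Fin n) (Fin n) ℂ) j j /
    ((a : Matrix (Fin n) (Fin n) ℂ) i i + c * (a : Matrix (Fin n) (Fin n) ℂ) j i), ?_⟩
  intro p q hpq
  have hpq : p < q := hpq
  rw [Units.val_mul, mul_transv_apply, Units.val_mul, transv_mul_apply, transv_mul_apply,
    ha.apply_eq_zero hpq, zero_add]
  have hlt : i < j := by rw [Fin.lt_def]; omega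
  by_cases hp : p = i
  · subst hp
    rw [if_pos rfl, if_pos rfl]
    by_cases hq : q = j
    · subst hq
      rw [if_pos rfl]
      field_simp
      ring
    · rw [if_neg hq, ha.apply_eq_zero (i := j) (j := q)]
      · simp
      · rw [Fin.lt_def] at *
        have : (q : ℕ) ≠ j := fun h => hq (Fin.ext h)
        omega
  · rw [if_neg hp, if_neg hp, zero_add, add_zero]
    by_cases hq : q = j
    · subst hq
      rw [if_pos rfl, ha.apply_eq_zero (i := p) (j := i), mul_zero]
      rw [Fin.lt_def] at *
      have : (p : ℕ) ≠ i := fun h => hp (Fin.ext h)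
      omega
    · rw [if_neg hq]

variable {S : Type*} [Fintype S] [DecidableEq S]

/-- Vanishing on the big cell. -/
def VanishesOnBigCell (P : MatPoly S n) : Prop :=
  ∀ a b : S → GLn n, (∀ s, IsLower (a s)) → (∀ s, IsUpper (b s)) → evalG (a * b) P = 0

/-- The families whose translations preserve vanishing on the big cell. -/
def bigCellStabilizer (S : Type*) [Fintype S] [DecidableEq S] (n : ℕ) :
    Submonoid (S → GLn n) where
  carrier := {k | ∀ P : MatPoly S n, VanishesOnBigCell P → VanishesOnBigCell (translate k P)}
  one_mem' P hP := by rwa [translate_one]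
  mul_mem' {k k'} h h' P hP := by
    rw [← translate_mul]
    exact h' _ (h P hP)

/-- The family with value `g` at `s` and `1` elsewhere. -/
def single {S : Type*} [DecidableEq S] (s : S) (g : GLn n) : S → GLn n := Pi.mulSingle s g

section Single

variable {S : Type*} [DecidableEq S]

@[simp] theorem single_same (s : S) (g : GLn n) : single s g s = g :=
  Pi.mulSingle_eq_same (M := fun _ => GLn n) s g

theorem single_of_ne {s t : S} (h : t ≠ s) (g : GLn n) : single s g t = 1 :=
  Pi.mulSingle_eq_of_ne (M := fun _ => GLn n) h g

theorem single_mul (s : S) (g h : GLn n) : single s (g * h) = single s g * single s h :=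
  Pi.mulSingle_mul (f := fun _ => GLn n) s g h

theorem single_inv (s : S) (g : GLn n) : single s g⁻¹ = (single s g)⁻¹ :=
  Pi.mulSingle_inv (f := fun _ => GLn n) s g

theorem isLower_single (s : S) {k : GLn n} (hk : IsLower k) (t : S) : IsLower (single s k t) := by
  by_cases h : t = s
  · subst h
    simpa using hk
  · simpa [single_of_ne h] using isLower_one

theorem isUpper_single (s : S) {k : GLn n} (hk : IsUpper k) (t : S) : IsUpper (single s k t) := by
  by_cases h : t = s
  · subst h
    simpa using hk
  · simpa [single_of_ne h] using isUpper_one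

theorem continuous_single {Z : Type*} [TopologicalSpace Z] (s : S) (γ : Z → GLn n)
    (h : ∀ p q, Continuous fun z => (γ z : Matrix (Fin n) (Fin n) ℂ) p q) (t : S) (p q : Fin n) :
    Continuous fun z => (single s (γ z) t : Matrix (Fin n) (Fin n) ℂ) p q := by
  by_cases hts : t = s
  · subst hts
    simpa using h p q
  · simp only [single_of_ne hts]
    exact continuous_const

end Single

theorem mem_bigCellStabilizer_of_isLower {k : S → GLn n} (hk : ∀ s, IsLower (k s)) :
    k ∈ bigCellStabilizer S n := by
  intro P hP a b ha hb
  rw [evalG_translate, ← mul_assoc]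
  exact hP _ _ (fun s => (hk s).mul (ha s)) hb

/-- The translate stays in the big cell unless the pivot `a i i + c * a j i` vanishes, which happens
for at most one `c` since `a i i ≠ 0`. The value is continuous in `c`, so it vanishes at the
exceptional `c` as well. -/
theorem simple_transv_mem_bigCellStabilizer (s : S) {i j : Fin n} (h : (i : ℕ) + 1 = j)
    (hij : i ≠ j) (c : ℂ) : single s (transv hij c) ∈ bigCellStabilizer S n := by
  intro P hP a b ha hb
  rw [evalG_translate]
  have hlt : i < j := by rw [Fin.lt_def]; omega
  let f : ℂ → ℂ := fun c => evalG (single s (transv hij c) * (a * b)) P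
  have hf : Continuous f := by
    refine continuous_of_mem_Reg (fun c => single s (transv hij c)) (fun t p q => ?_)
      (Reg_mul_right (a * b) (evalG_mem_Reg P))
    refine continuous_single s _ (fun p q => ?_) t p q
    simp only [transv_apply]
    split_ifs <;> fun_prop
  let d : ℂ → ℂ := fun c => (a s : Matrix (Fin n) (Fin n) ℂ) i i +
    c * (a s : Matrix (Fin n) (Fin n) ℂ) j i
  have hd : ({c | d c = 0} : Set ℂ).Subsingleton := by
    intro c₁ h₁ c₂ h₂
    have h₁ : d c₁ = 0 := h₁
    have h₂ : d c₂ = 0 := h₂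
    have h0 := (ha s).diag_ne_zero i
    by_cases hji : (a s : Matrix (Fin n) (Fin n) ℂ) j i = 0
    · simp [d, hji, h0] at h₁
    · exact mul_right_cancel₀ hji (add_left_cancel (h₁.trans h₂.symm))
  have hdense : Dense ({c | d c = 0}ᶜ : Set ℂ) := hd.countable.dense_compl ℂ
  have hz : f = fun _ => 0 := by
    refine hf.ext_on hdense continuous_const fun c hc => ?_
    obtain ⟨t, ht⟩ := isLower_transv_mul h hij (ha s) c hc
    -- The factors with `-t` and `t` cancel between the lower and the upper part.
    have := hP (single s (transv hij c) * a * single s (transv hij (-t)))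
      (single s (transv hij t) * b) (fun u => ?_)
      (fun u => (isUpper_single s (isUpper_transv hlt t) u).mul (hb u))
    · rw [← transv_inv, single_inv, mul_assoc, inv_mul_cancel_left, mul_assoc] at this
      exact this
    · by_cases hu : u = s
      · subst hu
        simpa using ht
      · simpa [single_of_ne hu] using ha u
  exact congrFun hz c

theorem transv_mem_bigCellStabilizer (s : S) {i j : Fin n} (hij : i ≠ j) (c : ℂ) :
    single s (transv hij c) ∈ bigCellStabilizer S n := by
  rcases lt_or_gt_of_ne hij with h | h
  · obtain ⟨m, hm⟩ : ∃ m : ℕ, (i : ℕ) + m + 1 = j := ⟨j - i - 1, by rw [Fin.lt_def] at h; omega⟩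
    induction m generalizing j c with
    | zero => exact simple_transv_mem_bigCellStabilizer s hm hij c
    | succ m ih =>
      let k : Fin n := ⟨i + m + 1, by omega⟩
      have hik : i < k := by rw [Fin.lt_def]; simp only [k]; omega
      have hkj : k < j := by rw [Fin.lt_def]; simp only [k]; omega
      have hk := ih hik.ne (hm := rfl) (h := hik)
      have hk' := simple_transv_mem_bigCellStabilizer s (i := k) (j := j) hm hkj.ne
      rw [transv_commutator hik.ne hkj.ne hij, single_mul, single_mul, single_mul]
      exact mul_mem (mul_mem (hk _) (hk' _)) (mul_mem (hk _) (hk' _))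
  · exact mem_bigCellStabilizer_of_isLower (isLower_single s (isLower_transv h c))

/-- By Gaussian elimination every invertible matrix is a product of transvections and an invertible
diagonal matrix, all of which lie in this submonoid. -/
theorem single_mem_bigCellStabilizer (s : S) (g : GLn n) :
    single s g ∈ bigCellStabilizer S n := by
  suffices h : ∀ M : Matrix (Fin n) (Fin n) ℂ, M.det ≠ 0 →
      ∀ g : GLn n, (g : Matrix (Fin n) (Fin n) ℂ) = M →
        single s g ∈ bigCellStabilizer S n from h _ (GLn.det_ne_zero g) g rfl
  intro M hM
  refine Matrix.diagonal_transvection_induction_of_det_ne_zero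
    (fun M => ∀ g : GLn n, (g : Matrix (Fin n) (Fin n) ℂ) = M →
        single s g ∈ bigCellStabilizer S n) M hM ?_ ?_ ?_
  · intro D _ g hg
    refine mem_bigCellStabilizer_of_isLower (isLower_single s ?_)
    rw [IsLower, hg]
    exact Matrix.blockTriangular_diagonal D
  · rintro ⟨i, j, hij, c⟩ g hg
    rw [show g = transv hij c from Units.ext hg]
    exact transv_mem_bigCellStabilizer s hij c
  · intro A B hA hB h h' g hg
    have : g = Matrix.GeneralLinearGroup.mkOfDetNeZero A hA *
        Matrix.GeneralLinearGroup.mkOfDetNeZero B hB := Units.ext hg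
    rw [this, single_mul]
    exact mul_mem (h _ rfl) (h' _ rfl)

theorem VanishesOnBigCell.eq_zero {P : MatPoly S n} (h : VanishesOnBigCell P) : P = 0 := by
  refine eq_zero_of_evalG fun g => ?_
  have hg : g ∈ bigCellStabilizer S n :=
    Submonoid.pi_mem_of_mulSingle_mem g fun s => single_mem_bigCellStabilizer s (g s)
  have := hg P h 1 1 (fun _ => isLower_one) (fun _ => isUpper_one)
  rwa [evalG_translate, mul_one, mul_one] at this

theorem Reg_eq_zero_of_bigCell {f : (S → GLn n) → ℂ} (hf : f ∈ Reg S n)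
    (h : ∀ a b : S → GLn n, (∀ s, IsLower (a s)) → (∀ s, IsUpper (b s)) → f (a * b) = 0)
    (g : S → GLn n) : f g = 0 := by
  obtain ⟨K, hK⟩ := exists_poly_of_mem_Reg hf
  obtain ⟨P, hP⟩ := hK K le_rfl
  have hP0 : P = 0 := VanishesOnBigCell.eq_zero fun a b ha hb => by
    rw [← hP, h a b ha hb, mul_zero]
  have := hP g
  rw [hP0, map_zero] at this
  exact (mul_eq_zero.mp this).resolve_left (pow_ne_zero _ (detG_ne_zero g))

end BigCell

/-! ### Highest weight representations and their matrix coefficients -/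

section HighestWeight

variable {S : Type*} [Fintype S] {n : ℕ}

/-- The character of the group of families of triangular matrices given by `wt`. -/
def charB (wt : S → Fin n → ℤ) (b : S → GLn n) : ℂ := ∏ s, borelChar (wt s) (b s)

theorem charB_conjTranspose (wt : S → Fin n → ℤ) (b : S → GLn n) :
    charB wt (fun s => (b s).conjTranspose) = starRingEnd ℂ (charB wt b) := by
  simp [charB, borelChar, GLn.conjTranspose]

theorem borelChar_ne_zero_of_isLower (wt : Fin n → ℤ) {b : GLn n} (hb : IsLower b) :
    borelChar wt b ≠ 0 :=
  Finset.prod_ne_zero_iff.mpr fun i _ => zpow_ne_zero _ (hb.diag_ne_zero i)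

theorem charB_add_const (wt : S → Fin n → ℤ) (K : ℕ) {b : S → GLn n}
    (h0 : ∀ s i, (b s : Matrix (Fin n) (Fin n) ℂ) i i ≠ 0)
    (hdet : ∀ s, (b s : Matrix (Fin n) (Fin n) ℂ).det =
      ∏ i, (b s : Matrix (Fin n) (Fin n) ℂ) i i) :
    charB (fun s i => wt s i + K) b = detG b ^ K * charB wt b := by
  simp only [charB, detG, hdet, ← Finset.prod_pow, ← Finset.prod_mul_distrib, borelChar]
  refine Finset.prod_congr rfl fun s _ => Finset.prod_congr rfl fun i _ => ?_
  rw [zpow_add₀ (h0 s i), zpow_natCast, mul_comm]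

theorem charB_add_const_of_isUpper (wt : S → Fin n → ℤ) (K : ℕ) {b : S → GLn n}
    (hb : ∀ s, IsUpper (b s)) :
    charB (fun s i => wt s i + K) b = detG b ^ K * charB wt b :=
  charB_add_const wt K (fun s => (hb s).diag_ne_zero) fun s => (hb s).det

theorem charB_add_const_of_isLower (wt : S → Fin n → ℤ) (K : ℕ) {b : S → GLn n}
    (hb : ∀ s, IsLower (b s)) :
    charB (fun s i => wt s i + K) b = detG b ^ K * charB wt b :=
  charB_add_const wt K (fun s => (hb s).diag_ne_zero) fun s => (hb s).det

theorem GLn.isUpper_conjTranspose {a : GLn n} (ha : IsLower a) : IsUpper a.conjTranspose := by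
  intro i j hij
  change star ((a : Matrix (Fin n) (Fin n) ℂ) j i) = 0
  rw [ha.apply_eq_zero (show j < i from hij), star_zero]

variable [DecidableEq S]

/-- A translation-stable space of polynomials contains a lowest weight vector. -/
theorem exists_lowest_weight_poly (wt : S → Fin n → ℤ) (N : Submodule ℂ (MatPoly S n))
    [FiniteDimensional ℂ N] (hN : N ≠ ⊥) (hinv : ∀ k, ∀ P ∈ N, translate k P ∈ N)
    (hwt : ∀ P ∈ N, ∀ g b : S → GLn n, (∀ s, IsUpper (b s)) →
      evalG (g * b) P = charB wt b * evalG g P) :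
    ∃ K ∈ N, evalG 1 K = 1 ∧ ∀ a g : S → GLn n, (∀ s, IsLower (a s)) →
      evalG (a * g) K = charB wt a * evalG g K := by
  -- `K` is the reproducing kernel at the identity: pairing with `K` evaluates at `1`. For lower
  -- triangular `a`, the adjoint of translation by `a` is translation by the upper triangular
  -- conjugate transpose, which multiplies the value at `1` by a character. Hence `K` is an
  -- eigenvector of `a`.
  obtain ⟨K, hK, h⟩ := exists_hermitianFischer_eq N (evalG (1 : S → GLn n)).toLinearMap
  have h : ∀ P ∈ N, hermitianFischer K P = evalG 1 P := h
  have htr : ∀ a : S → GLn n, (∀ s, IsLower (a s)) → translate a K = charB wt a • K := by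
    intro a ha
    have hmem : translate a K - charB wt a • K ∈ N :=
      N.sub_mem (hinv a K hK) (N.smul_mem _ hK)
    have hz : ∀ P ∈ N, hermitianFischer (translate a K - charB wt a • K) P = 0 := by
      intro P hP
      have h1 : hermitianFischer (translate a K) P =
          starRingEnd ℂ (charB wt a) * hermitianFischer K P := by
        rw [hermitianFischer_translate, h _ (hinv _ _ hP), evalG_translate, h P hP,
          ← charB_conjTranspose, mul_one]
        have := hwt P hP 1 (fun s => (a s).conjTranspose)
          fun s => GLn.isUpper_conjTranspose (ha s)
        rwa [one_mul] at this
      rw [hermitianFischer, map_sub, map_sub, LinearMap.sub_apply, conjPoly_smul, map_smul,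
        LinearMap.smul_apply, smul_eq_mul, ← hermitianFischer, ← hermitianFischer, h1, sub_self]
    exact sub_eq_zero.mp (hermitianFischer_self_eq_zero (hz _ hmem))
  -- The value of `K` at `1` is its squared norm. If `K` were zero, every element of `N` would
  -- vanish at `1`, hence everywhere by stability under translation.
  have h1 : evalG 1 K ≠ 0 := by
    intro h0
    rw [← h K hK] at h0
    have hK0 := hermitianFischer_self_eq_zero h0
    refine hN ((Submodule.eq_bot_iff N).mpr fun P hP => eq_zero_of_evalG fun g => ?_)
    have := h _ (hinv g P hP)
    rw [evalG_translate, mul_one, hK0] at this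
    rw [← this]
    simp [hermitianFischer]
  refine ⟨(evalG 1 K)⁻¹ • K, N.smul_mem _ hK, ?_, fun a g ha => ?_⟩
  · rw [map_smul, smul_eq_mul, inv_mul_cancel₀ h1]
  · rw [map_smul, map_smul, ← evalG_translate, htr a ha, map_smul]
    simp only [smul_eq_mul]
    ring

/-- A nonzero translation-stable space of polynomials of weight `wt` contains all polynomials of
weight `wt`. -/
theorem mem_of_weight (wt : S → Fin n → ℤ) (N : Submodule ℂ (MatPoly S n))
    [FiniteDimensional ℂ N] (hN : N ≠ ⊥) (hinv : ∀ k, ∀ P ∈ N, translate k P ∈ N)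
    (hwt : ∀ P ∈ N, ∀ g b : S → GLn n, (∀ s, IsUpper (b s)) →
      evalG (g * b) P = charB wt b * evalG g P)
    (P : MatPoly S n) (hP : ∀ g b : S → GLn n, (∀ s, IsUpper (b s)) →
      evalG (g * b) P = charB wt b * evalG g P) : P ∈ N := by
  -- If `P` is not in `N`, its component `P - Q` orthogonal to `N` generates a stable space `N'` of
  -- the same weight, still orthogonal to `N`. Both spaces contain a lowest weight polynomial with
  -- value `1` at the identity. The two weights determine such a polynomial on the big cell, so the
  -- two coincide, against orthogonality.
  obtain ⟨Q, hQ, hQP⟩ := exists_hermitianFischer_proj N P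
  by_cases h0 : P - Q = 0
  · rwa [sub_eq_zero.mp h0]
  exfalso
  let N' : Submodule ℂ (MatPoly S n) :=
    Submodule.span ℂ (Set.range fun k : S → GLn n => translate k (P - Q))
  have hfd : FiniteDimensional ℂ N' := by
    have hle : N' ≤ restrictTotalDegree _ ℂ (P - Q).totalDegree := by
      refine Submodule.span_le.mpr ?_
      rintro _ ⟨k, rfl⟩
      exact (mem_restrictTotalDegree _ _ _).mpr (totalDegree_subst_le _ _)
    exact Submodule.finiteDimensional_of_le hle
  have hmem : P - Q ∈ N' := Submodule.subset_span ⟨1, translate_one _⟩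
  have hN' : N' ≠ ⊥ := fun h => h0 (by rwa [h, Submodule.mem_bot] at hmem)
  have hinv' : ∀ k, ∀ R ∈ N', translate k R ∈ N' := by
    intro k R hR
    induction hR using Submodule.span_induction with
    | mem x hx =>
      obtain ⟨k', rfl⟩ := hx
      exact Submodule.subset_span ⟨k' * k, (translate_mul _ _ _).symm⟩
    | zero => rw [map_zero]; exact N'.zero_mem
    | add x y _ _ h h' => rw [map_add]; exact N'.add_mem h h'
    | smul c x _ h => rw [map_smul]; exact N'.smul_mem c h
  have hwt' : ∀ R ∈ N', ∀ g b : S → GLn n, (∀ s, IsUpper (b s)) →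
      evalG (g * b) R = charB wt b * evalG g R := by
    intro R hR g b hb
    induction hR using Submodule.span_induction with
    | mem x hx =>
      obtain ⟨k, rfl⟩ := hx
      simp only [evalG_translate, map_sub, ← mul_assoc, hP _ _ hb, hwt Q hQ _ _ hb]
      ring
    | zero => simp
    | add x y _ _ h h' => rw [map_add, map_add, h, h', mul_add]
    | smul c x _ h => rw [map_smul, map_smul, h, smul_eq_mul, smul_eq_mul]; ring
  have horth : ∀ R ∈ N', ∀ T ∈ N, hermitianFischer R T = 0 := by
    intro R hR T hT
    induction hR using Submodule.span_induction with
    | mem x hx =>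
      obtain ⟨k, rfl⟩ := hx
      rw [hermitianFischer_translate, hQP _ (hinv _ _ hT)]
    | zero => simp [hermitianFischer]
    | add x y _ _ h h' =>
      simp only [hermitianFischer, map_add, LinearMap.add_apply] at h h' ⊢
      rw [h, h', add_zero]
    | smul c x _ h =>
      simp only [hermitianFischer, conjPoly_smul, map_smul, LinearMap.smul_apply] at h ⊢
      rw [h, smul_zero]
  obtain ⟨K, hK, hK1, hKa⟩ := exists_lowest_weight_poly wt N hN hinv hwt
  obtain ⟨K', hK', hK1', hKa'⟩ := exists_lowest_weight_poly wt N' hN' hinv' hwt'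
  have heq : K - K' = 0 := VanishesOnBigCell.eq_zero fun a b ha hb => by
    have e1 := hwt K hK 1 b hb
    have e2 := hwt' K' hK' 1 b hb
    rw [one_mul] at e1 e2
    rw [map_sub, hKa a b ha, hKa' a b ha, e1, e2, hK1, hK1', sub_self]
  rw [← sub_eq_zero.mp heq] at hK'
  have := hermitianFischer_self_eq_zero (horth K hK' K hK)
  rw [this, map_zero] at hK1
  exact zero_ne_one hK1

variable {V : Type*} [AddCommGroup V] [Module ℂ V]

/-- An algebraic representation of `S → GL_n(ℂ)` that is generated by a highest weight vector `v`
of weight `wt`. -/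
structure IsHighestWeight (wt : S → Fin n → ℤ) (ρ : Representation ℂ (S → GLn n) V) (v : V) :
    Prop where
  finiteDimensional : FiniteDimensional ℂ V
  regular : ∀ (l : Module.Dual ℂ V) (u : V), (fun g => l (ρ g u)) ∈ Reg S n
  eigen : ∀ b : S → GLn n, (∀ s, IsUpper (b s)) → ρ b v = charB wt b • v
  cyclic : Submodule.span ℂ (Set.range fun g => ρ g v) = ⊤
  ne_zero : v ≠ 0

namespace IsHighestWeight

variable {wt : S → Fin n → ℤ} {ρ : Representation ℂ (S → GLn n) V} {v : V}

omit [DecidableEq S] in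
theorem ext_dual (h : IsHighestWeight wt ρ v) {W : Type*} [AddCommGroup W] [Module ℂ W]
    {l l' : V →ₗ[ℂ] W} (hl : ∀ g, l (ρ g v) = l' (ρ g v)) : l = l' :=
  LinearMap.ext_on_range h.cyclic hl

omit [DecidableEq S] in
/-- The matrix coefficients against the highest weight vector, multiplied by a power of the
determinants, are polynomials. -/
theorem exists_polyMap (h : IsHighestWeight wt ρ v) :
    ∃ K₀ : ℕ, ∀ K ≥ K₀, ∃ Φ : Module.Dual ℂ V →ₗ[ℂ] MatPoly S n,
      ∀ l g, evalG g (Φ l) = detG g ^ K * l (ρ g v) := by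
  have := h.finiteDimensional
  let b := Module.finBasis ℂ (Module.Dual ℂ V)
  choose K hK using fun i => exists_poly_of_mem_Reg (h.regular (b i) v)
  refine ⟨∑ i, K i, fun K' hK' => ?_⟩
  choose P hP using fun i => hK i K'
    ((Finset.single_le_sum (f := K) (fun _ _ => Nat.zero_le _) (Finset.mem_univ i)).trans hK')
  refine ⟨b.constr ℂ P, fun l g => ?_⟩
  have key : (evalG g).toLinearMap ∘ₗ b.constr ℂ P =
      detG g ^ K' • Module.Dual.eval ℂ V (ρ g v) := by
    refine b.ext fun i => ?_
    simp only [LinearMap.comp_apply, Module.Basis.constr_basis, AlgHom.toLinearMap_apply,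
      LinearMap.smul_apply, Module.Dual.eval_apply, smul_eq_mul]
    exact (hP i g).symm
  exact LinearMap.congr_fun key l

/-- Puts the matrix coefficients in the form required by `exists_lowest_weight_poly` and
`mem_of_weight`; the power of the determinant shifts every weight by `K`. -/
theorem range_polyMap (h : IsHighestWeight wt ρ v) {K : ℕ}
    {Φ : Module.Dual ℂ V →ₗ[ℂ] MatPoly S n}
    (hΦ : ∀ l g, evalG g (Φ l) = detG g ^ K * l (ρ g v)) :
    FiniteDimensional ℂ (LinearMap.range Φ) ∧ LinearMap.range Φ ≠ ⊥ ∧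
    (∀ k, ∀ P ∈ LinearMap.range Φ, translate k P ∈ LinearMap.range Φ) ∧
    ∀ P ∈ LinearMap.range Φ, ∀ g b : S → GLn n, (∀ s, IsUpper (b s)) →
      evalG (g * b) P = charB (fun s i => wt s i + K) b * evalG g P := by
  have := h.finiteDimensional
  refine ⟨inferInstance, ?_, ?_, ?_⟩
  · intro h0
    obtain ⟨l, hl⟩ : ∃ l : Module.Dual ℂ V, l v ≠ 0 := by
      by_contra! hl
      exact h.ne_zero ((Module.forall_dual_apply_eq_zero_iff ℂ v).mp hl)
    have h1 : Φ l = 0 := by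
      rw [LinearMap.range_eq_bot.mp h0, LinearMap.zero_apply]
    have h2 := hΦ l 1
    rw [h1, map_zero, map_one] at h2
    rcases mul_eq_zero.mp h2.symm with h3 | h3
    · exact pow_ne_zero _ (detG_ne_zero _) h3
    · exact hl h3
  · rintro k _ ⟨l, rfl⟩
    refine ⟨detG k ^ K • (l ∘ₗ ρ k), eq_of_evalG fun g => ?_⟩
    rw [map_smul, map_smul, hΦ, evalG_translate, hΦ, detG_mul, map_mul]
    simp only [smul_eq_mul, LinearMap.comp_apply, Module.End.mul_apply]
    ring
  · rintro _ ⟨l, rfl⟩ g b hb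
    rw [hΦ, hΦ, map_mul, Module.End.mul_apply, h.eigen b hb, map_smul, map_smul, detG_mul,
      charB_add_const_of_isUpper _ _ hb, smul_eq_mul]
    ring

/-- The dual of a highest weight representation contains a lowest weight functional. -/
theorem exists_lowest_weight_functional (h : IsHighestWeight wt ρ v) :
    ∃ l : Module.Dual ℂ V, l v = 1 ∧
      ∀ a : S → GLn n, (∀ s, IsLower (a s)) → ∀ u, l (ρ a u) = charB wt a * l u := by
  obtain ⟨K, hK⟩ := h.exists_polyMap
  obtain ⟨Φ, hΦ⟩ := hK K le_rfl
  obtain ⟨hfd, h0, hinv, hwt⟩ := h.range_polyMap hΦ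
  obtain ⟨_, ⟨l, rfl⟩, h1, ha⟩ := exists_lowest_weight_poly _ _ h0 hinv hwt
  have hdet1 : detG (1 : S → GLn n) = 1 := by simp [detG]
  refine ⟨l, ?_, fun a hlow u => ?_⟩
  · rw [hΦ, hdet1, one_pow, one_mul, map_one] at h1
    exact h1
  · have : l ∘ₗ ρ a = charB wt a • l := h.ext_dual fun g => by
      have := ha a g hlow
      rw [hΦ, hΦ, charB_add_const_of_isLower _ _ hlow, detG_mul, map_mul, mul_pow] at this
      have hne := pow_ne_zero K (detG_ne_zero a)
      have hne' := pow_ne_zero K (detG_ne_zero g)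
      refine mul_left_cancel₀ (mul_ne_zero hne hne') ?_
      rw [LinearMap.smul_apply, LinearMap.comp_apply, ← Module.End.mul_apply, this, smul_eq_mul]
      ring
    exact LinearMap.congr_fun this u

/-- Every regular function of weight `wt` is a matrix coefficient. -/
theorem exists_functional_eq (h : IsHighestWeight wt ρ v) {f : (S → GLn n) → ℂ}
    (hf : f ∈ Reg S n)
    (hfb : ∀ g b : S → GLn n, (∀ s, IsUpper (b s)) → f (g * b) = charB wt b * f g) :
    ∃ l : Module.Dual ℂ V, ∀ g, l (ρ g v) = f g := by
  obtain ⟨K₁, hK₁⟩ := h.exists_polyMap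
  obtain ⟨K₂, hK₂⟩ := exists_poly_of_mem_Reg hf
  obtain ⟨Φ, hΦ⟩ := hK₁ (K₁ + K₂) (by omega)
  obtain ⟨P, hP⟩ := hK₂ (K₁ + K₂) (by omega)
  obtain ⟨hfd, h0, hinv, hwt⟩ := h.range_polyMap hΦ
  obtain ⟨l, hl⟩ := mem_of_weight _ _ h0 hinv hwt P fun g b hb => by
    rw [← hP, ← hP, hfb g b hb, charB_add_const_of_isUpper _ _ hb, detG_mul]
    ring
  refine ⟨l, fun g => mul_left_cancel₀ (pow_ne_zero (K₁ + K₂) (detG_ne_zero g)) ?_⟩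
  rw [← hΦ, hl, hP]

end IsHighestWeight

end HighestWeight

/-! ### Triangular matrices and the transpose inverse automorphism -/

section Twist

variable {n : ℕ}

theorem IsUpper.inv {b : GLn n} (hb : IsUpper b) : IsUpper b⁻¹ := by
  have := b.invertible
  rw [IsUpper, Matrix.coe_units_inv]
  exact Matrix.blockTriangular_inv_of_blockTriangular hb

theorem IsUpper.mul_diag {a b : GLn n} (ha : IsUpper a) (hb : IsUpper b) (i : Fin n) :
    ((a * b : GLn n) : Matrix (Fin n) (Fin n) ℂ) i i =
      (a : Matrix (Fin n) (Fin n) ℂ) i i * (b : Matrix (Fin n) (Fin n) ℂ) i i := by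
  rw [Units.val_mul, Matrix.mul_apply, Finset.sum_eq_single i]
  · intro k _ hk
    rcases lt_or_gt_of_ne hk with h | h
    · rw [ha.apply_eq_zero h, zero_mul]
    · rw [hb.apply_eq_zero h, mul_zero]
  · simp

theorem IsUpper.inv_diag {b : GLn n} (hb : IsUpper b) (i : Fin n) :
    ((b⁻¹ : GLn n) : Matrix (Fin n) (Fin n) ℂ) i i =
      ((b : Matrix (Fin n) (Fin n) ℂ) i i)⁻¹ := by
  have h := hb.mul_diag hb.inv i
  rw [mul_inv_cancel, Units.val_one, Matrix.one_apply_eq] at h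
  exact (inv_eq_of_mul_eq_one_right h.symm).symm

/-- The antidiagonal permutation matrix. -/
def flip (n : ℕ) : GLn n where
  val := Matrix.of fun i j => if i = j.rev then 1 else 0
  inv := Matrix.of fun i j => if i = j.rev then 1 else 0
  val_inv := by ext i j; simp [Matrix.mul_apply, Matrix.one_apply]
  inv_val := by ext i j; simp [Matrix.mul_apply, Matrix.one_apply]

theorem flip_inv : (flip n)⁻¹ = flip n := rfl

theorem flip_mul_flip : flip n * flip n = 1 := by
  conv_lhs => rw [← flip_inv (n := n)]
  rw [flip_inv, ← mul_inv_cancel (flip n), flip_inv]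

theorem flip_mul_apply (M : Matrix (Fin n) (Fin n) ℂ) (i j : Fin n) :
    ((flip n : Matrix (Fin n) (Fin n) ℂ) * M) i j = M i.rev j := by
  simp [flip, Matrix.mul_apply, ← Fin.rev_eq_iff]

theorem mul_flip_apply (M : Matrix (Fin n) (Fin n) ℂ) (i j : Fin n) :
    (M * (flip n : Matrix (Fin n) (Fin n) ℂ)) i j = M i j.rev := by
  simp [flip, Matrix.mul_apply]

theorem isUpper_flip_conj {a : GLn n} (ha : IsLower a) : IsUpper (flip n * a * flip n) := by
  intro i j hij
  rw [Units.val_mul, mul_flip_apply, Units.val_mul, flip_mul_apply]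
  exact ha.apply_eq_zero (Fin.rev_lt_rev.mpr hij)

theorem isLower_flip_conj {a : GLn n} (ha : IsUpper a) : IsLower (flip n * a * flip n) := by
  intro i j hij
  rw [Units.val_mul, mul_flip_apply, Units.val_mul, flip_mul_apply]
  exact ha.apply_eq_zero (Fin.rev_lt_rev.mpr hij)

theorem borelChar_flip_conj (wt : Fin n → ℤ) (a : GLn n) :
    borelChar wt (flip n * a * flip n) = borelChar (fun i => wt i.rev) a := by
  simp only [borelChar]
  rw [← Equiv.prod_comp Fin.revPerm]
  refine Finset.prod_congr rfl fun i _ => ?_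
  rw [Units.val_mul, mul_flip_apply, Units.val_mul, flip_mul_apply]
  simp

theorem GLn.isLower_transpose {a : GLn n} (ha : IsUpper a) : IsLower a.transpose := by
  intro i j hij
  exact ha.apply_eq_zero (i := j) (j := i) hij

/-- The identity, or the transpose inverse automorphism of `GL_n(ℂ)`. -/
def twist (n : ℕ) : Bool → GLn n →* GLn n
  | false => MonoidHom.id _
  | true =>
    { toFun := fun g => (g.transpose)⁻¹
      map_one' := by
        rw [inv_eq_one]
        exact Units.ext (by simp [GLn.transpose])
      map_mul' := fun g h => by
        rw [← mul_inv_rev]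
        exact congrArg _ (Units.ext (by simp [GLn.transpose])) }

theorem twist_true_val (g : GLn n) : ((twist n true g : GLn n) : Matrix (Fin n) (Fin n) ℂ) =
    ((g⁻¹ : GLn n) : Matrix (Fin n) (Fin n) ℂ).transpose := rfl

theorem twist_surjective (ε : Bool) : Function.Surjective (twist n ε) := by
  cases ε
  · exact Function.surjective_id
  · intro g
    refine ⟨(g⁻¹).transpose, Units.ext ?_⟩
    rw [twist_true_val]
    simp [GLn.transpose]

/-- The effect of a twist on highest weights. -/
def twistWeight (ε : Bool) (wt : Fin n → ℤ) : Fin n → ℤ :=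
  if ε then fun i => -wt i.rev else wt

/-- The element that moves a highest weight vector to a highest weight vector of the twist. -/
def twistElement (n : ℕ) (ε : Bool) : GLn n := if ε then flip n else 1

/-- Transpose inverse sends the upper triangular group to the lower triangular one, and conjugation
by the antidiagonal permutation brings it back. The diagonal is inverted and reversed on the way,
whence `twistWeight`. -/
theorem exists_twist_mul_twistElement (ε : Bool) {b : GLn n} (hb : IsUpper b) :
    ∃ b' : GLn n, IsUpper b' ∧ twist n ε b * twistElement n ε = twistElement n ε * b' ∧
      ∀ wt, borelChar wt b' = borelChar (twistWeight ε wt) b := by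
  cases ε
  · exact ⟨b, hb, by simp [twistElement, twist], fun wt => rfl⟩
  · have hup := isUpper_flip_conj (GLn.isLower_transpose hb)
    refine ⟨(flip n * b.transpose * flip n)⁻¹, hup.inv, ?_, fun wt => ?_⟩
    · simp only [twistElement, if_true, mul_inv_rev, flip_inv]
      rw [← mul_assoc, flip_mul_flip, one_mul]
      rfl
    · have h1 : borelChar wt (flip n * b.transpose * flip n)⁻¹ =
          (borelChar wt (flip n * b.transpose * flip n))⁻¹ := by
        simp only [borelChar, ← Finset.prod_inv_distrib]
        exact Finset.prod_congr rfl fun i _ => by rw [hup.inv_diag, inv_zpow]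
      rw [h1, borelChar_flip_conj]
      simp only [borelChar, twistWeight, if_true, zpow_neg, Finset.prod_inv_distrib]
      rfl

variable {S : Type*}

theorem twist_entry_mem_Reg (ε : Bool) (s : S) (i j : Fin n) :
    (fun g : S → GLn n => (twist n ε (g s) : Matrix (Fin n) (Fin n) ℂ) i j) ∈ Reg S n := by
  cases ε
  · exact entry_mem_Reg s i j
  · exact inv_entry_mem_Reg s j i

theorem twist_det_inv_mem_Reg (ε : Bool) (s : S) :
    (fun g : S → GLn n => ((twist n ε (g s) : Matrix (Fin n) (Fin n) ℂ).det)⁻¹) ∈ Reg S n := by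
  cases ε
  · exact det_inv_mem_Reg s
  · have : (fun g : S → GLn n => ((twist n true (g s) : Matrix (Fin n) (Fin n) ℂ).det)⁻¹) =
        fun g => (g s : Matrix (Fin n) (Fin n) ℂ).det := by
      ext g
      rw [twist_true_val, Matrix.det_transpose, Matrix.coe_units_inv, Matrix.det_nonsing_inv,
        Ring.inverse_eq_inv', inv_inv]
    rw [this]
    exact det_mem_Reg s

theorem regularFunctions_twist_mem_Reg (ε : Bool) (s : S) {f : GLn n → ℂ}
    (hf : f ∈ regularFunctions n) : (fun g : S → GLn n => f (twist n ε (g s))) ∈ Reg S n := by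
  induction hf using Algebra.adjoin_induction with
  | mem f hf =>
    rcases hf with ⟨p, rfl⟩ | rfl
    · exact twist_entry_mem_Reg ε s _ _
    · exact twist_det_inv_mem_Reg ε s
  | algebraMap c => exact const_mem_Reg c
  | add f f' _ _ h h' => exact Subalgebra.add_mem _ h h'
  | mul f f' _ _ h h' => exact Subalgebra.mul_mem _ h h'

theorem regularFunctionsProd_twist_mem_Reg (ε ε' : Bool) (s s' : S) {f : GLn n × GLn n → ℂ}
    (hf : f ∈ regularFunctionsProd n) :
    (fun g : S → GLn n => f (twist n ε (g s), twist n ε' (g s'))) ∈ Reg S n := by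
  induction hf using Algebra.adjoin_induction with
  | mem f hf =>
    rcases hf with ⟨f, hf, rfl⟩ | ⟨f, hf, rfl⟩
    · exact regularFunctions_twist_mem_Reg ε s hf
    · exact regularFunctions_twist_mem_Reg ε' s' hf
  | algebraMap c => exact const_mem_Reg c
  | add f f' _ _ h h' => exact Subalgebra.add_mem _ h h'
  | mul f f' _ _ h h' => exact Subalgebra.mul_mem _ h h'

end Twist

/-! ### Irreducible representations -/

section Irreducible

variable {G H V : Type*} [Group G] [Group H] [AddCommGroup V] [Module ℂ V]

/-- There are no proper nonzero stable subspaces. -/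
def NoStableSubspace (ρ : Representation ℂ G V) : Prop :=
  ∀ W : Submodule ℂ V, (∀ g, ∀ w ∈ W, ρ g w ∈ W) → W = ⊥ ∨ W = ⊤

theorem noStableSubspace_of_isIrreducible {ρ : Representation ℂ G V} (h : ρ.IsIrreducible) :
    NoStableSubspace ρ := by
  intro W hW
  have := h
  rcases eq_bot_or_eq_top (⟨W, hW⟩ : Subrepresentation ρ) with h0 | h0
  · exact Or.inl (congrArg Subrepresentation.toSubmodule h0)
  · exact Or.inr (congrArg Subrepresentation.toSubmodule h0)

theorem NoStableSubspace.comp {ρ : Representation ℂ G V} (h : NoStableSubspace ρ) {φ : H →* G}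
    (hφ : Function.Surjective φ) : NoStableSubspace (MonoidHom.comp ρ φ) := by
  intro W hW
  refine h W fun g w hw => ?_
  obtain ⟨k, rfl⟩ := hφ g
  exact hW k w hw

theorem NoStableSubspace.cyclic {ρ : Representation ℂ G V} (h : NoStableSubspace ρ) {v : V}
    (hv : v ≠ 0) : Submodule.span ℂ (Set.range fun g => ρ g v) = ⊤ := by
  refine (h _ fun g w hw => ?_).resolve_left fun h0 => hv ?_
  · induction hw using Submodule.span_induction with
    | mem x hx =>
      obtain ⟨k, rfl⟩ := hx
      refine Submodule.subset_span ⟨g * k, ?_⟩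
      simp only [map_mul, Module.End.mul_apply]
    | zero => rw [map_zero]; exact Submodule.zero_mem _
    | add x y _ _ h h' => rw [map_add]; exact Submodule.add_mem _ h h'
    | smul c x _ h => rw [map_smul]; exact Submodule.smul_mem _ c h
  · have : v ∈ Submodule.span ℂ (Set.range fun g => ρ g v) :=
      Submodule.subset_span ⟨1, by simp⟩
    rwa [h0, Submodule.mem_bot] at this

/-- The vectors annihilated by every `l ∘ ρ g` form a stable subspace, which is proper because `l ≠
0`. -/
theorem NoStableSubspace.eq_zero {ρ : Representation ℂ G V} (h : NoStableSubspace ρ)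
    {l : Module.Dual ℂ V} (hl : l ≠ 0) {u : V} (hu : ∀ g, l (ρ g u) = 0) : u = 0 := by
  let W : Submodule ℂ V :=
    { carrier := {u | ∀ g, l (ρ g u) = 0}
      add_mem' := fun ha hb g => by rw [map_add, map_add, ha g, hb g, add_zero]
      zero_mem' := fun g => by rw [map_zero, map_zero]
      smul_mem' := fun c x hx g => by rw [map_smul, map_smul, hx g, smul_zero] }
  have hmem : u ∈ W := hu
  rcases h W fun g w hw k => by
      rw [← Module.End.mul_apply, ← map_mul]
      exact hw (k * g) with h0 | h0
  · rwa [h0, Submodule.mem_bot] at hmem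
  · refine absurd (LinearMap.ext fun x => ?_) hl
    have hx : x ∈ W := by rw [h0]; trivial
    simpa using hx 1

variable {S : Type*} [Fintype S] [DecidableEq S] {n : ℕ}

/-- Borel-Weil writes `f` as a matrix coefficient of `v`. An equivariance of `f` under right
multiplication by `p` then says that all `l ∘ ρ g` annihilate `ρ p v - c • v`. Thus a concrete model
function reveals a stabiliser larger than the Borel subgroup. -/
theorem NoStableSubspace.apply_eq_smul {wt : S → Fin n → ℤ}
    {ρ : Representation ℂ (S → GLn n) V} {v : V} (h : NoStableSubspace ρ)
    (hv : IsHighestWeight wt ρ v) {f : (S → GLn n) → ℂ} (hf : f ∈ Reg S n)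
    (hfb : ∀ g b : S → GLn n, (∀ s, IsUpper (b s)) → f (g * b) = charB wt b * f g)
    (h1 : f 1 ≠ 0) {p : S → GLn n} {c : ℂ} (hp : ∀ g, f (g * p) = c * f g) : ρ p v = c • v := by
  obtain ⟨l, hl⟩ := hv.exists_functional_eq hf hfb
  have hl0 : l ≠ 0 := by
    rintro rfl
    exact h1 (by rw [← hl]; simp)
  refine sub_eq_zero.mp (h.eq_zero hl0 fun g => ?_)
  rw [map_sub, map_sub, map_smul, map_smul, hl, ← Module.End.mul_apply, ← map_mul, hl, hp,
    smul_eq_mul, sub_self]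

omit [DecidableEq S] in
theorem charB_const {b : S → GLn n} (hb : ∀ s, IsUpper (b s)) (k : S → ℤ) :
    charB (fun s _ => k s) b = ∏ s, (b s : Matrix (Fin n) (Fin n) ℂ).det ^ k s := by
  refine Finset.prod_congr rfl fun s _ => ?_
  rw [borelChar, (hb s).det, Finset.prod_zpow]

/-- A representation whose highest weight is a power of the determinant is that power. -/
theorem NoStableSubspace.det_apply {k : S → ℤ} {ρ : Representation ℂ (S → GLn n) V} {v : V}
    (h : NoStableSubspace ρ) (hv : IsHighestWeight (fun s _ => k s) ρ v) (p : S → GLn n) :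
    ρ p v = (∏ s, (p s : Matrix (Fin n) (Fin n) ℂ).det ^ k s) • v := by
  have hm : ∀ g p : S → GLn n, (∏ s, ((g * p) s : Matrix (Fin n) (Fin n) ℂ).det ^ k s) =
      (∏ s, (p s : Matrix (Fin n) (Fin n) ℂ).det ^ k s) *
        ∏ s, (g s : Matrix (Fin n) (Fin n) ℂ).det ^ k s := by
    intro g p
    rw [← Finset.prod_mul_distrib]
    refine Finset.prod_congr rfl fun s _ => ?_
    rw [Pi.mul_apply, Units.val_mul, Matrix.det_mul, mul_zpow, mul_comm]
  refine h.apply_eq_smul hv (f := fun g => ∏ s, (g s : Matrix (Fin n) (Fin n) ℂ).det ^ k s)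
    (prod_mem_Reg _ _ fun s _ => det_zpow_mem_Reg s (k s)) (fun g b hb => ?_) (by simp)
    fun g => hm g p
  rw [hm, charB_const hb]

/-- The weight `(0, …, 0, -a)`. -/
def lastWeight (n : ℕ) (a : ℕ) : Fin n → ℤ := fun i => if (i : ℕ) + 1 = n then -(a : ℤ) else 0

/-- `p` lies in the mirabolic subgroup of matrices with last row `(0, …, 0, 1)`. -/
def IsMirabolic (p : GLn n) : Prop :=
  ∀ i j : Fin n, (i : ℕ) + 1 = n →
    (p : Matrix (Fin n) (Fin n) ℂ) i j = (1 : Matrix (Fin n) (Fin n) ℂ) i j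

omit [Fintype S] [DecidableEq S] in
theorem IsMirabolic.inv {p : GLn n} (hp : IsMirabolic p) : IsMirabolic p⁻¹ := by
  intro i j hi
  have h : ((p : Matrix (Fin n) (Fin n) ℂ) *
      ((p⁻¹ : GLn n) : Matrix (Fin n) (Fin n) ℂ)) i j = (1 : Matrix (Fin n) (Fin n) ℂ) i j := by
    rw [← Units.val_mul, mul_inv_cancel, Units.val_one]
  rw [Matrix.mul_apply] at h
  simpa [hp i _ hi, Matrix.one_apply] using h

theorem borelChar_lastWeight (a : ℕ) (b : GLn n) {i : Fin n} (hi : (i : ℕ) + 1 = n) :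
    borelChar (lastWeight n a) b = (((b : Matrix (Fin n) (Fin n) ℂ) i i)⁻¹) ^ a := by
  rw [borelChar, Finset.prod_eq_single i]
  · simp [lastWeight, hi]
  · intro j _ hj
    have : ¬ ((j : ℕ) + 1 = n) := fun h => hj (Fin.ext (by omega))
    simp [lastWeight, this]
  · simp

/-- The highest weight vector of weight `(0, …, 0, -a)` is fixed by the mirabolic subgroup. -/
theorem NoStableSubspace.mirabolic_apply {a : ℕ} {ρ : Representation ℂ (Unit → GLn n) V} {v : V}
    (hn : 0 < n) (h : NoStableSubspace ρ) (hv : IsHighestWeight (fun _ => lastWeight n a) ρ v)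
    {p : Unit → GLn n} (hp : IsMirabolic (p ())) : ρ p v = v := by
  let i : Fin n := ⟨n - 1, by omega⟩
  have hi : (i : ℕ) + 1 = n := Nat.sub_add_cancel hn
  -- The model function is the power `a` of the last diagonal entry of `g⁻¹`. Right multiplication
  -- by a mirabolic `p` does not change the last row of `g⁻¹`, since the last row of `p⁻¹` is that
  -- of the identity.
  have key := h.apply_eq_smul hv (f := fun g => ((g ())⁻¹ : GLn n).1 i i ^ a) (p := p) (c := 1)
    (pow_mem_Reg (inv_entry_mem_Reg () i i) a) (fun g b hb => ?_) (by simp) (fun g => ?_)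
  · rw [key, one_smul]
  · have e : (((g * b) ())⁻¹ : GLn n).1 i i =
        ((b () : Matrix (Fin n) (Fin n) ℂ) i i)⁻¹ * ((g ())⁻¹ : GLn n).1 i i := by
      rw [Pi.mul_apply, mul_inv_rev, Units.val_mul, Matrix.mul_apply, Finset.sum_eq_single i]
      · rw [(hb ()).inv_diag]
      · intro j _ hj
        have : (j : ℕ) ≠ i := fun h => hj (Fin.ext h)
        rw [(hb ()).inv.apply_eq_zero (i := i) (j := j), zero_mul]
        rw [Fin.lt_def]
        omega
      · simp
    simp only [e, mul_pow, charB, Finset.univ_unique, Finset.prod_singleton]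
    rw [borelChar_lastWeight a _ hi]
  · have e : (((g * p) ())⁻¹ : GLn n).1 i i = ((g ())⁻¹ : GLn n).1 i i := by
      rw [Pi.mul_apply, mul_inv_rev, Units.val_mul, Matrix.mul_apply, Finset.sum_eq_single i]
      · rw [hp.inv i i hi, Matrix.one_apply_eq, one_mul]
      · intro j _ hj
        rw [hp.inv i j hi, Matrix.one_apply_ne hj.symm, zero_mul]
      · simp
    simp only [e, one_mul]

end Irreducible

/-! ### Tensor products and twists of highest weight representations -/

section Tensor

theorem tprod_coefficient_mem {G V W : Type*} [Group G] [AddCommGroup V] [Module ℂ V]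
    [AddCommGroup W] [Module ℂ W] [FiniteDimensional ℂ V] [FiniteDimensional ℂ W]
    (A : Subalgebra ℂ (G → ℂ)) {ρ : Representation ℂ G V} {σ : Representation ℂ G W}
    (hρ : ∀ (l : Module.Dual ℂ V) (u : V), (fun g => l (ρ g u)) ∈ A)
    (hσ : ∀ (l : Module.Dual ℂ W) (u : W), (fun g => l (σ g u)) ∈ A)
    (l : Module.Dual ℂ (V ⊗[ℂ] W)) (u : V ⊗[ℂ] W) :
    (fun g => l ((ρ.tprod σ) g u)) ∈ A := by
  induction u using TensorProduct.induction_on with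
  | zero =>
    simp only [map_zero]
    exact A.zero_mem
  | add x y h h' =>
    simp only [map_add]
    exact A.add_mem h h'
  | tmul v w =>
    let b := Module.finBasis ℂ V
    let c := Module.finBasis ℂ W
    have key : (fun g => l ((ρ.tprod σ) g (v ⊗ₜ[ℂ] w))) = ∑ i, ∑ j,
        l (b i ⊗ₜ[ℂ] c j) • ((fun g => b.coord i (ρ g v)) * fun g => c.coord j (σ g w)) := by
      ext g
      rw [Representation.tprod_apply, TensorProduct.map_tmul]
      conv_lhs => rw [← b.sum_repr (ρ g v), ← c.sum_repr (σ g w)]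
      simp only [TensorProduct.sum_tmul, TensorProduct.tmul_sum, TensorProduct.smul_tmul_smul,
        map_sum, map_smul, Finset.sum_apply, Pi.smul_apply, Pi.mul_apply, smul_eq_mul,
        Module.Basis.coord_apply]
      rw [Finset.sum_comm]
      exact Finset.sum_congr rfl fun i _ => Finset.sum_congr rfl fun j _ => by ring
    rw [key]
    exact A.sum_mem fun i _ => A.sum_mem fun j _ => A.smul_mem (A.mul_mem (hρ _ _) (hσ _ _)) _

theorem span_tmul_eq_top {V W ι κ : Type*} [AddCommGroup V] [Module ℂ V]
    [AddCommGroup W] [Module ℂ W] {x : ι → V} {y : κ → W}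
    (hx : Submodule.span ℂ (Set.range x) = ⊤) (hy : Submodule.span ℂ (Set.range y) = ⊤)
    {X : Submodule ℂ (V ⊗[ℂ] W)} (h : ∀ i j, x i ⊗ₜ[ℂ] y j ∈ X) : X = ⊤ := by
  rw [eq_top_iff, ← TensorProduct.map₂_mk_top_top_eq_top, ← hx, ← hy, Submodule.map₂_span_span,
    Submodule.span_le]
  rintro _ ⟨_, ⟨i, rfl⟩, _, ⟨j, rfl⟩, rfl⟩
  exact h i j

variable {S S' : Type*} {n : ℕ} {V W : Type*} [AddCommGroup V] [Module ℂ V]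
  [AddCommGroup W] [Module ℂ W]

/-- Restriction of a family of matrices along a map of index sets. -/
def reindex (n : ℕ) (e : S' → S) : (S → GLn n) →* (S' → GLn n) where
  toFun g s := g (e s)
  map_one' := rfl
  map_mul' _ _ := rfl

@[simp] theorem reindex_apply (e : S' → S) (g : S → GLn n) (s : S') :
    reindex n e g s = g (e s) := rfl

/-- The outer tensor product of two representations. -/
def outerRep (ρ : Representation ℂ (S → GLn n) V) (σ : Representation ℂ (S' → GLn n) W) :
    Representation ℂ (S ⊕ S' → GLn n) (V ⊗[ℂ] W) :=
  Representation.tprod (MonoidHom.comp ρ (reindex n Sum.inl))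
    (MonoidHom.comp σ (reindex n Sum.inr))

theorem outerRep_tmul (ρ : Representation ℂ (S → GLn n) V) (σ : Representation ℂ (S' → GLn n) W)
    (g : S ⊕ S' → GLn n) (v : V) (w : W) : outerRep ρ σ g (v ⊗ₜ[ℂ] w) =
      ρ (reindex n Sum.inl g) v ⊗ₜ[ℂ] σ (reindex n Sum.inr g) w := rfl

theorem tmul_ne_zero {v : V} {w : W} (hv : v ≠ 0) (hw : w ≠ 0) : v ⊗ₜ[ℂ] w ≠ 0 := by
  intro h
  obtain ⟨l, hl⟩ : ∃ l : Module.Dual ℂ V, l v ≠ 0 := by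
    by_contra! hl
    exact hv ((Module.forall_dual_apply_eq_zero_iff ℂ v).mp hl)
  have := congrArg ((TensorProduct.lid ℂ W).toLinearMap ∘ₗ l.rTensor W) h
  simp [hl, hw] at this

variable [Fintype S] [Fintype S']

theorem IsHighestWeight.outer {wt : S → Fin n → ℤ} {wt' : S' → Fin n → ℤ}
    {ρ : Representation ℂ (S → GLn n) V} {σ : Representation ℂ (S' → GLn n) W} {v : V} {w : W}
    (hv : IsHighestWeight wt ρ v) (hw : IsHighestWeight wt' σ w) :
    IsHighestWeight (Sum.elim wt wt') (outerRep ρ σ) (v ⊗ₜ[ℂ] w) := by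
  have := hv.finiteDimensional
  have := hw.finiteDimensional
  refine ⟨inferInstance, ?_, fun b hb => ?_, ?_, tmul_ne_zero hv.ne_zero hw.ne_zero⟩
  · exact tprod_coefficient_mem (Reg (S ⊕ S') n)
      (fun l u => Reg_reindex Sum.inl (hv.regular l u))
      (fun l u => Reg_reindex Sum.inr (hw.regular l u))
  · rw [outerRep_tmul, hv.eigen (reindex n Sum.inl b) fun s => hb _,
      hw.eigen (reindex n Sum.inr b) fun s => hb _,
      TensorProduct.smul_tmul_smul]
    simp [charB, Fintype.prod_sum_type]
  · refine span_tmul_eq_top hv.cyclic hw.cyclic fun g g' =>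
      Submodule.subset_span ⟨Sum.elim g g', ?_⟩
    exact outerRep_tmul ρ σ (Sum.elim g g') v w

omit [Fintype S'] in
theorem charB_add {wt wt' : S → Fin n → ℤ} {b : S → GLn n} (hb : ∀ s, IsUpper (b s)) :
    charB (fun s i => wt s i + wt' s i) b = charB wt b * charB wt' b := by
  simp only [charB, borelChar, ← Finset.prod_mul_distrib]
  exact Finset.prod_congr rfl fun s _ => Finset.prod_congr rfl fun i _ =>
    zpow_add₀ ((hb s).diag_ne_zero i) _ _

/-- Under the diagonal action `v ⊗ w` need not generate the tensor product, so cyclicity is assumed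
here; it is available when one of the two vectors spans a stable line. -/
theorem IsHighestWeight.tprod_aux {wt wt' : S → Fin n → ℤ}
    {ρ : Representation ℂ (S → GLn n) V} {σ : Representation ℂ (S → GLn n) W} {v : V} {w : W}
    (hv : IsHighestWeight wt ρ v) (hw : IsHighestWeight wt' σ w)
    (hc : Submodule.span ℂ (Set.range fun g => ρ.tprod σ g (v ⊗ₜ[ℂ] w)) = ⊤) :
    IsHighestWeight (fun s i => wt s i + wt' s i) (ρ.tprod σ) (v ⊗ₜ[ℂ] w) := by
  have := hv.finiteDimensional
  have := hw.finiteDimensional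
  refine ⟨inferInstance, ?_, fun b hb => ?_, hc, tmul_ne_zero hv.ne_zero hw.ne_zero⟩
  · exact tprod_coefficient_mem (Reg S n) hv.regular hw.regular
  · rw [Representation.tprod_apply, TensorProduct.map_tmul, hv.eigen _ hb, hw.eigen _ hb,
      TensorProduct.smul_tmul_smul, charB_add hb]

theorem IsHighestWeight.tprod_left {wt wt' : S → Fin n → ℤ}
    {ρ : Representation ℂ (S → GLn n) V} {σ : Representation ℂ (S → GLn n) W} {v : V} {w : W}
    (hv : IsHighestWeight wt ρ v) (hw : IsHighestWeight wt' σ w) {χ : (S → GLn n) → ℂ}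
    (hχ : ∀ g, χ g ≠ 0) (hρ : ∀ g, ρ g v = χ g • v) :
    IsHighestWeight (fun s i => wt s i + wt' s i) (ρ.tprod σ) (v ⊗ₜ[ℂ] w) := by
  refine hv.tprod_aux hw (span_tmul_eq_top hv.cyclic hw.cyclic fun g g' => ?_)
  have h1 : ρ g v ⊗ₜ[ℂ] σ g' w = (χ g * (χ g')⁻¹) • ρ.tprod σ g' (v ⊗ₜ[ℂ] w) := by
    rw [Representation.tprod_apply, TensorProduct.map_tmul, hρ, hρ, ← TensorProduct.smul_tmul',
      ← TensorProduct.smul_tmul', smul_smul, mul_assoc, inv_mul_cancel₀ (hχ g'), mul_one]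
  change ρ g v ⊗ₜ[ℂ] σ g' w ∈ _
  rw [h1]
  exact Submodule.smul_mem _ _ (Submodule.subset_span ⟨g', rfl⟩)

theorem IsHighestWeight.tprod_right {wt wt' : S → Fin n → ℤ}
    {ρ : Representation ℂ (S → GLn n) V} {σ : Representation ℂ (S → GLn n) W} {v : V} {w : W}
    (hv : IsHighestWeight wt ρ v) (hw : IsHighestWeight wt' σ w) {χ : (S → GLn n) → ℂ}
    (hχ : ∀ g, χ g ≠ 0) (hσ : ∀ g, σ g w = χ g • w) :
    IsHighestWeight (fun s i => wt s i + wt' s i) (ρ.tprod σ) (v ⊗ₜ[ℂ] w) := by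
  refine hv.tprod_aux hw (span_tmul_eq_top hv.cyclic hw.cyclic fun g g' => ?_)
  have h1 : ρ g v ⊗ₜ[ℂ] σ g' w = (χ g' * (χ g)⁻¹) • ρ.tprod σ g (v ⊗ₜ[ℂ] w) := by
    rw [Representation.tprod_apply, TensorProduct.map_tmul, hσ, hσ, TensorProduct.tmul_smul,
      TensorProduct.tmul_smul, smul_smul, mul_assoc, inv_mul_cancel₀ (hχ g), mul_one]
  change ρ g v ⊗ₜ[ℂ] σ g' w ∈ _
  rw [h1]
  exact Submodule.smul_mem _ _ (Submodule.subset_span ⟨g, rfl⟩)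

end Tensor

/-! ### Irreducible representations after twisting by transpose inverse. -/

section TwistRep

variable {n : ℕ} {V : Type*} [AddCommGroup V] [Module ℂ V]

/-- A twist as a map from a one-element family. -/
def twistOne (n : ℕ) (ε : Bool) : (Unit → GLn n) →* GLn n where
  toFun g := twist n ε (g ())
  map_one' := map_one _
  map_mul' _ _ := map_mul _ _ _

/-- A pair of twists as a map from a two-element family. -/
def twistPair (n : ℕ) (ε ε' : Bool) : (Unit ⊕ Unit → GLn n) →* GLn n × GLn n where
  toFun g := (twist n ε (g (Sum.inl ())), twist n ε' (g (Sum.inr ())))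
  map_one' := Prod.ext (map_one _) (map_one _)
  map_mul' _ _ := Prod.ext (map_mul _ _ _) (map_mul _ _ _)

theorem twistOne_surjective (ε : Bool) : Function.Surjective (twistOne n ε) := fun g => by
  obtain ⟨h, rfl⟩ := twist_surjective ε g
  exact ⟨fun _ => h, rfl⟩

theorem twistPair_surjective (ε ε' : Bool) : Function.Surjective (twistPair n ε ε') :=
  fun ⟨g, g'⟩ => by
    obtain ⟨h, rfl⟩ := twist_surjective ε g
    obtain ⟨h', rfl⟩ := twist_surjective ε' g'
    exact ⟨Sum.elim (fun _ => h) fun _ => h', rfl⟩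

theorem apply_ne_zero {G : Type*} [Group G] (ρ : Representation ℂ G V) (g : G) {v : V}
    (hv : v ≠ 0) : ρ g v ≠ 0 := by
  intro h
  have := congrArg (ρ g⁻¹) h
  rw [← Module.End.mul_apply, ← map_mul, inv_mul_cancel, map_one, map_zero] at this
  exact hv this

theorem IsIrrepGL.twist {wt : Fin n → ℤ} {ρ : Representation ℂ (GLn n) V}
    (h : IsIrrepGL wt ρ) (ε : Bool) :
    NoStableSubspace (MonoidHom.comp ρ (twistOne n ε)) ∧
      ∃ v, IsHighestWeight (fun _ : Unit => twistWeight ε wt)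
        (MonoidHom.comp ρ (twistOne n ε)) v := by
  have hirr := (noStableSubspace_of_isIrreducible h.irreducible).comp (twistOne_surjective ε)
  obtain ⟨hfd, hreg⟩ := h.algebraic
  obtain ⟨v, hv, hb⟩ := h.highestWeight
  have hv' := apply_ne_zero ρ (twistElement n ε) hv
  refine ⟨hirr, ρ (twistElement n ε) v, hfd,
    fun l u => regularFunctions_twist_mem_Reg ε () (hreg l u), fun b hup => ?_,
    hirr.cyclic hv', hv'⟩
  obtain ⟨b', hb', he, hw⟩ := exists_twist_mul_twistElement ε (hup ())
  change ρ (GLCompat.twist n ε (b ())) _ = _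
  rw [← Module.End.mul_apply, ← map_mul, he, map_mul, Module.End.mul_apply, hb b' hb', map_smul, hw]
  simp [charB]

theorem IsIrrepGLProd.twist {μ : DominantWeight n} {ρ : Representation ℂ (GLn n × GLn n) V}
    (h : IsIrrepGLProd μ ρ) (ε ε' : Bool) :
    NoStableSubspace (MonoidHom.comp ρ (twistPair n ε ε')) ∧
      ∃ v, IsHighestWeight (Sum.elim (fun _ : Unit => twistWeight ε μ.left)
        (fun _ : Unit => twistWeight ε' μ.right)) (MonoidHom.comp ρ (twistPair n ε ε')) v := by
  have hirr := (noStableSubspace_of_isIrreducible h.irreducible).comp (twistPair_surjective ε ε')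
  obtain ⟨hfd, hreg⟩ := h.algebraic
  obtain ⟨v, hv, hb⟩ := h.highestWeight
  have hv' := apply_ne_zero ρ (twistElement n ε, twistElement n ε') hv
  refine ⟨hirr, ρ (twistElement n ε, twistElement n ε') v, hfd,
    fun l u => regularFunctionsProd_twist_mem_Reg ε ε' _ _ (hreg l u), fun b hup => ?_,
    hirr.cyclic hv', hv'⟩
  obtain ⟨b₁, hb₁, he₁, hw₁⟩ := exists_twist_mul_twistElement ε (hup (Sum.inl ()))
  obtain ⟨b₂, hb₂, he₂, hw₂⟩ := exists_twist_mul_twistElement ε' (hup (Sum.inr ()))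
  change ρ (GLCompat.twist n ε (b (Sum.inl ())), GLCompat.twist n ε' (b (Sum.inr ()))) _ = _
  rw [← Module.End.mul_apply, ← map_mul, Prod.mk_mul_mk, he₁, he₂, ← Prod.mk_mul_mk, map_mul,
    Module.End.mul_apply, hb b₁ b₂ hb₁ hb₂, map_smul, hw₁, hw₂]
  simp [charB, Fintype.prod_sum_type]

end TwistRep

/-! ### Invariant trilinear forms -/

section InvForms

variable {G H F F' V : Type*} [Group G] [Group H] [AddCommGroup F] [Module ℂ F] [AddCommGroup F']
  [Module ℂ F'] [AddCommGroup V] [Module ℂ V]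

/-- The space of invariant linear forms on `F^∨ ⊗ F'^∨ ⊗ V`. -/
def invForms (ρ : Representation ℂ G F) (ρ' : Representation ℂ G F') (τ : Representation ℂ G V) :
    Submodule ℂ (Module.Dual ℂ ((Module.Dual ℂ F ⊗[ℂ] Module.Dual ℂ F') ⊗[ℂ] V)) where
  carrier := {A | ∀ g x, A (((ρ.dual.tprod ρ'.dual).tprod τ) g x) = A x}
  add_mem' h h' g x := by rw [LinearMap.add_apply, LinearMap.add_apply, h, h']
  zero_mem' _ _ := rfl
  smul_mem' c A h g x := by rw [LinearMap.smul_apply, LinearMap.smul_apply, h]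

theorem mem_invForms_iff {ρ : Representation ℂ G F} {ρ' : Representation ℂ G F'}
    {τ : Representation ℂ G V}
    {A : Module.Dual ℂ ((Module.Dual ℂ F ⊗[ℂ] Module.Dual ℂ F') ⊗[ℂ] V)} :
    A ∈ invForms ρ ρ' τ ↔ ∀ g l m u,
      A ((l ⊗ₜ m) ⊗ₜ τ g u) = A (((l ∘ₗ ρ g) ⊗ₜ (m ∘ₗ ρ' g)) ⊗ₜ u) := by
  have hd : ∀ g l m u, ((ρ.dual.tprod ρ'.dual).tprod τ) g ((l ⊗ₜ[ℂ] m) ⊗ₜ[ℂ] u) =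
      ((l ∘ₗ ρ g⁻¹) ⊗ₜ (m ∘ₗ ρ' g⁻¹)) ⊗ₜ τ g u := fun _ _ _ _ => rfl
  constructor
  · intro h g l m u
    have := h g (((l ∘ₗ ρ g) ⊗ₜ (m ∘ₗ ρ' g)) ⊗ₜ u)
    rw [hd, LinearMap.comp_assoc, LinearMap.comp_assoc, ← Module.End.mul_eq_comp,
      ← Module.End.mul_eq_comp, ← map_mul, ← map_mul, mul_inv_cancel, map_one, map_one] at this
    exact this
  · intro h g x
    refine LinearMap.congr_fun (f := A ∘ₗ ((ρ.dual.tprod ρ'.dual).tprod τ) g) (g := A) ?_ x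
    refine TensorProduct.ext_threefold fun l m u => ?_
    rw [LinearMap.comp_apply, hd, h, LinearMap.comp_assoc, LinearMap.comp_assoc,
      ← Module.End.mul_eq_comp, ← Module.End.mul_eq_comp, ← map_mul, ← map_mul, inv_mul_cancel,
      map_one, map_one]
    rfl

theorem invForms_comp (ρ : Representation ℂ G F) (ρ' : Representation ℂ G F')
    (τ : Representation ℂ G V) {φ : H →* G} (hφ : Function.Surjective φ) :
    invForms (MonoidHom.comp ρ φ) (MonoidHom.comp ρ' φ) (MonoidHom.comp τ φ) =
      invForms ρ ρ' τ := by
  ext A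
  rw [mem_invForms_iff, mem_invForms_iff]
  exact ⟨fun h g => by obtain ⟨k, rfl⟩ := hφ g; exact h k, fun h g => h (φ g)⟩

theorem homDim_eq_finrank_invForms {n : ℕ} (ρ : Representation ℂ (GLn n × GLn n) F)
    (ρ' : Representation ℂ (GLn n × GLn n) F') (τ : Representation ℂ (GLn n × GLn n) V) :
    homDim ρ ρ' τ = Module.finrank ℂ (invForms ρ ρ' τ) := by
  let e : Representation.IntertwiningMap ((ρ.dual.tprod ρ'.dual).tprod τ)
      (Representation.trivial ℂ (GLn n × GLn n) ℂ) ≃ₗ[ℂ] invForms ρ ρ' τ :=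
    { toFun := fun f => ⟨f.toLinearMap, fun g x => LinearMap.congr_fun (f.isIntertwining' g) x⟩
      invFun := fun A => ⟨A.1, fun g => LinearMap.ext fun x => A.2 g x⟩
      map_add' := fun _ _ => rfl
      map_smul' := fun _ _ => rfl
      left_inv := fun _ => rfl
      right_inv := fun _ => rfl }
  exact e.finrank_eq

end InvForms

/-! ### Elements of `GL_n(ℂ)` -/

section Elements

variable {n : ℕ}

/-- An invertible diagonal matrix. -/
def diagGL (x : Fin n → ℂ) (hx : ∀ i, x i ≠ 0) : GLn n where
  val := Matrix.diagonal x
  inv := Matrix.diagonal fun i => (x i)⁻¹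
  val_inv := by
    rw [Matrix.diagonal_mul_diagonal, ← Matrix.diagonal_one]
    exact congrArg _ (funext fun i => mul_inv_cancel₀ (hx i))
  inv_val := by
    rw [Matrix.diagonal_mul_diagonal, ← Matrix.diagonal_one]
    exact congrArg _ (funext fun i => inv_mul_cancel₀ (hx i))

theorem diagGL_val (x : Fin n → ℂ) (hx : ∀ i, x i ≠ 0) :
    (diagGL x hx : Matrix (Fin n) (Fin n) ℂ) = Matrix.diagonal x := rfl

theorem isUpper_diagGL (x : Fin n → ℂ) (hx : ∀ i, x i ≠ 0) : IsUpper (diagGL x hx) :=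
  Matrix.blockTriangular_diagonal x

theorem isLower_diagGL (x : Fin n → ℂ) (hx : ∀ i, x i ≠ 0) : IsLower (diagGL x hx) :=
  Matrix.blockTriangular_diagonal x

theorem borelChar_diagGL (wt : Fin n → ℤ) (x : Fin n → ℂ) (hx : ∀ i, x i ≠ 0) :
    borelChar wt (diagGL x hx) = ∏ i, x i ^ wt i := by
  simp [borelChar, diagGL_val]

/-- The identity matrix with its last row replaced by `(1, …, 1)`. -/
def onesRowMatrix (n : ℕ) : Matrix (Fin n) (Fin n) ℂ :=
  Matrix.of fun i j => if (i : ℕ) + 1 = n then 1 else if i = j then 1 else 0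

theorem onesRowMatrix_lower : (onesRowMatrix n).BlockTriangular OrderDual.toDual := by
  intro i j hij
  have hij : i < j := hij
  have h1 : ¬ ((i : ℕ) + 1 = n) := by
    have := j.2
    rw [Fin.lt_def] at hij
    omega
  simp [onesRowMatrix, h1, hij.ne]

theorem det_onesRowMatrix : (onesRowMatrix n).det = 1 := by
  rw [Matrix.det_of_isLowerTriangular _ onesRowMatrix_lower]
  exact Finset.prod_eq_one fun i _ => by simp [onesRowMatrix]

/-- The identity matrix with its last row replaced by `(1, …, 1)`, as an invertible matrix. -/
def onesRow (n : ℕ) : GLn n :=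
  Matrix.GeneralLinearGroup.mkOfDetNeZero (onesRowMatrix n) (by simp [det_onesRowMatrix])

theorem onesRow_val : (onesRow n : Matrix (Fin n) (Fin n) ℂ) = onesRowMatrix n := rfl

theorem det_onesRow : (onesRow n : Matrix (Fin n) (Fin n) ℂ).det = 1 := det_onesRowMatrix

theorem onesRow_apply {e : Fin n} (he : (e : ℕ) + 1 = n) (i : Fin n) :
    (onesRow n : Matrix (Fin n) (Fin n) ℂ) e i = 1 := by
  simp [onesRow_val, onesRowMatrix, he]

theorem isMirabolic_mul_inv {e : Fin n} (he : (e : ℕ) + 1 = n) {q h : GLn n}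
    (hqh : ∀ j, (q : Matrix (Fin n) (Fin n) ℂ) e j = (h : Matrix (Fin n) (Fin n) ℂ) e j) :
    IsMirabolic (q * h⁻¹) := by
  intro i j hi
  obtain rfl : i = e := Fin.ext (by omega)
  rw [Units.val_mul, Matrix.mul_apply]
  simp only [hqh]
  rw [← Matrix.mul_apply, ← Units.val_mul, mul_inv_cancel, Units.val_one]

theorem det_transv {i j : Fin n} (h : i ≠ j) (c : ℂ) :
    (transv h c : Matrix (Fin n) (Fin n) ℂ).det = 1 := Matrix.det_transvection_of_ne _ _ h c

/-- The embedded matrix `(ζ, 1; -1, 0)`. -/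
def weylCurve {i j : Fin n} (h : i ≠ j) (ζ : ℂ) : GLn n :=
  transv h 1 * transv h.symm (-1) * transv h 1 * transv h.symm ζ

theorem continuous_weylCurve {i j : Fin n} (h : i ≠ j) (p q : Fin n) :
    Continuous fun ζ => (weylCurve h ζ : Matrix (Fin n) (Fin n) ℂ) p q := by
  simp only [weylCurve, Units.val_mul (_ * _ * _) _, mul_transv_apply _ _
    ((transv h 1 * transv h.symm (-1) * transv h 1 : GLn n) : Matrix (Fin n) (Fin n) ℂ)]
  split_ifs <;> fun_prop

/-- In the `i`, `j` block this is the factorisation `(1, ζ⁻¹; 0, 1) = (ζ⁻¹, 0; 1, ζ) (ζ, 1; -1, 0)`: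
as `ζ` tends to zero all poles sit in the lower triangular factor, and the other factor has a limit.
-/
theorem transv_mul_weylCurve_inv_apply {i j : Fin n} (h : i ≠ j) {ζ : ℂ} (hζ : ζ ≠ 0)
    (p q : Fin n) :
    ((transv h ζ⁻¹ * (weylCurve h ζ)⁻¹ : GLn n) : Matrix (Fin n) (Fin n) ℂ) p q =
      if p = i then (if q = i then ζ⁻¹ else 0)
      else if p = j then (if q = i then 1 else if q = j then ζ else 0)
      else if p = q then 1 else 0 := by
  have e : transv h ζ⁻¹ * (weylCurve h ζ)⁻¹ =
      transv h ζ⁻¹ * transv h.symm (-ζ) * transv h (-1) * transv h.symm 1 * transv h (-1) := by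
    simp only [weylCurve, mul_inv_rev, transv_inv, neg_neg, mul_assoc]
  rw [e]
  simp only [Units.val_mul, mul_transv_apply, transv_apply]
  by_cases hpi : p = i
  · subst hpi
    by_cases hqi : q = p
    · subst hqi
      simp [h, h.symm, hζ]
    · by_cases hqj : q = j
      · subst hqj
        simp [h, h.symm, hζ]
      · simp [hqi, hqj, Ne.symm hqi]
  · by_cases hpj : p = j
    · subst hpj
      by_cases hqi : q = i
      · subst hqi
        simp [h, h.symm]
      · by_cases hqj : q = p
        · subst hqj
          simp [h, h.symm]
        · simp [hqi, hqj, Ne.symm hqj]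
    · simp [hpi, hpj]

/-- If `m` were negative, multiplying by `z ^ (-m)` and letting `z` tend to zero would give `ψ 0 =
0`. -/
theorem nonneg_of_continuous_zpow {φ ψ : ℂ → ℂ} (hφ : ContinuousAt φ 0) (hψ : ContinuousAt ψ 0)
    (h0 : ψ 0 ≠ 0) {m : ℤ} (h : ∀ᶠ z in nhdsWithin (0 : ℂ) {0}ᶜ, φ z = z ^ m * ψ z) : 0 ≤ m := by
  by_contra! hm
  obtain ⟨k, hk⟩ : ∃ k : ℕ, m = -((k + 1 : ℕ) : ℤ) := ⟨(-m).toNat - 1, by omega⟩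
  have h1 : Filter.Tendsto (fun z => φ z * z ^ (k + 1)) (nhdsWithin (0 : ℂ) {0}ᶜ)
      (nhds (φ 0 * 0 ^ (k + 1))) :=
    (hφ.mul (continuous_pow (k + 1)).continuousAt).tendsto.mono_left nhdsWithin_le_nhds
  have h2 : Filter.Tendsto ψ (nhdsWithin (0 : ℂ) {0}ᶜ) (nhds (ψ 0)) :=
    hψ.tendsto.mono_left nhdsWithin_le_nhds
  have h3 : (fun z => φ z * z ^ (k + 1)) =ᶠ[nhdsWithin (0 : ℂ) {0}ᶜ] ψ := by
    filter_upwards [h, self_mem_nhdsWithin] with z hz hz0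
    have hz0 : z ≠ 0 := hz0
    rw [hz, hk, zpow_neg, zpow_natCast]
    field_simp
  have := tendsto_nhds_unique (h1.congr' h3) h2
  rw [pow_succ, mul_zero, mul_zero] at this
  exact h0 this.symm

end Elements

/-! ### The multiplicity bound and the necessary conditions -/

section Pieri

variable {S : Type*} [Fintype S] [DecidableEq S] {n : ℕ}

theorem charB_single (wt : S → Fin n → ℤ) (s : S) (b : GLn n) :
    charB wt (single s b) = borelChar (wt s) b := by
  rw [charB, Finset.prod_eq_single s]
  · rw [single_same]
  · intro t _ ht
    rw [single_of_ne ht]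
    simp [borelChar]
  · simp

/-- `y_i(g)`, the entries of the last row of `g⁻¹`. -/
def lastRowInv (e : Fin n) (g : S → GLn n) (s : S) (i : Fin n) : ℂ :=
  ((g s)⁻¹ : GLn n).1 e i

/-- The base point, at which all `y_i` are `1`. -/
def basePoint (S : Type*) (n : ℕ) : S → GLn n := fun _ => (onesRow n)⁻¹

omit [Fintype S] [DecidableEq S] in
theorem lastRowInv_mul_basePoint {e : Fin n} (he : (e : ℕ) + 1 = n) (h : S → GLn n) (s : S)
    (i : Fin n) : lastRowInv e (h * basePoint S n) s i =
      ∑ j, ((h s)⁻¹ : GLn n).1 j i := by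
  rw [lastRowInv, Pi.mul_apply, mul_inv_rev, basePoint, inv_inv, Units.val_mul, Matrix.mul_apply]
  simp [onesRow_apply he]

omit [Fintype S] [DecidableEq S] in
theorem lastRowInv_basePoint {e : Fin n} (he : (e : ℕ) + 1 = n) (s : S) (i : Fin n) :
    lastRowInv e (basePoint S n) s i = 1 := by
  rw [lastRowInv, basePoint, inv_inv, onesRow_apply he]

omit [Fintype S] [DecidableEq S] in
theorem sum_transv_inv {i j : Fin n} (hij : i ≠ j) (c : ℂ) (q : Fin n) :
    ∑ p, ((transv hij c)⁻¹ : GLn n).1 p q = if q = j then 1 - c else 1 := by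
  rw [transv_inv]
  simp only [transv_apply, Finset.sum_add_distrib]
  split_ifs with h
  · simp [h, sub_eq_add_neg]
  · simp [h]

omit [Fintype S] in
theorem lastRowInv_single_mul_basePoint {e : Fin n} (he : (e : ℕ) + 1 = n) (s : S)
    {i j : Fin n} (hij : i ≠ j) (c : ℂ) (t : S) (q : Fin n) :
    lastRowInv e (single s (transv hij c) * basePoint S n) t q =
      if t = s ∧ q = j then 1 - c else 1 := by
  rw [lastRowInv_mul_basePoint he]
  by_cases hts : t = s
  · subst hts
    rw [single_same, sum_transv_inv]
    simp
  · rw [single_of_ne hts, inv_one, if_neg fun h => hts h.1]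
    simp [Matrix.one_apply]

variable {F F' V : Type*} [AddCommGroup F] [Module ℂ F] [AddCommGroup F'] [Module ℂ F']
  [AddCommGroup V] [Module ℂ V]

/-- Two irreducible highest weight representations, and a highest weight representation that
looks like `∏ det^k ⊗ Sym^{-a}`. -/
structure PieriSetup (wt wt' : S → Fin n → ℤ) (k : S → ℤ) (a : S → ℕ)
    (ρ : Representation ℂ (S → GLn n) F) (ρ' : Representation ℂ (S → GLn n) F')
    (τ : Representation ℂ (S → GLn n) V) (v : F) (v' : F') (v₀ : V) : Prop where
  left : IsHighestWeight wt ρ v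
  left_irr : NoStableSubspace ρ
  right : IsHighestWeight wt' ρ' v'
  right_irr : NoStableSubspace ρ'
  target : IsHighestWeight (fun s i => k s + lastWeight n (a s) i) τ v₀
  mirabolic : ∀ p : S → GLn n, (∀ s, IsMirabolic (p s)) →
    τ p v₀ = (∏ s, (p s : Matrix (Fin n) (Fin n) ℂ).det ^ k s) • v₀

/-- The exponents of the monomial attached to an invariant form. -/
def pieriExponent (wt wt' : S → Fin n → ℤ) (k : S → ℤ) (s : S) (i : Fin n) : ℤ :=
  k s - wt s i - wt' s i.rev

/-- A pair of opposite extremal functionals on two representations. -/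
structure IsExtremalPair (wt wt' : S → Fin n → ℤ)
    (ρ : Representation ℂ (S → GLn n) F) (ρ' : Representation ℂ (S → GLn n) F')
    (l : Module.Dual ℂ F) (m : Module.Dual ℂ F') : Prop where
  left_ne : l ≠ 0
  right_ne : m ≠ 0
  lower : ∀ b : S → GLn n, (∀ s, IsLower (b s)) → l ∘ₗ ρ b = charB wt b • l
  upper : ∀ b : S → GLn n, (∀ s, IsUpper (b s)) →
    m ∘ₗ ρ' b = charB (fun s i => wt' s i.rev) b • m
  lower_flip : ∀ b : S → GLn n, (∀ s, IsLower (b s)) → ∀ u,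
    m (ρ' (fun s => flip n * b s) u) =
      charB wt' b * m (ρ' (fun _ => flip n) u)

variable {wt wt' : S → Fin n → ℤ} {k : S → ℤ} {a : S → ℕ}
  {ρ : Representation ℂ (S → GLn n) F} {ρ' : Representation ℂ (S → GLn n) F'}
  {τ : Representation ℂ (S → GLn n) V} {v : F} {v' : F'} {v₀ : V}

namespace PieriSetup

/-- Both functionals are lowest weight functionals; the second is composed with the antidiagonal
permutation, which exchanges upper and lower triangular matrices and reverses its weight. -/
theorem exists_extremalPair (h : PieriSetup wt wt' k a ρ ρ' τ v v' v₀) :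
    ∃ l m, IsExtremalPair wt wt' ρ ρ' l m := by
  obtain ⟨l, hl1, hl⟩ := h.left.exists_lowest_weight_functional
  obtain ⟨l', hl1', hl'⟩ := h.right.exists_lowest_weight_functional
  have hff : ((fun _ => flip n) * fun _ => flip n : S → GLn n) = 1 :=
    funext fun _ => flip_mul_flip
  refine ⟨l, l' ∘ₗ ρ' (fun _ => flip n), ?_, ?_, ?_, ?_, ?_⟩
  · rintro rfl
    simp at hl1
  · intro h0
    have := LinearMap.congr_fun h0 (ρ' (fun _ => flip n) v')
    rw [LinearMap.comp_apply, ← Module.End.mul_apply, ← map_mul, hff, map_one] at this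
    simp [hl1'] at this
  · intro b hb
    exact LinearMap.ext fun u => hl b hb u
  · intro b hb
    refine LinearMap.ext fun u => ?_
    have e : ((fun _ => flip n) * b : S → GLn n) =
        (fun s => flip n * b s * flip n) * fun _ => flip n := by
      funext s
      simp only [Pi.mul_apply, mul_assoc, flip_mul_flip, mul_one]
    simp only [LinearMap.comp_apply, LinearMap.smul_apply]
    rw [← Module.End.mul_apply, ← map_mul, e, map_mul, Module.End.mul_apply,
      hl' _ fun s => isLower_flip_conj (hb s)]
    simp only [charB, borelChar_flip_conj, smul_eq_mul]
  · intro b hb u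
    simp only [LinearMap.comp_apply]
    rw [← Module.End.mul_apply, ← map_mul, ← Module.End.mul_apply, ← map_mul, hff, map_one]
    have e : ((fun _ => flip n) * fun s => flip n * b s : S → GLn n) = b := by
      funext s
      simp only [Pi.mul_apply, ← mul_assoc, flip_mul_flip, one_mul]
    rw [e, hl' b hb]
    rfl

/-- The matrix coefficient attached to an invariant form. -/
def coefficient (τ : Representation ℂ (S → GLn n) V) (v₀ : V)
    (l : Module.Dual ℂ F) (m : Module.Dual ℂ F')
    (A : Module.Dual ℂ ((Module.Dual ℂ F ⊗[ℂ] Module.Dual ℂ F') ⊗[ℂ] V)) (g : S → GLn n) : ℂ :=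
  A ((l ⊗ₜ m) ⊗ₜ τ g v₀)

variable {A : Module.Dual ℂ ((Module.Dual ℂ F ⊗[ℂ] Module.Dual ℂ F') ⊗[ℂ] V)}
  {l : Module.Dual ℂ F} {m : Module.Dual ℂ F'}

omit [DecidableEq S] in
theorem coefficient_mem_Reg (h : PieriSetup wt wt' k a ρ ρ' τ v v' v₀) :
    coefficient τ v₀ l m A ∈ Reg S n :=
  h.target.regular (A ∘ₗ TensorProduct.mk ℂ _ _ (l ⊗ₜ m)) v₀

omit [DecidableEq S] in
theorem coefficient_diag (hlm : IsExtremalPair wt wt' ρ ρ' l m)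
    (hA : A ∈ invForms ρ ρ' τ) {t : S → GLn n} (hl : ∀ s, IsLower (t s)) (hu : ∀ s, IsUpper (t s))
    (g : S → GLn n) : coefficient τ v₀ l m A (t * g) =
      charB wt t * charB (fun s i => wt' s i.rev) t * coefficient τ v₀ l m A g := by
  rw [coefficient, map_mul, Module.End.mul_apply, mem_invForms_iff.mp hA, hlm.lower t hl,
    hlm.upper t hu]
  simp only [← TensorProduct.smul_tmul', TensorProduct.tmul_smul, map_smul, smul_eq_mul,
    coefficient]
  ring

omit [DecidableEq S] in
/-- The coefficient of an invariant form is a monomial in the entries of the last row of `g⁻¹`. -/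
theorem coefficient_eq {e : Fin n} (he : (e : ℕ) + 1 = n)
    (h : PieriSetup wt wt' k a ρ ρ' τ v v' v₀)
    (hlm : IsExtremalPair wt wt' ρ ρ' l m) (hA : A ∈ invForms ρ ρ' τ) (g : S → GLn n)
    (hg : ∀ s i, lastRowInv e g s i ≠ 0) :
    coefficient τ v₀ l m A g =
      (∏ s, ((g s : Matrix (Fin n) (Fin n) ℂ).det ^ k s *
        ∏ i, lastRowInv e g s i ^ pieriExponent wt wt' k s i)) *
          coefficient τ v₀ l m A (basePoint S n) := by
  -- The torus element `t` normalises the last row of `g⁻¹` to `(1, …, 1)`, so that `g = t *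
  -- basePoint * p` with `p` mirabolic: the last rows of `g⁻¹ t` and of `onesRow` agree. Since `det
  -- p = (∏ y_i) det g`, the character of `p` contributes the summand `k` of the exponents and `t`
  -- contributes the two weights.
  let y := lastRowInv e g
  let t : S → GLn n := fun s => diagGL (fun i => (y s i)⁻¹) fun i => inv_ne_zero (hg s i)
  let p : S → GLn n := fun s => onesRow n * (t s)⁻¹ * g s
  have hp : ∀ s, IsMirabolic (p s) := by
    intro s
    have h1 : IsMirabolic ((g s)⁻¹ * t s * (onesRow n)⁻¹) := by
      refine isMirabolic_mul_inv he fun j => ?_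
      rw [onesRow_apply he, Units.val_mul]
      simp only [t, diagGL_val, Matrix.mul_diagonal]
      exact mul_inv_cancel₀ (hg s j)
    have h2 := h1.inv
    simpa only [p, mul_inv_rev, inv_inv, mul_assoc] using h2
  have hgt : g = t * (basePoint S n * p) := by
    funext s
    simp only [Pi.mul_apply, basePoint, p]
    group
  have hdet : ∀ s, (p s : Matrix (Fin n) (Fin n) ℂ).det =
      (∏ i, y s i) * (g s : Matrix (Fin n) (Fin n) ℂ).det := by
    intro s
    have h1 : (t s : Matrix (Fin n) (Fin n) ℂ).det * ∏ i, y s i = 1 := by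
      simp only [t, diagGL_val, Matrix.det_diagonal, ← Finset.prod_mul_distrib]
      exact Finset.prod_eq_one fun i _ => inv_mul_cancel₀ (hg s i)
    have h2 : (t s * p s : GLn n) = t s * onesRow n * (t s)⁻¹ * g s := by
      simp only [p, mul_assoc]
    have h3 := congrArg (fun x : GLn n => (x : Matrix (Fin n) (Fin n) ℂ).det) h2
    simp only [Units.val_mul, Matrix.det_mul, det_onesRow, mul_one] at h3
    have h4 : (t s : Matrix (Fin n) (Fin n) ℂ).det *
        (((t s)⁻¹ : GLn n) : Matrix (Fin n) (Fin n) ℂ).det = 1 := by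
      rw [← Matrix.det_mul, ← Units.val_mul, mul_inv_cancel]
      simp
    rw [h4, one_mul] at h3
    rw [← h3, ← mul_assoc, mul_comm _ (t s : Matrix (Fin n) (Fin n) ℂ).det, h1, one_mul]
  have hstep : coefficient τ v₀ l m A (basePoint S n * p) =
      (∏ s, (p s : Matrix (Fin n) (Fin n) ℂ).det ^ k s) *
        coefficient τ v₀ l m A (basePoint S n) := by
    rw [coefficient, map_mul, Module.End.mul_apply, h.mirabolic p hp, map_smul,
      TensorProduct.tmul_smul, map_smul, smul_eq_mul, coefficient]
  conv_lhs => rw [hgt]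
  rw [coefficient_diag hlm hA (fun s => isLower_diagGL _ _) (fun s => isUpper_diagGL _ _), hstep,
    ← mul_assoc]
  congr 1
  simp only [charB, borelChar_diagGL, ← Finset.prod_mul_distrib, hdet, mul_zpow,
    ← Finset.prod_zpow]
  refine Finset.prod_congr rfl fun s _ => ?_
  rw [← mul_assoc, mul_comm (_ ^ k s), ← Finset.prod_mul_distrib]
  congr 1
  refine Finset.prod_congr rfl fun i _ => ?_
  have hy : y s i ≠ 0 := hg s i
  change _ = y s i ^ _
  rw [pieriExponent, zpow_sub₀ hy, zpow_sub₀ hy, inv_zpow, inv_zpow]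
  field_simp

/-- The formula on the open orbit makes the coefficient vanish identically. Since `v₀` is cyclic, `l
⊗ m` pairs to zero with all of `V`. Invariance under the lower triangular group, with `l` as an
eigenvector, and then the big cell replace `m` by any functional; invariance under the whole group
replaces `l`. -/
theorem coefficient_ne_zero {e : Fin n} (he : (e : ℕ) + 1 = n)
    (h : PieriSetup wt wt' k a ρ ρ' τ v v' v₀)
    (hlm : IsExtremalPair wt wt' ρ ρ' l m) (hA : A ∈ invForms ρ ρ' τ)
    (h0 : coefficient τ v₀ l m A (basePoint S n) = 0) : A = 0 := by
  have hA' := mem_invForms_iff.mp hA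
  have h1 : ∀ g, coefficient τ v₀ l m A g = 0 := by
    -- Off the open orbit the product of all `y_i` vanishes, so coefficient times product is zero
    -- everywhere. Regular functions form a domain, and the product is `1` at the base point.
    have hy : (fun g : S → GLn n => ∏ s, ∏ i, lastRowInv e g s i) ∈ Reg S n :=
      prod_mem_Reg _ _ fun s _ => prod_mem_Reg _ _ fun i _ => inv_entry_mem_Reg s e i
    refine (Reg_eq_zero_or_eq_zero (coefficient_mem_Reg (l := l) (m := m) (A := A) h) hy
      fun g => ?_).resolve_right fun h2 => ?_
    · by_cases hg : ∀ s i, lastRowInv e g s i ≠ 0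
      · rw [coefficient_eq he h hlm hA g hg, h0, mul_zero, zero_mul]
      · push Not at hg
        obtain ⟨s, i, hi⟩ := hg
        rw [Finset.prod_eq_zero (Finset.mem_univ s) (Finset.prod_eq_zero (Finset.mem_univ i) hi),
          mul_zero]
    · have := h2 (basePoint S n)
      simp [lastRowInv_basePoint he] at this
  have h2 : ∀ u, A ((l ⊗ₜ m) ⊗ₜ u) = 0 := fun u => LinearMap.congr_fun
    (h.target.ext_dual (l := A ∘ₗ TensorProduct.mk ℂ _ _ (l ⊗ₜ m)) (l' := 0) h1) u
  have := h.left.finiteDimensional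
  have := h.right.finiteDimensional
  have h3 : ∀ m' u, A ((l ⊗ₜ m') ⊗ₜ u) = 0 := by
    intro m' u
    let Ψ : Module.Dual ℂ (Module.Dual ℂ F') :=
      A ∘ₗ (TensorProduct.mk ℂ _ V).flip u ∘ₗ TensorProduct.mk ℂ _ _ l
    obtain ⟨u', hu'⟩ := (Module.evalEquiv ℂ F').surjective Ψ
    have hΨ : ∀ x, A ((l ⊗ₜ x) ⊗ₜ u) = x u' := fun x => (LinearMap.congr_fun hu' x).symm
    have hz : u' = 0 := by
      refine h.right_irr.eq_zero hlm.right_ne fun g => ?_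
      -- Conjugation by the antidiagonal permutation turns the decomposition lower times upper into
      -- upper times lower: `m` absorbs the upper factor, and invariance together with the
      -- eigenvector `l` disposes of the lower one.
      have key : ∀ x : S → GLn n, m (ρ' ((fun _ => flip n) * x) (ρ' (fun _ => flip n) u')) = 0 := by
        refine Reg_eq_zero_of_bigCell (Reg_mul_left (fun _ => flip n) (h.right.regular m _))
          fun a b ha hb => ?_
        have e1 : ((fun _ => flip n) * (a * b) : S → GLn n) = (fun s => flip n * a s) * b := by
          rw [← mul_assoc]; rfl
        have e2 : ((fun _ => flip n) * b * fun _ => flip n : S → GLn n) =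
          fun s => flip n * b s * flip n := rfl
        have hb' : ∀ s, IsLower ((fun s => flip n * b s * flip n : S → GLn n) s) :=
          fun s => isLower_flip_conj (hb s)
        rw [e1, map_mul, Module.End.mul_apply, hlm.lower_flip a ha, ← Module.End.mul_apply,
          ← map_mul, ← Module.End.mul_apply, ← map_mul, e2]
        have h4 := hA' (fun s => flip n * b s * flip n) l m u
        rw [h2, hlm.lower _ hb', ← TensorProduct.smul_tmul', ← TensorProduct.smul_tmul',
          map_smul, hΨ, smul_eq_mul] at h4
        have h5 : charB wt (fun s => flip n * b s * flip n) ≠ 0 :=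
          Finset.prod_ne_zero_iff.mpr fun s _ => borelChar_ne_zero_of_isLower _ (hb' s)
        rw [LinearMap.comp_apply] at h4
        rw [(mul_eq_zero.mp h4.symm).resolve_left h5, mul_zero]
      have := key ((fun _ => flip n) * g * fun _ => flip n)
      rw [← Module.End.mul_apply, ← map_mul] at this
      convert this using 4
      funext s
      simp only [Pi.mul_apply, mul_assoc, flip_mul_flip, mul_one]
      rw [← mul_assoc, flip_mul_flip, one_mul]
    rw [hΨ, hz, map_zero]
  refine TensorProduct.ext_threefold fun l' m' u => ?_
  let Ψ : Module.Dual ℂ (Module.Dual ℂ F) :=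
    A ∘ₗ (TensorProduct.mk ℂ _ V).flip u ∘ₗ (TensorProduct.mk ℂ _ _).flip m'
  obtain ⟨u', hu'⟩ := (Module.evalEquiv ℂ F).surjective Ψ
  have hΨ : ∀ x, A ((x ⊗ₜ m') ⊗ₜ u) = x u' := fun x => (LinearMap.congr_fun hu' x).symm
  have hz : u' = 0 := by
    refine h.left_irr.eq_zero hlm.left_ne fun g => ?_
    have h4 := hA' g l (m' ∘ₗ ρ' g⁻¹) u
    rw [h3, LinearMap.comp_assoc, ← Module.End.mul_eq_comp, ← map_mul, inv_mul_cancel, map_one,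
      Module.End.one_eq_id, LinearMap.comp_id, hΨ] at h4
    exact h4.symm
  rw [hΨ, hz, map_zero]
  rfl

theorem finrank_invForms_le_one {e : Fin n} (he : (e : ℕ) + 1 = n)
    (h : PieriSetup wt wt' k a ρ ρ' τ v v' v₀) :
    Module.finrank ℂ (invForms ρ ρ' τ) ≤ 1 := by
  obtain ⟨l, m, hlm⟩ := h.exists_extremalPair
  let c : invForms ρ ρ' τ →ₗ[ℂ] ℂ :=
    LinearMap.applyₗ ((l ⊗ₜ m) ⊗ₜ τ (basePoint S n) v₀) ∘ₗ (invForms ρ ρ' τ).subtype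
  have hc : Function.Injective c := by
    rw [← LinearMap.ker_eq_bot, LinearMap.ker_eq_bot']
    exact fun A hA => Subtype.ext (coefficient_ne_zero he h hlm A.2 hA)
  simpa using LinearMap.finrank_le_finrank_of_injective hc

end PieriSetup

end Pieri

/-! ### The interlacing inequalities are necessary. -/

section Necessity

variable {S : Type*} [Fintype S] [DecidableEq S] {n : ℕ}
  {F F' V : Type*} [AddCommGroup F] [Module ℂ F] [AddCommGroup F'] [Module ℂ F']
  [AddCommGroup V] [Module ℂ V]
  {wt wt' : S → Fin n → ℤ} {k : S → ℤ} {a : S → ℕ}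
  {ρ : Representation ℂ (S → GLn n) F} {ρ' : Representation ℂ (S → GLn n) F'}
  {τ : Representation ℂ (S → GLn n) V} {v : F} {v' : F'} {v₀ : V}
  {A : Module.Dual ℂ ((Module.Dual ℂ F ⊗[ℂ] Module.Dual ℂ F') ⊗[ℂ] V)}
  {l : Module.Dual ℂ F} {m : Module.Dual ℂ F'}

namespace PieriSetup

theorem coefficient_single_transv {e : Fin n} (he : (e : ℕ) + 1 = n)
    (h : PieriSetup wt wt' k a ρ ρ' τ v v' v₀)
    (hlm : IsExtremalPair wt wt' ρ ρ' l m) (hA : A ∈ invForms ρ ρ' τ) (s : S) {i j : Fin n}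
    (hij : i ≠ j) {c : ℂ} (hc : 1 - c ≠ 0) :
    coefficient τ v₀ l m A (single s (transv hij c) * basePoint S n) =
      (1 - c) ^ pieriExponent wt wt' k s j * coefficient τ v₀ l m A (basePoint S n) := by
  have hy := fun t q => lastRowInv_single_mul_basePoint he s hij c t q
  rw [coefficient_eq he h hlm hA _ fun t q => by rw [hy]; split_ifs <;> simp [hc]]
  congr 1
  have hdet : ∀ t, ((single s (transv hij c) * basePoint S n) t :
      Matrix (Fin n) (Fin n) ℂ).det = 1 := by
    intro t
    have h1 : (basePoint S n t : Matrix (Fin n) (Fin n) ℂ).det = 1 := by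
      rw [basePoint, Matrix.coe_units_inv, Matrix.det_nonsing_inv, det_onesRow,
        Ring.inverse_one]
    rw [Pi.mul_apply, Units.val_mul, Matrix.det_mul, h1, mul_one]
    by_cases hts : t = s
    · subst hts
      rw [single_same, det_transv]
    · rw [single_of_ne hts]
      simp
  simp only [hdet, hy, one_zpow, one_mul]
  rw [Finset.prod_eq_single s, Finset.prod_eq_single j]
  · simp
  · intro q _ hq
    rw [if_neg fun h => hq h.2, one_zpow]
  · simp
  · intro t _ ht
    exact Finset.prod_eq_one fun q _ => by rw [if_neg fun h => ht h.1, one_zpow]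
  · simp

/-- Along a curve moving only `y_j` the coefficient is a nonzero constant times `z ^ α`, yet it
extends continuously to `z = 0`. Some `i ≠ j` is needed to move `y_j` by a transvection; this is
where `n ≥ 2` enters. -/
theorem pieriExponent_nonneg {e : Fin n} (he : (e : ℕ) + 1 = n) (hn : 2 ≤ n)
    (h : PieriSetup wt wt' k a ρ ρ' τ v v' v₀)
    (hlm : IsExtremalPair wt wt' ρ ρ' l m) (hA : A ∈ invForms ρ ρ' τ)
    (h0 : coefficient τ v₀ l m A (basePoint S n) ≠ 0) (s : S) (j : Fin n) :
    0 ≤ pieriExponent wt wt' k s j := by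
  obtain ⟨i, hij⟩ : ∃ i : Fin n, i ≠ j := by
    have : Nontrivial (Fin n) := Fin.nontrivial_iff_two_le.mpr hn
    exact exists_ne j
  have hφ : Continuous fun z : ℂ =>
      coefficient τ v₀ l m A (single s (transv hij (1 - z)) * basePoint S n) := by
    refine continuous_of_mem_Reg (fun z : ℂ => single s (transv hij (1 - z)))
      (continuous_single s _ fun p q => ?_)
      (Reg_mul_right (basePoint S n) (coefficient_mem_Reg (l := l) (m := m) (A := A) h))
    simp only [transv_apply]
    split_ifs <;> fun_prop
  refine nonneg_of_continuous_zpow hφ.continuousAt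
    (ψ := fun _ => coefficient τ v₀ l m A (basePoint S n)) continuousAt_const h0 ?_
  filter_upwards [self_mem_nhdsWithin] with z hz
  have hz : z ≠ 0 := hz
  rw [coefficient_single_transv he h hlm hA s hij (by simpa using hz), sub_sub_cancel]

/-- The coefficient at `1 + ζ⁻¹ E_ij` is computed twice. The monomial formula gives growth `ζ ^
(-α)`. Invariance and the extremal functionals give `ζ ^ (wt j - wt i)` times a function continuous
at `ζ = 0`. Comparing orders at zero yields the inequality. -/
theorem pieriExponent_le {e : Fin n} (he : (e : ℕ) + 1 = n) (hn : 2 ≤ n)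
    (h : PieriSetup wt wt' k a ρ ρ' τ v v' v₀)
    (hlm : IsExtremalPair wt wt' ρ ρ' l m) (hA : A ∈ invForms ρ ρ' τ)
    (h0 : coefficient τ v₀ l m A (basePoint S n) ≠ 0) (s : S) {i j : Fin n} (hij : i < j) :
    pieriExponent wt wt' k s j ≤ wt s i - wt s j := by
  have := h.left.finiteDimensional
  have hα := h.pieriExponent_nonneg he hn hlm hA h0 s j
  obtain ⟨α, hα⟩ := Int.eq_ofNat_of_zero_le hα
  let w := τ (basePoint S n) v₀
  let Ψ : Module.Dual ℂ (Module.Dual ℂ F) :=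
    A ∘ₗ (TensorProduct.mk ℂ _ V).flip w ∘ₗ (TensorProduct.mk ℂ _ _).flip m
  -- By reflexivity the first slot of `A`, with the other two fixed, is evaluation at a vector `u`.
  -- The upper unipotent curve fixes `m`, so its whole effect is on `l (ρ · u)`.
  obtain ⟨u, hu⟩ := (Module.evalEquiv ℂ F).surjective Ψ
  have hΨ : ∀ x, A ((x ⊗ₜ m) ⊗ₜ w) = x u := fun x => (LinearMap.congr_fun hu x).symm
  have hφ : Continuous fun ζ : ℂ => l (ρ (single s (weylCurve hij.ne ζ)) u) :=
    continuous_of_mem_Reg (fun ζ : ℂ => single s (weylCurve hij.ne ζ))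
      (continuous_single s _ (continuous_weylCurve hij.ne)) (h.left.regular l u)
  have hψ : Continuous fun ζ : ℂ => (ζ - 1) ^ α * coefficient τ v₀ l m A (basePoint S n) := by
    fun_prop
  rw [← sub_nonneg]
  refine nonneg_of_continuous_zpow hφ.continuousAt hψ.continuousAt
    (mul_ne_zero (pow_ne_zero _ (by norm_num)) h0) ?_
  have h1 : ∀ᶠ ζ : ℂ in nhdsWithin 0 {0}ᶜ, ζ ≠ 1 :=
    eventually_nhdsWithin_of_eventually_nhds (isOpen_ne.mem_nhds (by simp))
  filter_upwards [h1, self_mem_nhdsWithin] with ζ hζ1 hζ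
  have hζ : ζ ≠ 0 := hζ
  let b : GLn n := transv hij.ne ζ⁻¹ * (weylCurve hij.ne ζ)⁻¹
  have hb : ∀ p q, (b : Matrix (Fin n) (Fin n) ℂ) p q = _ :=
    transv_mul_weylCurve_inv_apply hij.ne hζ
  have hlow : IsLower b := by
    intro p q hpq
    have hpq : p < q := hpq
    rw [hb]
    split_ifs with h1 h2 h3 h4 h5 h6
    · subst h1 h2; exact absurd hpq (lt_irrefl _)
    · rfl
    · subst h3 h4; exact absurd hpq (lt_asymm hij)
    · subst h3 h5; exact absurd hpq (lt_irrefl _)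
    · rfl
    · subst h6; exact absurd hpq (lt_irrefl _)
    · rfl
  have hchar : charB wt (single s b) = ζ ^ (wt s j - wt s i) := by
    rw [charB_single, borelChar, Finset.prod_eq_mul i j hij.ne]
    · rw [hb, hb, zpow_sub₀ hζ]
      simp [hij.ne', div_eq_mul_inv, mul_comm]
    · intro p _ hp
      rw [hb]
      simp [hp.1, hp.2]
    · simp
    · simp
  have hfac : single s (transv hij.ne ζ⁻¹) =
      (single s b * single s (weylCurve hij.ne ζ) : S → GLn n) := by
    rw [← single_mul]
    simp [b]
  have hup : ∀ t, IsUpper (single s (transv hij.ne ζ⁻¹) t) :=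
    isUpper_single s (isUpper_transv hij _)
  have hunip : charB (fun s i => wt' s i.rev) (single s (transv hij.ne ζ⁻¹)) = 1 := by
    rw [charB_single, borelChar]
    refine Finset.prod_eq_one fun p _ => ?_
    rw [transv_apply, if_pos rfl, if_neg, add_zero, one_zpow]
    rintro ⟨rfl, h2⟩
    exact hij.ne h2
  have key : coefficient τ v₀ l m A (single s (transv hij.ne ζ⁻¹) * basePoint S n) =
      ζ ^ (wt s j - wt s i) * l (ρ (single s (weylCurve hij.ne ζ)) u) := by
    rw [coefficient, map_mul, Module.End.mul_apply, mem_invForms_iff.mp hA, hlm.upper _ hup,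
      hunip, one_smul, hΨ, hfac, map_mul, LinearMap.comp_apply, Module.End.mul_apply]
    have := LinearMap.congr_fun (hlm.lower (single s b) (isLower_single s hlow))
      (ρ (single s (weylCurve hij.ne ζ)) u)
    rw [LinearMap.comp_apply] at this
    rw [this, hchar]
    rfl
  have hne : 1 - ζ⁻¹ ≠ 0 := by
    rw [sub_ne_zero]
    exact fun h => hζ1 (inv_eq_one.mp h.symm)
  rw [coefficient_single_transv he h hlm hA s hij.ne hne, hα] at key
  rw [hα]
  have e1 : ζ ^ (wt s i - wt s j - (α : ℤ)) = (ζ ^ (wt s j - wt s i))⁻¹ * (ζ ^ α)⁻¹ := by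
    rw [zpow_sub₀ hζ, ← zpow_neg, neg_sub, zpow_natCast, div_eq_mul_inv]
  have e2 : (1 - ζ⁻¹) ^ (α : ℤ) = (ζ - 1) ^ α * (ζ ^ α)⁻¹ := by
    rw [zpow_natCast, ← inv_pow, ← mul_pow]
    congr 1
    field_simp
  have hz : ζ ^ (wt s j - wt s i) ≠ 0 := zpow_ne_zero _ hζ
  change l (ρ (single s (weylCurve hij.ne ζ)) u) = ζ ^ (wt s i - wt s j - (α : ℤ)) *
    ((ζ - 1) ^ α * coefficient τ v₀ l m A (basePoint S n))
  rw [e2] at key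
  rw [e1, ← mul_right_inj' hz, ← key]
  field_simp

theorem necessity {e : Fin n} (he : (e : ℕ) + 1 = n) (hn : 2 ≤ n)
    (h : PieriSetup wt wt' k a ρ ρ' τ v v' v₀) (hA : A ∈ invForms ρ ρ' τ) (hA0 : A ≠ 0) (s : S) :
    (∀ i, wt s i + wt' s i.rev ≤ k s) ∧
      ∀ i j : Fin n, (i : ℕ) + j + 2 = n → k s ≤ wt s i + wt' s j := by
  obtain ⟨l, m, hlm⟩ := h.exists_extremalPair
  have h0 : coefficient τ v₀ l m A (basePoint S n) ≠ 0 := fun h0 =>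
    hA0 (coefficient_ne_zero he h hlm hA h0)
  refine ⟨fun i => ?_, fun i j hij => ?_⟩
  · have := h.pieriExponent_nonneg he hn hlm hA h0 s i
    rw [pieriExponent] at this
    omega
  · let i' : Fin n := ⟨i + 1, by omega⟩
    have hrev : i'.rev = j := Fin.ext (by rw [Fin.val_rev]; simp only [i']; omega)
    have := h.pieriExponent_le he hn hlm hA h0 s (i := i) (j := i') (by
      rw [Fin.lt_def]; simp only [i']; omega)
    rw [pieriExponent, hrev] at this
    omega

end PieriSetup

end Necessity

/-! ### Products of mixed minors -/

section MixedMinors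

variable {n : ℕ} {R R' : Type*} [CommRing R] [CommRing R']

/-- The matrix whose columns are the first `i` columns of `g₁`, then copies of `x`, and from
position `i'` on the first columns of `g₂` in reversed order. -/
def mixedMatrix (i i' : ℕ) (g₁ g₂ : Matrix (Fin n) (Fin n) R) (x : Fin n → R) :
    Matrix (Fin n) (Fin n) R :=
  Matrix.of fun r c => if (c : ℕ) < i then g₁ r c else if i' ≤ (c : ℕ) then g₂ r c.rev else x r

theorem mixedMatrix_map (f : R →+* R') (i i' : ℕ) (g₁ g₂ : Matrix (Fin n) (Fin n) R)
    (x : Fin n → R) : f.mapMatrix (mixedMatrix i i' g₁ g₂ x) =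
      mixedMatrix i i' (g₁.map f) (g₂.map f) (fun r => f (x r)) := by
  ext r c
  simp only [mixedMatrix, RingHom.mapMatrix_apply, Matrix.map_apply, Matrix.of_apply]
  split_ifs <;> rfl

theorem mixedMatrix_mul_left (i i' : ℕ) (k g₁ g₂ : Matrix (Fin n) (Fin n) R) (x : Fin n → R) :
    mixedMatrix i i' (k * g₁) (k * g₂) (k.mulVec x) = k * mixedMatrix i i' g₁ g₂ x := by
  ext r c
  simp only [mixedMatrix, Matrix.of_apply, Matrix.mul_apply, Matrix.mulVec, dotProduct]
  split_ifs <;> rfl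

/-- Since `b` is upper triangular, the first `i` columns of `g₁ * b` only involve the first `i`
columns of `g₁`. The mixed matrix is thus multiplied on the right by a triangular matrix that is the
identity in the other columns. -/
theorem det_mixedMatrix_mul_first (i i' : ℕ) (g₁ g₂ b : Matrix (Fin n) (Fin n) R) (x : Fin n → R)
    (hb : ∀ r c : Fin n, c < r → b r c = 0) :
    (mixedMatrix i i' (g₁ * b) g₂ x).det =
      (mixedMatrix i i' g₁ g₂ x).det * ∏ c : Fin n, if (c : ℕ) < i then b c c else 1 := by
  let C : Matrix (Fin n) (Fin n) R :=
    Matrix.of fun r c => if (c : ℕ) < i then b r c else if r = c then 1 else 0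
  have hC : C.BlockTriangular id := by
    intro r c hrc
    have hrc : c < r := hrc
    simp [C, hb r c hrc, hrc.ne']
  have hM : mixedMatrix i i' (g₁ * b) g₂ x = mixedMatrix i i' g₁ g₂ x * C := by
    ext r c
    rw [Matrix.mul_apply]
    by_cases hc : (c : ℕ) < i
    · simp only [mixedMatrix, C, Matrix.of_apply, if_pos hc, Matrix.mul_apply]
      refine Finset.sum_congr rfl fun j _ => ?_
      by_cases hj : c < j
      · rw [hb j c hj, mul_zero, mul_zero]
      · rw [if_pos (lt_of_le_of_lt (Fin.le_def.mp (not_lt.mp hj)) hc)]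
    · simp [C, if_neg hc, mixedMatrix]
  rw [hM, Matrix.det_mul, Matrix.det_of_isUpperTriangular hC]
  simp [C]

theorem det_mixedMatrix_mul_second {i i' : ℕ} (hii : i ≤ i') (g₁ g₂ b : Matrix (Fin n) (Fin n) R)
    (x : Fin n → R) (hb : ∀ r c : Fin n, c < r → b r c = 0) :
    (mixedMatrix i i' g₁ (g₂ * b) x).det = (mixedMatrix i i' g₁ g₂ x).det *
      ∏ c : Fin n, if i' ≤ (c.rev : ℕ) then b c c else 1 := by
  let C : Matrix (Fin n) (Fin n) R :=
    Matrix.of fun r c => if i' ≤ (c : ℕ) then b r.rev c.rev else if r = c then 1 else 0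
  have hC : C.BlockTriangular OrderDual.toDual := by
    intro r c hrc
    have hrc : r < c := hrc
    simp [C, hb r.rev c.rev (Fin.rev_lt_rev.mpr hrc), hrc.ne]
  have hM : mixedMatrix i i' g₁ (g₂ * b) x = mixedMatrix i i' g₁ g₂ x * C := by
    ext r c
    rw [Matrix.mul_apply]
    by_cases hc : i' ≤ (c : ℕ)
    · simp only [mixedMatrix, C, Matrix.of_apply, if_pos hc, Matrix.mul_apply,
        if_neg (not_lt.mpr (hii.trans hc))]
      rw [← Equiv.sum_comp Fin.revPerm]
      refine Finset.sum_congr rfl fun j _ => ?_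
      rw [Fin.revPerm_apply]
      by_cases hj : j < c
      · rw [hb j.rev c.rev (Fin.rev_lt_rev.mpr hj), mul_zero, mul_zero]
      · have hcj : i' ≤ (j : ℕ) := hc.trans (Fin.le_def.mp (not_lt.mp hj))
        rw [if_neg (not_lt.mpr (hii.trans hcj)), if_pos hcj]
    · simp [C, if_neg hc, mixedMatrix]
  rw [hM, Matrix.det_mul, Matrix.det_of_isLowerTriangular _ hC]
  congr 1
  rw [← Equiv.prod_comp Fin.revPerm]
  simp [C]

theorem det_mixedMatrix_smul {i : ℕ} (hi : i < n) (g₁ g₂ : Matrix (Fin n) (Fin n) R) (x : Fin n → R)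
    (c : R) : (mixedMatrix i (i + 1) g₁ g₂ (c • x)).det =
      c * (mixedMatrix i (i + 1) g₁ g₂ x).det := by
  have h : ∀ z : Fin n → R, mixedMatrix i (i + 1) g₁ g₂ z =
      (mixedMatrix i (i + 1) g₁ g₂ 0).updateCol ⟨i, hi⟩ z := by
    intro z
    ext r j
    by_cases hj : j = ⟨i, hi⟩
    · subst hj
      simp [mixedMatrix]
    · have : (j : ℕ) ≠ i := fun h => hj (Fin.ext h)
      rw [Matrix.updateCol_ne hj]
      simp only [mixedMatrix, Matrix.of_apply]
      split_ifs
      · rfl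
      · rfl
      · omega
  rw [h, Matrix.det_updateCol_smul, ← h]

omit [CommRing R] in
theorem mixedMatrix_self (i : ℕ) (g₁ g₂ : Matrix (Fin n) (Fin n) R) (x y : Fin n → R) :
    mixedMatrix i i g₁ g₂ x = mixedMatrix i i g₁ g₂ y := by
  ext r c
  simp only [mixedMatrix, Matrix.of_apply]
  split_ifs
  · rfl
  · rfl
  · omega

/-- A product of powers of mixed minors. -/
def pieriFun (p q : ℕ → ℕ) (g₁ g₂ : Matrix (Fin n) (Fin n) R) (x : Fin n → R) : R :=
  (∏ i ∈ Finset.range (n + 1), (mixedMatrix i i g₁ g₂ x).det ^ p i) *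
    ∏ i ∈ Finset.range n, (mixedMatrix i (i + 1) g₁ g₂ x).det ^ q i

theorem pieriFun_map (f : R →+* R') (p q : ℕ → ℕ) (g₁ g₂ : Matrix (Fin n) (Fin n) R)
    (x : Fin n → R) : f (pieriFun p q g₁ g₂ x) =
      pieriFun p q (g₁.map f) (g₂.map f) (fun r => f (x r)) := by
  simp only [pieriFun, map_mul, map_prod, map_pow, RingHom.map_det, mixedMatrix_map]

theorem pieriFun_mul_left (p q : ℕ → ℕ) (k g₁ g₂ : Matrix (Fin n) (Fin n) R) (x : Fin n → R) :
    pieriFun p q (k * g₁) (k * g₂) (k.mulVec x) =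
      k.det ^ (∑ i ∈ Finset.range (n + 1), p i + ∑ i ∈ Finset.range n, q i) *
        pieriFun p q g₁ g₂ x := by
  simp only [pieriFun, mixedMatrix_mul_left, Matrix.det_mul, mul_pow, Finset.prod_mul_distrib,
    Finset.prod_pow_eq_pow_sum, pow_add]
  ring

theorem prod_prod_ite_pow {κ : Type*} (T : Finset κ) (p : κ → ℕ) (P : κ → Fin n → Prop)
    [∀ i c, Decidable (P i c)] (b : Fin n → R) :
    ∏ i ∈ T, (∏ c, if P i c then b c else 1) ^ p i =
      ∏ c, b c ^ ∑ i ∈ T, if P i c then p i else 0 := by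
  simp only [← Finset.prod_pow, ite_pow, one_pow]
  rw [Finset.prod_comm]
  refine Finset.prod_congr rfl fun c _ => ?_
  rw [← Finset.prod_pow_eq_pow_sum]
  refine Finset.prod_congr rfl fun i _ => ?_
  split_ifs <;> simp

theorem pieriFun_mul_first (p q : ℕ → ℕ) (g₁ g₂ b : Matrix (Fin n) (Fin n) R) (x : Fin n → R)
    (hb : ∀ r c : Fin n, c < r → b r c = 0) :
    pieriFun p q (g₁ * b) g₂ x = pieriFun p q g₁ g₂ x *
      ∏ c : Fin n, b c c ^ (∑ i ∈ Finset.range (n + 1), (if (c : ℕ) < i then p i else 0) +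
        ∑ i ∈ Finset.range n, if (c : ℕ) < i then q i else 0) := by
  simp only [pieriFun, det_mixedMatrix_mul_first _ _ _ _ _ _ hb, mul_pow, Finset.prod_mul_distrib,
    pow_add, prod_prod_ite_pow _ _ (fun i (c : Fin n) => (c : ℕ) < i)]
  ring

theorem pieriFun_mul_second (p q : ℕ → ℕ) (g₁ g₂ b : Matrix (Fin n) (Fin n) R) (x : Fin n → R)
    (hb : ∀ r c : Fin n, c < r → b r c = 0) :
    pieriFun p q g₁ (g₂ * b) x = pieriFun p q g₁ g₂ x *
      ∏ c : Fin n, b c c ^ (∑ i ∈ Finset.range (n + 1), (if i ≤ (c.rev : ℕ) then p i else 0) +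
        ∑ i ∈ Finset.range n, if i + 1 ≤ (c.rev : ℕ) then q i else 0) := by
  simp only [pieriFun, det_mixedMatrix_mul_second le_rfl _ _ _ _ hb,
    det_mixedMatrix_mul_second (Nat.le_succ _) _ _ _ _ hb, mul_pow, Finset.prod_mul_distrib,
    pow_add, prod_prod_ite_pow _ _ (fun i (c : Fin n) => i ≤ (c.rev : ℕ)),
    prod_prod_ite_pow _ _ (fun i (c : Fin n) => i + 1 ≤ (c.rev : ℕ))]
  ring

theorem pieriFun_smul (p q : ℕ → ℕ) (g₁ g₂ : Matrix (Fin n) (Fin n) R) (x : Fin n → R) (c : R) :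
    pieriFun p q g₁ g₂ (c • x) =
      c ^ (∑ i ∈ Finset.range n, q i) * pieriFun p q g₁ g₂ x := by
  have h1 : ∏ i ∈ Finset.range n, (mixedMatrix i (i + 1) g₁ g₂ (c • x)).det ^ q i =
      c ^ (∑ i ∈ Finset.range n, q i) *
        ∏ i ∈ Finset.range n, (mixedMatrix i (i + 1) g₁ g₂ x).det ^ q i := by
    rw [← Finset.prod_pow_eq_pow_sum, ← Finset.prod_mul_distrib]
    refine Finset.prod_congr rfl fun i hi => ?_
    rw [det_mixedMatrix_smul (Finset.mem_range.mp hi), mul_pow]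
  rw [pieriFun, h1, pieriFun]
  simp only [mixedMatrix_self _ g₁ g₂ (c • x) x]
  ring

/-- The reversed columns of the antidiagonal matrix are those of the identity. Each mixed matrix is
then the identity, possibly with one column of ones, so all minors are `1`. -/
theorem pieriFun_one_flip (p q : ℕ → ℕ) :
    pieriFun p q (1 : Matrix (Fin n) (Fin n) ℂ) (flip n : Matrix (Fin n) (Fin n) ℂ)
      (fun _ => 1) = 1 := by
  have hf : ∀ r c : Fin n, (flip n : Matrix (Fin n) (Fin n) ℂ) r c.rev =
      (1 : Matrix (Fin n) (Fin n) ℂ) r c := by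
    intro r c
    simp [flip, Matrix.one_apply]
  have h1 : ∀ i, mixedMatrix i i (1 : Matrix (Fin n) (Fin n) ℂ)
      (flip n : Matrix (Fin n) (Fin n) ℂ) (fun _ => 1) = 1 := by
    intro i
    ext r c
    simp only [mixedMatrix, Matrix.of_apply, hf]
    split_ifs
    · rfl
    · rfl
    · omega
  have h2 : ∀ i ∈ Finset.range n, (mixedMatrix i (i + 1) (1 : Matrix (Fin n) (Fin n) ℂ)
      (flip n : Matrix (Fin n) (Fin n) ℂ) (fun _ => 1)).det = 1 := by
    intro i hi
    have hi := Finset.mem_range.mp hi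
    have : mixedMatrix i (i + 1) (1 : Matrix (Fin n) (Fin n) ℂ)
        (flip n : Matrix (Fin n) (Fin n) ℂ) (fun _ => 1) =
        (1 : Matrix (Fin n) (Fin n) ℂ).updateCol ⟨i, hi⟩ (fun _ => 1) := by
      ext r c
      by_cases hc : c = ⟨i, hi⟩
      · subst hc
        simp [mixedMatrix]
      · have : (c : ℕ) ≠ i := fun h => hc (Fin.ext h)
        rw [Matrix.updateCol_ne hc]
        simp only [mixedMatrix, Matrix.of_apply, hf]
        split_ifs
        · rfl
        · rfl
        · omega
    rw [this, ← Matrix.cramer_apply, Matrix.cramer_one]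
    rfl
  rw [pieriFun, Finset.prod_eq_one fun i _ => by rw [h1, Matrix.det_one, one_pow],
    Finset.prod_eq_one fun i hi => by rw [h2 i hi, one_pow], one_mul]

end MixedMinors

/-! ### Solving for the exponents of the mixed minors. -/

section Exponents

variable {n : ℕ}

/-- The exponents of the mixed minors. -/
theorem exists_pieri_exponents (hn : 0 < n) (wt wt' : Fin n → ℤ) (k : ℤ) (K : ℕ)
    (h1 : ∀ i, wt i + wt' i.rev ≤ k) (h2 : ∀ i j : Fin n, (i : ℕ) + j + 2 = n → k ≤ wt i + wt' j)
    (hK : ∀ i, 0 ≤ wt i + K) (hK' : ∀ i, 0 ≤ wt' i + K) :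
    ∃ p q : ℕ → ℕ,
      (∀ c : Fin n, ((∑ i ∈ Finset.range (n + 1), (if (c : ℕ) < i then p i else 0) +
        ∑ i ∈ Finset.range n, if (c : ℕ) < i then q i else 0 : ℕ) : ℤ) = wt c + K) ∧
      (∀ c : Fin n, ((∑ i ∈ Finset.range (n + 1), (if i ≤ (c.rev : ℕ) then p i else 0) +
        ∑ i ∈ Finset.range n, if i + 1 ≤ (c.rev : ℕ) then q i else 0 : ℕ) : ℤ) = wt' c + K) ∧
      ((∑ i ∈ Finset.range (n + 1), p i + ∑ i ∈ Finset.range n, q i : ℕ) : ℤ) = k + 2 * K ∧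
      ((∑ i ∈ Finset.range n, q i : ℕ) : ℤ) = n * k - (∑ i, wt i + ∑ i, wt' i) := by
  let L : ℕ → ℤ := fun j => if h : j < n then wt ⟨j, h⟩ + K else 0
  let L' : ℕ → ℤ := fun j => if h : j < n then wt' ⟨j, h⟩ + K else 0
  have hL : ∀ c : Fin n, L c = wt c + K := fun c => by simp [L]
  have hL' : ∀ c : Fin n, L' c = wt' c + K := fun c => by simp [L']
  -- In the order `p 0, q 0, p 1, q 1, …, p n` the partial sums are prescribed by the weights, and
  -- the exponents are their differences. Interlacing gives nonnegativity of all of them except `p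
  -- 0` and `p n`, which are nonnegative because of the shift by `K`.
  let p : ℕ → ℤ := fun i =>
    if i = 0 then L' (n - 1) else if i = n then L (n - 1)
    else L (i - 1) + L' (n - 1 - i) - (k + 2 * K)
  let q : ℕ → ℤ := fun i => if i < n then k + 2 * K - L i - L' (n - 1 - i) else 0
  have hp : ∀ i ≤ n, 0 ≤ p i := by
    intro i hi
    simp only [p]
    split_ifs with h h'
    · rw [show L' (n - 1) = L' ((⟨n - 1, by omega⟩ : Fin n) : ℕ) from rfl, hL']
      exact hK' _
    · rw [show L (n - 1) = L ((⟨n - 1, by omega⟩ : Fin n) : ℕ) from rfl, hL]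
      exact hK _
    · rw [show L (i - 1) = L ((⟨i - 1, by omega⟩ : Fin n) : ℕ) from rfl, hL,
        show L' (n - 1 - i) = L' ((⟨n - 1 - i, by omega⟩ : Fin n) : ℕ) from rfl, hL']
      have := h2 ⟨i - 1, by omega⟩ ⟨n - 1 - i, by omega⟩ (by simp only; omega)
      omega
  have hq : ∀ i, 0 ≤ q i := by
    intro i
    simp only [q]
    split_ifs with h
    · have hr : n - 1 - i = ((⟨i, h⟩ : Fin n).rev : ℕ) := by rw [Fin.val_rev]; simp only; omega
      rw [hr, hL', show L i = L ((⟨i, h⟩ : Fin n) : ℕ) from rfl, hL]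
      have := h1 ⟨i, h⟩
      omega
    · exact le_rfl
  have hpz : ∀ i ≤ n, ((p i).toNat : ℤ) = p i := fun i hi => Int.toNat_of_nonneg (hp i hi)
  have hqz : ∀ i, ((q i).toNat : ℤ) = q i := fun i => Int.toNat_of_nonneg (hq i)
  have hsum : ∀ m, m < n → ∑ i ∈ Finset.range (m + 1), p i + ∑ i ∈ Finset.range m, q i =
      L' (n - 1 - m) := by
    intro m
    induction m with
    | zero => intro _; simp [p]
    | succ m ih =>
      intro hm
      rw [Finset.sum_range_succ p (m + 1), Finset.sum_range_succ q m]
      have := ih (by omega)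
      have e1 : p (m + 1) = L m + L' (n - 1 - (m + 1)) - (k + 2 * K) := by
        simp only [p]
        rw [if_neg (by omega), if_neg (by omega), Nat.add_sub_cancel]
      have e2 : q m = k + 2 * K - L m - L' (n - 1 - m) := by
        simp only [q]
        rw [if_pos (by omega)]
      rw [e1, e2]
      linarith
  have htot : ∑ i ∈ Finset.range (n + 1), p i + ∑ i ∈ Finset.range n, q i = k + 2 * K := by
    obtain ⟨m, rfl⟩ : ∃ m, n = m + 1 := ⟨n - 1, by omega⟩
    rw [Finset.sum_range_succ p (m + 1), Finset.sum_range_succ q m]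
    have := hsum m (by omega)
    have e1 : p (m + 1) = L m := by simp [p]
    have e2 : q m = k + 2 * K - L m - L' (m + 1 - 1 - m) := by
      simp only [q]
      rw [if_pos (by omega)]
    rw [e1, e2]
    linarith
  have hlow : ∀ (f : ℕ → ℤ) (M m : ℕ), m ≤ M →
      ∑ i ∈ Finset.range M, (if i < m then f i else 0) = ∑ i ∈ Finset.range m, f i := by
    intro f M m hm
    rw [← Finset.sum_filter]
    congr 1
    ext i
    simp only [Finset.mem_filter, Finset.mem_range]
    omega
  have hhigh : ∀ (f : ℕ → ℤ) (M m : ℕ), m < M →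
      ∑ i ∈ Finset.range M, (if m < i then f i else 0) =
        ∑ i ∈ Finset.range M, f i - ∑ i ∈ Finset.range (m + 1), f i := by
    intro f M m hm
    rw [← hlow f M (m + 1) hm, ← Finset.sum_sub_distrib]
    refine Finset.sum_congr rfl fun i _ => ?_
    split_ifs
    · omega
    · ring
    · ring
    · omega
  have hcp : ∀ (P : ℕ → Prop) [DecidablePred P],
      ((∑ i ∈ Finset.range (n + 1), (if P i then (p i).toNat else 0) : ℕ) : ℤ) =
        ∑ i ∈ Finset.range (n + 1), if P i then p i else 0 := by
    intro P _
    rw [Nat.cast_sum]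
    refine Finset.sum_congr rfl fun i hi => ?_
    split_ifs
    · exact hpz i (by have := Finset.mem_range.mp hi; omega)
    · rfl
  have hcq : ∀ (P : ℕ → Prop) [DecidablePred P],
      ((∑ i ∈ Finset.range n, (if P i then (q i).toNat else 0) : ℕ) : ℤ) =
        ∑ i ∈ Finset.range n, if P i then q i else 0 := by
    intro P _
    rw [Nat.cast_sum]
    refine Finset.sum_congr rfl fun i hi => ?_
    split_ifs
    · exact hqz i
    · rfl
  refine ⟨fun i => (p i).toNat, fun i => (q i).toNat, fun c => ?_, fun c => ?_, ?_, ?_⟩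
  · rw [Nat.cast_add, hcp, hcq, hhigh _ _ _ (by omega), hhigh _ _ _ c.2]
    have := hsum c c.2
    rw [Finset.sum_range_succ q]
    have e2 : q c = k + 2 * K - L c - L' (n - 1 - c) := by
      simp only [q]
      rw [if_pos c.2]
    rw [← hL, e2]
    linarith
  · have hc := c.rev.2
    rw [Nat.cast_add, hcp, hcq]
    have e1 : ∀ i : ℕ, i ≤ (c.rev : ℕ) ↔ i < (c.rev : ℕ) + 1 := fun i => Nat.lt_succ_iff.symm
    have e2 : ∀ i : ℕ, i + 1 ≤ (c.rev : ℕ) ↔ i < (c.rev : ℕ) := fun i => Nat.succ_le_iff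
    rw [Finset.sum_congr rfl fun i _ => if_congr (e1 i) rfl rfl,
      Finset.sum_congr (f := fun i => if i + 1 ≤ (c.rev : ℕ) then q i else 0) rfl
        fun i _ => if_congr (e2 i) rfl rfl,
      hlow _ _ _ (by omega), hlow _ _ _ (by omega)]
    refine (hsum _ hc).trans ?_
    rw [← hL' c]
    congr 1
    rw [Fin.val_rev]
    omega
  · have e1 := hcp fun _ => True
    have e2 := hcq fun _ => True
    simp only [if_true] at e1 e2
    rw [Nat.cast_add, e1, e2, htot]
  · have e2 := hcq fun _ => True
    simp only [if_true] at e2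
    rw [e2, Finset.sum_range]
    have e3 : ∀ i : Fin n, q i = k + 2 * K - (wt i + K) - (wt' i.rev + K) := by
      intro i
      have hr : n - 1 - (i : ℕ) = (i.rev : ℕ) := by rw [Fin.val_rev]; omega
      simp only [q]
      rw [if_pos i.2, hr, hL, hL']
    have e4 : ∑ i : Fin n, wt' i.rev = ∑ i, wt' i := Equiv.sum_comp Fin.revPerm wt'
    simp only [e3, Finset.sum_sub_distrib, Finset.sum_add_distrib, e4, Finset.sum_const,
      Finset.card_univ, Fintype.card_fin, nsmul_eq_mul]
    ring

end Exponents

/-! ### Existence of invariant forms -/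

section PieriPoly

variable {S : Type*} [Fintype S] {n : ℕ}

/-- The product of mixed minors, as a polynomial in two families of matrices. -/
def pieriPoly (p q : S → ℕ → ℕ) (x : S → Fin n → ℂ) : MatPoly (S ⊕ S) n :=
  ∏ s, pieriFun (p s) (q s) (Matrix.of fun i j => X (Sum.inl s, i, j))
    (Matrix.of fun i j => X (Sum.inr s, i, j)) fun r => C (x s r)

theorem evalG_pieriPoly (p q : S → ℕ → ℕ) (x : S → Fin n → ℂ) (h : S ⊕ S → GLn n) :
    evalG h (pieriPoly p q x) = ∏ s, pieriFun (p s) (q s)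
      (h (Sum.inl s) : Matrix (Fin n) (Fin n) ℂ) (h (Sum.inr s)) (x s) := by
  rw [pieriPoly, map_prod]
  refine Finset.prod_congr rfl fun s _ => ?_
  have := pieriFun_map (evalG h).toRingHom (p s) (q s) (Matrix.of fun i j => X (Sum.inl s, i, j))
    (Matrix.of fun i j => X (Sum.inr s, i, j)) fun r => C (x s r)
  refine this.trans ?_
  congr 1
  · ext i j
    exact evalG_X h _
  · ext i j
    exact evalG_X h _
  · funext r
    exact evalG_C h _

omit [Fintype S] in
theorem eval_mem_Reg {ι : Type*} (f : ι → (S → GLn n) → ℂ) (hf : ∀ i, f i ∈ Reg S n)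
    (P : MvPolynomial ι ℂ) : (fun g => eval (fun i => f i g) P) ∈ Reg S n := by
  induction P using MvPolynomial.induction_on with
  | C c => simpa using const_mem_Reg c
  | add p q h h' =>
    simp only [map_add]
    exact Subalgebra.add_mem _ h h'
  | mul_X p i h =>
    simp only [map_mul, eval_X]
    exact mul_mem_Reg h (hf i)

/-- Treating `x` as variables shows that the coefficients depend polynomially on `x`, hence
regularly on `g` when `x` is the last row of `g⁻¹`. -/
theorem exists_universal_pieriPoly (p q : S → ℕ → ℕ) :
    ∃ Q : MvPolynomial ((S ⊕ S) × Fin n × Fin n) (MvPolynomial (S × Fin n) ℂ),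
      ∀ x : S → Fin n → ℂ,
        pieriPoly p q x = MvPolynomial.map (eval fun z : S × Fin n => x z.1 z.2) Q := by
  refine ⟨∏ s, pieriFun (p s) (q s) (Matrix.of fun i j => X (Sum.inl s, i, j))
    (Matrix.of fun i j => X (Sum.inr s, i, j)) fun r => C (X (s, r)), fun x => ?_⟩
  rw [pieriPoly, map_prod]
  refine Finset.prod_congr rfl fun s _ => ?_
  rw [pieriFun_map]
  congr 1
  · ext1 i j
    exact (map_X _ _).symm
  · ext1 i j
    exact (map_X _ _).symm
  · funext r
    rw [map_C, eval_X]

theorem fischer_pieriPoly_mem_Reg (p q : S → ℕ → ℕ) (e : Fin n) (P : MatPoly (S ⊕ S) n) :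
    (fun g => fischer P (pieriPoly p q (lastRowInv e g))) ∈ Reg S n := by
  obtain ⟨Q, hQ⟩ := exists_universal_pieriPoly (n := n) p q
  simp only [fischer_eq_sum]
  refine sum_mem_Reg _ _ fun m _ => mul_mem_Reg (const_mem_Reg _) ?_
  have h := eval_mem_Reg (fun z g => lastRowInv e g z.1 z.2)
    (fun z : S × Fin n => inv_entry_mem_Reg z.1 e z.2) (coeff m Q)
  have h' : (fun g => coeff m (pieriPoly p q (lastRowInv e g))) = fun g =>
      eval (fun z : S × Fin n => lastRowInv e g z.1 z.2) (coeff m Q) := by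
    funext g
    rw [hQ, coeff_map]
  rw [h']
  exact h

theorem pieriPoly_smul (p q : S → ℕ → ℕ) (x : S → Fin n → ℂ) (c : S → ℂ) :
    pieriPoly p q (fun s => c s • x s) =
      (∏ s, c s ^ ∑ i ∈ Finset.range n, q s i) • pieriPoly p q x := by
  refine eq_of_evalG fun h => ?_
  rw [map_smul, evalG_pieriPoly, evalG_pieriPoly, smul_eq_mul, ← Finset.prod_mul_distrib]
  exact Finset.prod_congr rfl fun s _ => pieriFun_smul _ _ _ _ _ _

/-- The coefficients are integers, so for this polynomial the bilinear Fischer square equals the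
positive definite Hermitian one and is nonzero. -/
theorem conjPoly_pieriPoly (p q : S → ℕ → ℕ) :
    conjPoly (pieriPoly (n := n) p q fun _ _ => 1) = pieriPoly p q fun _ _ => 1 := by
  rw [pieriPoly, map_prod]
  refine Finset.prod_congr rfl fun s _ => ?_
  rw [pieriFun_map]
  congr 1
  · ext1 i j
    exact map_X _ _
  · ext1 i j
    exact map_X _ _
  · funext r
    rw [C_1, map_one]

theorem pieriPoly_ne_zero (p q : S → ℕ → ℕ) : pieriPoly (n := n) p q (fun _ _ => 1) ≠ 0 := by
  intro h0
  have := evalG_pieriPoly (n := n) p q (fun _ _ => 1) (Sum.elim (fun _ => 1) fun _ => flip n)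
  rw [h0, map_zero] at this
  simp [pieriFun_one_flip] at this

theorem translate_pieriPoly [DecidableEq S] (p q : S → ℕ → ℕ) (x : S → Fin n → ℂ) (κ : S → GLn n) :
    translate (Sum.elim κ κ)
        (pieriPoly p q fun s => (κ s : Matrix (Fin n) (Fin n) ℂ).mulVec (x s)) =
      (∏ s, (κ s : Matrix (Fin n) (Fin n) ℂ).det ^
        (∑ i ∈ Finset.range (n + 1), p s i + ∑ i ∈ Finset.range n, q s i)) • pieriPoly p q x := by
  refine eq_of_evalG fun h => ?_
  rw [evalG_translate, map_smul, evalG_pieriPoly, evalG_pieriPoly, smul_eq_mul,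
    ← Finset.prod_mul_distrib]
  exact Finset.prod_congr rfl fun s _ => pieriFun_mul_left _ _ _ _ _ _

theorem evalG_pieriPoly_mul (p q : S → ℕ → ℕ) (x : S → Fin n → ℂ) (wt wt' : S → Fin n → ℤ)
    (h1 : ∀ s, ∀ c : Fin n, ((∑ i ∈ Finset.range (n + 1), (if (c : ℕ) < i then p s i else 0) +
        ∑ i ∈ Finset.range n, if (c : ℕ) < i then q s i else 0 : ℕ) : ℤ) = wt s c)
    (h2 : ∀ s, ∀ c : Fin n,
      ((∑ i ∈ Finset.range (n + 1), (if i ≤ (c.rev : ℕ) then p s i else 0) +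
        ∑ i ∈ Finset.range n, if i + 1 ≤ (c.rev : ℕ) then q s i else 0 : ℕ) : ℤ) = wt' s c)
    (h b : S ⊕ S → GLn n) (hb : ∀ s, IsUpper (b s)) :
    evalG (h * b) (pieriPoly p q x) =
      charB (Sum.elim wt wt') b * evalG h (pieriPoly p q x) := by
  rw [evalG_pieriPoly, evalG_pieriPoly, charB, Fintype.prod_sum_type, ← Finset.prod_mul_distrib,
    ← Finset.prod_mul_distrib]
  refine Finset.prod_congr rfl fun s _ => ?_
  simp only [Pi.mul_apply, Units.val_mul]
  rw [pieriFun_mul_first _ _ _ _ _ _ fun r c => (hb _).apply_eq_zero,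
    pieriFun_mul_second _ _ _ _ _ _ fun r c => (hb _).apply_eq_zero]
  simp only [Sum.elim_inl, Sum.elim_inr, borelChar, ← h1, ← h2, zpow_natCast]
  ring

end PieriPoly

/-! ### Equivariance of the last row of the inverse. -/

section LastRow

variable {S : Type*} {n : ℕ}

theorem lastRowInv_mul_upper {e : Fin n} (he : (e : ℕ) + 1 = n) (g b : S → GLn n)
    (hb : ∀ s, IsUpper (b s)) : lastRowInv e (g * b) = fun s =>
      ((b s : Matrix (Fin n) (Fin n) ℂ) e e)⁻¹ • lastRowInv e g s := by
  funext s i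
  rw [lastRowInv, Pi.mul_apply, mul_inv_rev, Units.val_mul, Matrix.mul_apply,
    Finset.sum_eq_single e]
  · rw [(hb s).inv_diag]
    rfl
  · intro j _ hj
    have : j < e := lt_of_le_of_ne (Fin.le_def.mpr (by omega)) hj
    rw [(hb s).inv.apply_eq_zero this, zero_mul]
  · simp

theorem transpose_mulVec_lastRowInv (e : Fin n) (κ g : S → GLn n) (s : S) :
    ((κ s).transpose : Matrix (Fin n) (Fin n) ℂ).mulVec (lastRowInv e (κ * g) s) =
      lastRowInv e g s := by
  have h2 : ((g s)⁻¹ : GLn n).1 = (((κ * g) s)⁻¹ : GLn n).1 * (κ s : Matrix (Fin n) (Fin n) ℂ) := by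
    rw [← Units.val_mul, Pi.mul_apply, mul_inv_rev, mul_assoc, inv_mul_cancel, mul_one]
  funext i
  rw [lastRowInv, h2, Matrix.mul_apply]
  change ∑ j, (κ s : Matrix (Fin n) (Fin n) ℂ) j i * (((κ * g) s)⁻¹ : GLn n).1 e j = _
  exact Finset.sum_congr rfl fun j _ => mul_comm _ _

end LastRow

/-! ### Construction of a nonzero invariant form, and the Pieri rule. -/

section Existence

variable {S : Type*} [Fintype S] [DecidableEq S] {n : ℕ}
  {F F' V : Type*} [AddCommGroup F] [Module ℂ F] [AddCommGroup F'] [Module ℂ F']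
  [AddCommGroup V] [Module ℂ V]

theorem IsHighestWeight.exists_linear_functional_eq {wt : S → Fin n → ℤ}
    {ρ : Representation ℂ (S → GLn n) V} {v : V} (h : IsHighestWeight wt ρ v)
    {W : Type*} [AddCommGroup W] [Module ℂ W] [FiniteDimensional ℂ W]
    (T : W →ₗ[ℂ] ((S → GLn n) → ℂ)) (hT : ∀ w, T w ∈ Reg S n)
    (hTb : ∀ w, ∀ g b : S → GLn n, (∀ s, IsUpper (b s)) → T w (g * b) = charB wt b * T w g) :
    ∃ θ : W →ₗ[ℂ] Module.Dual ℂ V, ∀ w g, θ w (ρ g v) = T w g := by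
  let b := Module.finBasis ℂ W
  choose l hl using fun i => h.exists_functional_eq (hT (b i)) (hTb (b i))
  refine ⟨b.constr ℂ l, fun w g => ?_⟩
  have key : (LinearMap.applyₗ (ρ g v) : Module.Dual ℂ V →ₗ[ℂ] ℂ) ∘ₗ b.constr ℂ l =
      (LinearMap.proj g : ((S → GLn n) → ℂ) →ₗ[ℂ] ℂ) ∘ₗ T := by
    refine b.ext fun i => ?_
    rw [LinearMap.comp_apply, Module.Basis.constr_basis]
    exact hl i g
  exact LinearMap.congr_fun key w

variable {wt wt' : S → Fin n → ℤ} {k : S → ℤ} {a : S → ℕ}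
  {ρ : Representation ℂ (S → GLn n) F} {ρ' : Representation ℂ (S → GLn n) F'}
  {τ : Representation ℂ (S → GLn n) V} {v : F} {v' : F'} {v₀ : V}

theorem translate_polyMap {ρ : Representation ℂ (S → GLn n) V} {v : V} {K : ℕ}
    {Φ : Module.Dual ℂ V →ₗ[ℂ] MatPoly S n}
    (hΦ : ∀ l g, evalG g (Φ l) = detG g ^ K * l (ρ g v)) (l : Module.Dual ℂ V) (κ : S → GLn n) :
    translate κ (Φ l) = detG κ ^ K • Φ (l ∘ₗ ρ κ) := by
  refine eq_of_evalG fun g => ?_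
  rw [map_smul, hΦ, evalG_translate, hΦ, detG_mul, map_mul]
  simp only [smul_eq_mul, LinearMap.comp_apply, Module.End.mul_apply]
  ring

/-- Matrix coefficients of `F ⊗ F'` are paired with the mixed minor polynomial at `x = y(g)`, the
last row of `g⁻¹`. Homogeneity of degree `a` in `x` gives the weight of the target, so Borel-Weil
yields a map from the dual of `F ⊗ F'` to the dual of `V`. It is nonzero because the mixed minor
polynomial at `x = (1, …, 1)` is itself among these coefficients and has nonzero square. -/
theorem PieriSetup.exists_ne_zero {e : Fin n} (he : (e : ℕ) + 1 = n)
    (h : PieriSetup wt wt' k a ρ ρ' τ v v' v₀) (h1 : ∀ s i, wt s i + wt' s i.rev ≤ k s)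
    (h2 : ∀ s, ∀ i j : Fin n, (i : ℕ) + j + 2 = n → k s ≤ wt s i + wt' s j)
    (ha : ∀ s, n * k s - (∑ i, wt s i + ∑ i, wt' s i) = a s) :
    ∃ A ∈ invForms ρ ρ' τ, A ≠ 0 := by
  have hfd := h.left.finiteDimensional
  have hfd' := h.right.finiteDimensional
  have hX := h.left.outer h.right
  obtain ⟨K₀, hK₀⟩ := hX.exists_polyMap
  -- `K` must be large enough both to clear denominators in the matrix coefficients and to make all
  -- shifted weights nonnegative.
  obtain ⟨K, hKK, hK, hK'⟩ : ∃ K : ℕ, K₀ ≤ K ∧ (∀ s i, 0 ≤ wt s i + K) ∧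
      ∀ s i, 0 ≤ wt' s i + K := by
    have hsum : ∀ (f : S → Fin n → ℤ) s i, (f s i).natAbs ≤ ∑ s, ∑ i, (f s i).natAbs := by
      intro f s i
      refine (Finset.single_le_sum (f := fun i => (f s i).natAbs) (fun _ _ => Nat.zero_le _)
        (Finset.mem_univ i)).trans ?_
      exact Finset.single_le_sum (f := fun s => ∑ i, (f s i).natAbs) (fun _ _ => Nat.zero_le _)
        (Finset.mem_univ s)
    refine ⟨K₀ + ∑ s, ∑ i, (wt s i).natAbs + ∑ s, ∑ i, (wt' s i).natAbs, by omega,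
      fun s i => ?_, fun s i => ?_⟩
    · have := hsum wt s i
      omega
    · have := hsum wt' s i
      omega
  obtain ⟨Φ, hΦ⟩ := hK₀ K hKK
  have hn : 0 < n := by omega
  choose p q hpw hpw' hpq hq using fun s =>
    exists_pieri_exponents hn (wt s) (wt' s) (k s) K (h1 s) (h2 s) (hK s) (hK' s)
  have hqa : ∀ s, ∑ i ∈ Finset.range n, q s i = a s := fun s => by
    have := (hq s).trans (ha s)
    exact_mod_cast this
  let c : (S → GLn n) → ℂ := fun g => ∏ s, (g s : Matrix (Fin n) (Fin n) ℂ).det ^ k s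
  have hc : ∀ g g', c (g * g') = c g * c g' := fun g g' => by
    simp [c, mul_zpow, Finset.prod_mul_distrib]
  let T : Module.Dual ℂ (F ⊗[ℂ] F') →ₗ[ℂ] ((S → GLn n) → ℂ) :=
    LinearMap.pi fun g => c g • (fischer.flip (pieriPoly p q (lastRowInv e g)) ∘ₗ Φ)
  have hT : ∀ x g, T x g = c g * fischer (Φ x) (pieriPoly p q (lastRowInv e g)) :=
    fun _ _ => rfl
  obtain ⟨θ, hθ⟩ := h.target.exists_linear_functional_eq T
    (fun x => mul_mem_Reg (prod_mem_Reg _ _ fun s _ => det_zpow_mem_Reg s (k s))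
      (fischer_pieriPoly_mem_Reg p q e (Φ x)))
    (fun x g b hb => by
      have h3 : charB (fun s i => k s + lastWeight n (a s) i) b =
          c b * ∏ s, ((b s : Matrix (Fin n) (Fin n) ℂ) e e)⁻¹ ^ a s := by
        rw [charB_add hb, ← Finset.prod_congr rfl fun s _ => borelChar_lastWeight (a s) (b s) he]
        congr 1
        refine Finset.prod_congr rfl fun s _ => ?_
        rw [(hb s).det, borelChar, Finset.prod_zpow]
      rw [hT, hT, lastRowInv_mul_upper he g b hb, pieriPoly_smul, map_smul, hc, h3]
      simp only [hqa, smul_eq_mul]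
      ring)
  -- Equivariance: the Fischer adjoint of translation by `κ` is translation by its transpose, and
  -- `y(g) = κᵀ y(κ g)`. The minors then contribute `det κ ^ (k + 2K)`, of which `2K` cancels
  -- against the two cleared denominators.
  have hTX : ∀ x κ g, T (x ∘ₗ outerRep ρ ρ' (Sum.elim κ κ)) g = T x (κ * g) := by
    intro x κ g
    have hne : detG (Sum.elim κ κ : S ⊕ S → GLn n) ^ K ≠ 0 := pow_ne_zero _ (detG_ne_zero _)
    refine mul_left_cancel₀ hne ?_
    have h4 := congrArg (fun P => fischer P (pieriPoly p q (lastRowInv e g)))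
      (translate_polyMap hΦ x (Sum.elim κ κ))
    have h5 : (fun s => (Sum.elim κ κ s : GLn n).transpose : S ⊕ S → GLn n) =
        Sum.elim (fun s => (κ s).transpose) (fun s => (κ s).transpose) := by
      funext s
      cases s <;> rfl
    have h6 : lastRowInv e g = fun s => ((κ s).transpose : Matrix (Fin n) (Fin n) ℂ).mulVec
        (lastRowInv e (κ * g) s) := funext fun s => (transpose_mulVec_lastRowInv e κ g s).symm
    have h7 : (∏ s, ((κ s).transpose : Matrix (Fin n) (Fin n) ℂ).det ^
        (∑ i ∈ Finset.range (n + 1), p s i + ∑ i ∈ Finset.range n, q s i)) =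
        detG (Sum.elim κ κ : S ⊕ S → GLn n) ^ K * c κ := by
      rw [detG, Fintype.prod_sum_type, mul_pow, ← Finset.prod_pow, ← Finset.prod_pow,
        ← Finset.prod_mul_distrib, ← Finset.prod_mul_distrib]
      refine Finset.prod_congr rfl fun s _ => ?_
      have h8 : ((κ s).transpose : Matrix (Fin n) (Fin n) ℂ).det =
          (κ s : Matrix (Fin n) (Fin n) ℂ).det := Matrix.det_transpose _
      rw [h8, ← zpow_natCast, hpq, zpow_add₀ (GLn.det_ne_zero _), zpow_mul, mul_comm, zpow_two,
        zpow_natCast, mul_pow]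
      rfl
    simp only [map_smul, LinearMap.smul_apply, smul_eq_mul] at h4
    rw [fischer_translate, h5] at h4
    nth_rewrite 1 [h6] at h4
    rw [translate_pieriPoly, h7, map_smul, smul_eq_mul] at h4
    rw [hT, hT, hc]
    linear_combination (-c g) * h4
  refine ⟨TensorProduct.lift (θ ∘ₗ TensorProduct.dualDistrib ℂ F F'), ?_, fun h0 => ?_⟩
  · rw [mem_invForms_iff]
    intro κ l m u
    have h8 : (TensorProduct.dualDistrib ℂ F F') ((l ∘ₗ ρ κ) ⊗ₜ (m ∘ₗ ρ' κ)) =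
        (TensorProduct.dualDistrib ℂ F F') (l ⊗ₜ m) ∘ₗ outerRep ρ ρ' (Sum.elim κ κ) := by
      refine TensorProduct.ext' fun f f' => ?_
      rfl
    simp only [TensorProduct.lift.tmul, LinearMap.comp_apply]
    refine LinearMap.congr_fun (h.target.ext_dual (l := θ _ ∘ₗ τ κ) (l' := θ _) fun g => ?_) u
    rw [LinearMap.comp_apply, ← Module.End.mul_apply, ← map_mul, hθ, hθ, h8, hTX]
  · have hθ0 : θ = 0 := by
      refine LinearMap.ext fun x => LinearMap.ext fun u => ?_
      obtain ⟨y, rfl⟩ := (TensorProduct.dualDistribEquiv ℂ F F').surjective x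
      exact LinearMap.congr_fun h0 (y ⊗ₜ u)
    obtain ⟨x, hx⟩ : ∃ x, Φ x = pieriPoly p q fun _ _ => 1 := by
      have hw := evalG_pieriPoly_mul p q (fun _ _ => 1) (fun s i => wt s i + K)
        (fun s i => wt' s i + K) hpw hpw'
      have hw' : (Sum.elim (fun s i => wt s i + K) fun s i => wt' s i + K : S ⊕ S → Fin n → ℤ) =
          fun s i => Sum.elim wt wt' s i + K := by
        funext s
        cases s <;> rfl
      obtain ⟨hfd, hb, hinv, hwt⟩ := hX.range_polyMap hΦ
      exact mem_of_weight _ _ hb hinv hwt _ fun g b hb => by rw [hw g b hb, hw']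
    have h9 := hθ x (basePoint S n)
    have h10 : lastRowInv e (basePoint S n) = fun _ _ => 1 :=
      funext fun s => funext fun i => lastRowInv_basePoint he s i
    rw [hθ0, hT, hx, h10, ← conjPoly_pieriPoly, conjPoly_pieriPoly] at h9
    have hc0 : c (basePoint S n) ≠ 0 :=
      Finset.prod_ne_zero_iff.mpr fun s _ => zpow_ne_zero _ (GLn.det_ne_zero _)
    have h11 := (mul_eq_zero.mp h9.symm).resolve_left hc0
    refine pieriPoly_ne_zero (n := n) p q (hermitianFischer_self_eq_zero ?_)
    rw [hermitianFischer, conjPoly_pieriPoly]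
    exact h11

/-- The Pieri rule for the multiplicity of invariant forms. -/
theorem PieriSetup.finrank_invForms_eq_one_iff {e : Fin n} (he : (e : ℕ) + 1 = n) (hn : 2 ≤ n)
    (h : PieriSetup wt wt' k a ρ ρ' τ v v' v₀)
    (ha : ∀ s, n * k s - (∑ i, wt s i + ∑ i, wt' s i) = a s) :
    Module.finrank ℂ (invForms ρ ρ' τ) = 1 ↔ ∀ s, (∀ i, wt s i + wt' s i.rev ≤ k s) ∧
      ∀ i j : Fin n, (i : ℕ) + j + 2 = n → k s ≤ wt s i + wt' s j := by
  constructor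
  · intro h1 s
    have : Nontrivial (invForms ρ ρ' τ) := Module.nontrivial_of_finrank_eq_succ h1
    obtain ⟨A, hA⟩ := exists_ne (0 : invForms ρ ρ' τ)
    exact h.necessity he hn A.2 (fun h0 => hA (Subtype.ext h0)) s
  · intro hs
    obtain ⟨A, hA, hA0⟩ := h.exists_ne_zero he (fun s => (hs s).1) (fun s => (hs s).2) ha
    refine le_antisymm (h.finrank_invForms_le_one he) ?_
    have hfd := h.left.finiteDimensional
    have hfd' := h.right.finiteDimensional
    have hfd'' := h.target.finiteDimensional
    have : Nontrivial (invForms ρ ρ' τ) :=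
      ⟨⟨A, hA⟩, 0, fun h0 => hA0 (congrArg Subtype.val h0)⟩
    exact Module.finrank_pos

end Existence

/-! ### Extremal sums -/

section Sums

variable {n : ℕ}

theorem sumSet_nonempty (μ ν : DominantWeight n) {s : ℕ} (h : 2 ≤ s) (h' : s ≤ 2 * n) :
    (sumSet μ ν s).Nonempty :=
  -- Indices start at `0`, so the two must sum to `s - 2`; the first is taken as large as possible.
  ⟨_, ⟨min (s - 2) (n - 1), by omega⟩, ⟨s - 2 - min (s - 2) (n - 1), by omega⟩,
    by simp only; omega, rfl⟩

theorem sumSet_finite (μ ν : DominantWeight n) (s : ℕ) : (sumSet μ ν s).Finite := by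
  refine (Set.finite_range fun p : Fin n × Fin n => μ.left p.1 + ν.left p.2).subset ?_
  rintro _ ⟨i, j, _, rfl⟩
  exact ⟨(i, j), rfl⟩

theorem maxSum_le_iff (μ ν : DominantWeight n) {s : ℕ} (h : 2 ≤ s) (h' : s ≤ 2 * n) (x : ℤ) :
    maxSum μ ν s ≤ x ↔ ∀ i j : Fin n, (i : ℕ) + j + 2 = s → μ.left i + ν.left j ≤ x := by
  rw [maxSum, csSup_le_iff (sumSet_finite μ ν s).bddAbove (sumSet_nonempty μ ν h h')]
  constructor
  · intro H i j hij
    exact H _ ⟨i, j, by omega, rfl⟩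
  · rintro H _ ⟨i, j, hij, rfl⟩
    exact H i j (by omega)

theorem le_minSum_iff (μ ν : DominantWeight n) {s : ℕ} (h : 2 ≤ s) (h' : s ≤ 2 * n) (x : ℤ) :
    x ≤ minSum μ ν s ↔ ∀ i j : Fin n, (i : ℕ) + j + 2 = s → x ≤ μ.left i + ν.left j := by
  rw [minSum, le_csInf_iff (sumSet_finite μ ν s).bddBelow (sumSet_nonempty μ ν h h')]
  constructor
  · intro H i j hij
    exact H _ ⟨i, j, by omega, rfl⟩
  · rintro H _ ⟨i, j, hij, rfl⟩
    exact H i j (by omega)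

/-- The interlacing condition of the Pieri rule. -/
def PieriCondition (wt wt' : Fin n → ℤ) (k : ℤ) : Prop :=
  (∀ i, wt i + wt' i.rev ≤ k) ∧ ∀ i j : Fin n, (i : ℕ) + j + 2 = n → k ≤ wt i + wt' j

theorem pieriCondition_iff (hn : 2 ≤ n) (μ ν : DominantWeight n) {wt wt' : Fin n → ℤ} {c c' : ℤ}
    (h : ∀ i, wt i = μ.left i - c) (h' : ∀ i, wt' i = ν.left i - c') (k : ℤ) :
    PieriCondition wt wt' k ↔
      maxSum μ ν (n + 1) ≤ k + (c + c') ∧ k + (c + c') ≤ minSum μ ν n := by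
  rw [maxSum_le_iff μ ν (by omega) (by omega), le_minSum_iff μ ν hn (by omega), PieriCondition]
  simp only [h, h']
  refine and_congr ⟨fun H i j hij => ?_, fun H i => ?_⟩
    (forall_congr' fun i => forall_congr' fun j => forall_congr' fun _ => by
      constructor <;> intro <;> linarith)
  · have hj : j = i.rev := Fin.ext (by rw [Fin.val_rev]; omega)
    subst hj
    linarith [H i]
  · have := H i i.rev (by rw [Fin.val_rev]; omega)
    linarith

/-- Negating the weights exchanges maximum and minimum, and reversing the indices sends `i + j = n`
to `i + j = n + 2` while preserving `i + j = n + 1`. -/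
theorem pieriCondition_rev_iff (hn : 2 ≤ n) (μ ν : DominantWeight n) {wt wt' : Fin n → ℤ}
    {c c' : ℤ} (h : ∀ i, wt i = c - μ.left i.rev) (h' : ∀ i, wt' i = c' - ν.left i.rev) (k : ℤ) :
    PieriCondition wt wt' k ↔
      c + c' - k ≤ minSum μ ν (n + 1) ∧ maxSum μ ν (n + 2) ≤ c + c' - k := by
  rw [le_minSum_iff μ ν (by omega) (by omega), maxSum_le_iff μ ν (by omega) (by omega),
    PieriCondition]
  simp only [h, h', Fin.rev_rev]
  refine and_congr ⟨fun H i j hij => ?_, fun H i => ?_⟩ ⟨fun H i j hij => ?_, fun H i j hij => ?_⟩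
  · have hi : i = j.rev := Fin.ext (by rw [Fin.val_rev]; omega)
    subst hi
    linarith [H j]
  · have := H i.rev i (by rw [Fin.val_rev]; omega)
    linarith
  · have := H i.rev j.rev (by rw [Fin.val_rev, Fin.val_rev]; omega)
    rw [Fin.rev_rev, Fin.rev_rev] at this
    linarith
  · have := H i.rev j.rev (by rw [Fin.val_rev, Fin.val_rev]; omega)
    linarith

theorem twistWeight_true_detWeight (k : ℤ) :
    twistWeight true (detWeight n k) = fun _ => -k := rfl

theorem twistWeight_false_detWeight (k : ℤ) :
    twistWeight false (detWeight n k) = fun _ => k := rfl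

theorem symWeight_of_nonpos {a : ℕ} {A : ℤ} (hA : A = -(a : ℤ)) :
    twistWeight false (symWeight n A) = lastWeight n a := by
  subst hA
  funext i
  simp only [twistWeight, symWeight, lastWeight, Bool.false_eq_true, if_false]
  split_ifs <;> omega

theorem symWeight_of_nonneg {a : ℕ} {A : ℤ} (hA : A = (a : ℤ)) :
    twistWeight true (symWeight n A) = lastWeight n a := by
  subst hA
  funext i
  have : ((i.rev : Fin n) : ℕ) = 0 ↔ (i : ℕ) + 1 = n := by rw [Fin.val_rev]; omega
  simp only [twistWeight, symWeight, lastWeight, if_true, this]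
  split_ifs <;> omega

end Sums

/-! ### Products of a determinant power and a symmetric power as targets of the Pieri rule. -/

section Target

variable {S S' : Type*} [Fintype S] [Fintype S'] {n : ℕ} {V W : Type*} [AddCommGroup V]
  [Module ℂ V] [AddCommGroup W] [Module ℂ W]

/-- A representation that looks like `∏ det ^ k ⊗ Sym ^ (-a)`, and its highest weight vector. -/
structure IsPieriTarget (k : S → ℤ) (a : S → ℕ) (τ : Representation ℂ (S → GLn n) V) (v₀ : V) :
    Prop where
  highestWeight : IsHighestWeight (fun s i => k s + lastWeight n (a s) i) τ v₀
  mirabolic : ∀ p : S → GLn n, (∀ s, IsMirabolic (p s)) →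
    τ p v₀ = (∏ s, (p s : Matrix (Fin n) (Fin n) ℂ).det ^ k s) • v₀

theorem IsPieriTarget.outer {k : S → ℤ} {k' : S' → ℤ} {a : S → ℕ} {a' : S' → ℕ}
    {τ : Representation ℂ (S → GLn n) V} {τ' : Representation ℂ (S' → GLn n) W} {v : V} {w : W}
    (h : IsPieriTarget k a τ v) (h' : IsPieriTarget k' a' τ' w) :
    IsPieriTarget (Sum.elim k k') (Sum.elim a a') (outerRep τ τ') (v ⊗ₜ w) := by
  constructor
  · convert h.highestWeight.outer h'.highestWeight using 1
    funext s
    cases s <;> rfl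
  · intro p hp
    rw [outerRep_tmul, h.mirabolic (reindex n Sum.inl p) fun s => hp _,
      h'.mirabolic (reindex n Sum.inr p) fun s => hp _,
      TensorProduct.smul_tmul_smul, Fintype.prod_sum_type]
    rfl

theorem tprod_comp {G H : Type*} [Group G] [Group H] (ρ : Representation ℂ G V)
    (σ : Representation ℂ G W) (φ : H →* G) :
    MonoidHom.comp (ρ.tprod σ) φ =
      Representation.tprod (MonoidHom.comp ρ φ) (MonoidHom.comp σ φ) :=
  MonoidHom.ext fun _ => rfl

variable {k : ℤ} {a : ℕ} {G : Type*} [Group G] {φ : (Unit → GLn n) →* G}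
  {ρ : Representation ℂ G V} {σ : Representation ℂ G W}

theorem exists_isPieriTarget_det_sym (hn : 0 < n)
    (hρ : NoStableSubspace (MonoidHom.comp ρ φ) ∧
      ∃ v, IsHighestWeight (fun _ _ => k) (MonoidHom.comp ρ φ) v)
    (hσ : NoStableSubspace (MonoidHom.comp σ φ) ∧
      ∃ w, IsHighestWeight (fun _ => lastWeight n a) (MonoidHom.comp σ φ) w) :
    ∃ u, IsPieriTarget (fun _ => k) (fun _ => a) (MonoidHom.comp (ρ.tprod σ) φ) u := by
  obtain ⟨hρ, v, hv⟩ := hρ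
  obtain ⟨hσ, w, hw⟩ := hσ
  have hdet := hρ.det_apply (k := fun _ => k) hv
  rw [tprod_comp]
  refine ⟨v ⊗ₜ w, hv.tprod_left hw
    (fun g => Finset.prod_ne_zero_iff.mpr fun s _ => zpow_ne_zero _ (GLn.det_ne_zero (g s))) hdet,
    fun p hp => ?_⟩
  rw [Representation.tprod_apply, TensorProduct.map_tmul, hdet, hσ.mirabolic_apply hn hw (hp ()),
    TensorProduct.smul_tmul']

theorem exists_isPieriTarget_sym_det (hn : 0 < n)
    (hσ : NoStableSubspace (MonoidHom.comp σ φ) ∧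
      ∃ w, IsHighestWeight (fun _ => lastWeight n a) (MonoidHom.comp σ φ) w)
    (hρ : NoStableSubspace (MonoidHom.comp ρ φ) ∧
      ∃ v, IsHighestWeight (fun _ _ => k) (MonoidHom.comp ρ φ) v) :
    ∃ u, IsPieriTarget (fun _ => k) (fun _ => a) (MonoidHom.comp (σ.tprod ρ) φ) u := by
  obtain ⟨hρ, v, hv⟩ := hρ
  obtain ⟨hσ, w, hw⟩ := hσ
  have hdet := hρ.det_apply (k := fun _ => k) hv
  rw [tprod_comp]
  refine ⟨w ⊗ₜ v, ?_, fun p hp => ?_⟩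
  · have := hw.tprod_right hv
      (fun g => Finset.prod_ne_zero_iff.mpr fun s _ => zpow_ne_zero _ (GLn.det_ne_zero (g s))) hdet
    simpa only [add_comm] using this
  · rw [Representation.tprod_apply, TensorProduct.map_tmul, hdet, hσ.mirabolic_apply hn hw (hp ()),
      TensorProduct.tmul_smul]

end Target

/-! ### The two factors together, and bookkeeping for pure weights. -/

section Final

variable {n : ℕ} {Fμ Fν : Type*} [AddCommGroup Fμ] [Module ℂ Fμ] [AddCommGroup Fν] [Module ℂ Fν]
  {V W : Type*} [AddCommGroup V] [Module ℂ V] [AddCommGroup W] [Module ℂ W]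

/-- The Pieri rule for `GL_n(ℂ) × GL_n(ℂ)`, after a twist of the two factors. -/
theorem homDim_outerTensor (hn : 2 ≤ n) {μ ν : DominantWeight n}
    {ρμ : Representation ℂ (GLn n × GLn n) Fμ} {ρν : Representation ℂ (GLn n × GLn n) Fν}
    (hρμ : IsIrrepGLProd μ ρμ) (hρν : IsIrrepGLProd ν ρν) (ε ε' : Bool)
    {τ : Representation ℂ (GLn n) V} {τ' : Representation ℂ (GLn n) W} {k k' : ℤ} {a a' : ℕ}
    (hτ : ∃ u, IsPieriTarget (fun _ => k) (fun _ => a) (MonoidHom.comp τ (twistOne n ε)) u)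
    (hτ' : ∃ u, IsPieriTarget (fun _ => k') (fun _ => a') (MonoidHom.comp τ' (twistOne n ε')) u)
    (ha : n * k - (∑ i, twistWeight ε μ.left i + ∑ i, twistWeight ε ν.left i) = a)
    (ha' : n * k' - (∑ i, twistWeight ε' μ.right i + ∑ i, twistWeight ε' ν.right i) = a') :
    homDim ρμ ρν (outerTensor τ τ') ≤ 1 ∧ (homDim ρμ ρν (outerTensor τ τ') = 1 ↔
      PieriCondition (twistWeight ε μ.left) (twistWeight ε ν.left) k ∧
      PieriCondition (twistWeight ε' μ.right) (twistWeight ε' ν.right) k') := by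
  obtain ⟨u, hu⟩ := hτ
  obtain ⟨u', hu'⟩ := hτ'
  obtain ⟨hirr, v, hv⟩ := hρμ.twist ε ε'
  obtain ⟨hirr', v', hv'⟩ := hρν.twist ε ε'
  have ht := hu.outer hu'
  have h : PieriSetup _ _ _ _ _ _ (MonoidHom.comp (outerTensor τ τ') (twistPair n ε ε'))
      v v' (u ⊗ₜ[ℂ] u') := ⟨hv, hirr, hv', hirr', ht.highestWeight, ht.mirabolic⟩
  have he : ((⟨n - 1, by omega⟩ : Fin n) : ℕ) + 1 = n := Nat.sub_add_cancel (by omega)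
  rw [homDim_eq_finrank_invForms, ← invForms_comp _ _ _ (twistPair_surjective ε ε')]
  refine ⟨h.finrank_invForms_le_one he, (h.finrank_invForms_eq_one_iff he hn ?_).trans ?_⟩
  · rintro (s | s)
    · exact ha
    · exact ha'
  · rw [Sum.forall]
    exact ⟨fun H => ⟨H.1 (), H.2 ()⟩, fun H => ⟨fun _ => H.1, fun _ => H.2⟩⟩

theorem two_mul_kappa (w w' : ℤ) : 2 * kappa w w' = ((w + w' : ℤ) : ℚ) := by
  rw [kappa]
  push_cast
  ring

theorem sum_left_add_sum_left (μ ν : DominantWeight n) :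
    ∑ i, μ.left i + ∑ i, ν.left i = kEta μ ν := Finset.sum_add_distrib.symm

theorem sum_rev (f : Fin n → ℤ) : ∑ i : Fin n, f i.rev = ∑ i, f i :=
  Equiv.sum_comp Fin.revPerm f

theorem DominantWeight.IsPure.right_eq {μ : DominantWeight n} {w : ℤ} (h : μ.IsPure w)
    (i : Fin n) : μ.right i = w - μ.left i.rev := by
  have := h i.rev
  rw [Fin.rev_rev] at this
  linarith

end Final

end GLCompat

end

theorem mainTheorem5 {n : ℕ} (hn : 2 ≤ n)
    (μ ν : GLCompat.DominantWeight n) (w w' : ℤ) (hμ : μ.IsPure w) (hν : ν.IsPure w')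
    {Fμ Fν : Type*} [AddCommGroup Fμ] [Module ℂ Fμ] [AddCommGroup Fν] [Module ℂ Fν]
    (ρμ : Representation ℂ (GLCompat.GLn n × GLCompat.GLn n) Fμ)
    (ρν : Representation ℂ (GLCompat.GLn n × GLCompat.GLn n) Fν)
    (hρμ : GLCompat.IsIrrepGLProd μ ρμ) (hρν : GLCompat.IsIrrepGLProd ν ρν)
    (j : ℤ)
    {S₁ S₂ S₃ S₄ : Type*} [AddCommGroup S₁] [Module ℂ S₁] [AddCommGroup S₂] [Module ℂ S₂]
    [AddCommGroup S₃] [Module ℂ S₃] [AddCommGroup S₄] [Module ℂ S₄]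
    (σ₁ : Representation ℂ (GLCompat.GLn n) S₁) (σ₂ : Representation ℂ (GLCompat.GLn n) S₂)
    (σ₃ : Representation ℂ (GLCompat.GLn n) S₃) (σ₄ : Representation ℂ (GLCompat.GLn n) S₄) :
    -- case (b): `V_j = (det^{-j} ⊗ Sym^{nj + k_η}; Sym^{nj - n - k_η + 2nκ} ⊗ det^{1-j})`
    ((1 - 2 * GLCompat.kappa w w' + (GLCompat.kEta μ ν : ℚ) / n ≤ j ∧
        (j : ℚ) ≤ -((GLCompat.kEta μ ν : ℚ) / n) ∧
        GLCompat.IsDetPow (-j) σ₁ ∧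
        GLCompat.IsSymPow (n * j + GLCompat.kEta μ ν) σ₂ ∧
        GLCompat.IsSymPow (n * j - n - GLCompat.kEta μ ν + n * (w + w')) σ₃ ∧
        GLCompat.IsDetPow (1 - j) σ₄) →
      GLCompat.homDim ρμ ρν (GLCompat.outerTensor (σ₁.tprod σ₂) (σ₃.tprod σ₄)) ≤ 1 ∧
      (GLCompat.homDim ρμ ρν (GLCompat.outerTensor (σ₁.tprod σ₂) (σ₃.tprod σ₄)) = 1 ↔
        (-GLCompat.minSum μ ν n ≤ j ∧ j ≤ -GLCompat.maxSum μ ν (n + 1)) ∧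
        (1 - 2 * GLCompat.kappa w w' + GLCompat.maxSum μ ν (n + 1) ≤ j ∧
          (j : ℚ) ≤ 1 - 2 * GLCompat.kappa w w' + GLCompat.minSum μ ν n))) ∧
    -- case (c): `V_j = (Sym^{nj + k_η - n} ⊗ det^{1-j}; det^{-j} ⊗ Sym^{nj + 2nκ - k_η})`
    ((1 - (GLCompat.kEta μ ν : ℚ) / n ≤ j ∧
        (j : ℚ) ≤ -(2 * GLCompat.kappa w w') + (GLCompat.kEta μ ν : ℚ) / n ∧
        GLCompat.IsSymPow (n * j + GLCompat.kEta μ ν - n) σ₁ ∧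
        GLCompat.IsDetPow (1 - j) σ₂ ∧
        GLCompat.IsDetPow (-j) σ₃ ∧
        GLCompat.IsSymPow (n * j + n * (w + w') - GLCompat.kEta μ ν) σ₄) →
      GLCompat.homDim ρμ ρν (GLCompat.outerTensor (σ₁.tprod σ₂) (σ₃.tprod σ₄)) ≤ 1 ∧
      (GLCompat.homDim ρμ ρν (GLCompat.outerTensor (σ₁.tprod σ₂) (σ₃.tprod σ₄)) = 1 ↔
        (1 - GLCompat.minSum μ ν (n + 1) ≤ j ∧ j ≤ 1 - GLCompat.maxSum μ ν (n + 2)) ∧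
        (GLCompat.maxSum μ ν (n + 2) - 2 * GLCompat.kappa w w' ≤ j ∧
          (j : ℚ) ≤ -(2 * GLCompat.kappa w w') + GLCompat.minSum μ ν (n + 1)))) := by
  have hn0 : 0 < n := by omega
  have hnQ : (0 : ℚ) < n := by exact_mod_cast hn0
  have hsum := GLCompat.sum_left_add_sum_left μ ν
  have hleft : ∀ κ : GLCompat.DominantWeight n, ∀ i,
      GLCompat.twistWeight false κ.left i = κ.left i - 0 := fun κ i => (sub_zero _).symm
  have hleft' : ∀ κ : GLCompat.DominantWeight n, ∀ i,
      GLCompat.twistWeight true κ.left i = 0 - κ.left i.rev := fun κ i => (zero_sub _).symm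
  have hright : ∀ (κ : GLCompat.DominantWeight n) (z : ℤ), κ.IsPure z → ∀ i,
      GLCompat.twistWeight true κ.right i = κ.left i - z := fun κ z h i => by
    rw [GLCompat.twistWeight, if_pos rfl, h.right_eq, Fin.rev_rev, neg_sub]
  have hright' : ∀ (κ : GLCompat.DominantWeight n) (z : ℤ), κ.IsPure z → ∀ i,
      GLCompat.twistWeight false κ.right i = z - κ.left i.rev := fun κ z h i => h.right_eq i
  rw [GLCompat.two_mul_kappa]
  constructor
  · rintro ⟨hj1, hj2, h₁, h₂, h₃, h₄⟩
    -- Multiplied by `n`, the bounds on `j` are exactly the signs of the two symmetric powers.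
    have hA : n * j + GLCompat.kEta μ ν ≤ 0 := by
      rw [← neg_div, le_div_iff₀ hnQ] at hj2
      have : ((n * j + GLCompat.kEta μ ν : ℤ) : ℚ) ≤ 0 := by push_cast; linarith
      exact_mod_cast this
    have hB : 0 ≤ n * j - n - GLCompat.kEta μ ν + n * (w + w') := by
      rw [← le_sub_iff_add_le', div_le_iff₀ hnQ] at hj1
      have : (0 : ℚ) ≤ ((n * j - n - GLCompat.kEta μ ν + n * (w + w') : ℤ) : ℚ) := by
        push_cast at hj1 ⊢
        linarith
      exact_mod_cast this
    obtain ⟨a, ha⟩ := Int.eq_ofNat_of_zero_le (neg_nonneg.mpr hA)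
    obtain ⟨b, hb⟩ := Int.eq_ofNat_of_zero_le hB
    -- The first symmetric power already has nonpositive exponent; only the second factor needs
    -- transpose inverse. There `k = j - 1`, and purity turns the twisted right weights into `μ_i -
    -- w` and `ν_i - w'`.
    have k₁ := h₁.twist false
    have k₂ := h₂.twist false
    have k₃ := h₃.twist true
    have k₄ := h₄.twist true
    rw [GLCompat.twistWeight_false_detWeight] at k₁
    rw [GLCompat.twistWeight_true_detWeight] at k₄
    rw [GLCompat.symWeight_of_nonpos (a := a) (by omega)] at k₂
    rw [GLCompat.symWeight_of_nonneg (a := b) hb] at k₃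
    obtain ⟨hle, hiff⟩ := GLCompat.homDim_outerTensor hn hρμ hρν false true
      (τ := σ₁.tprod σ₂) (τ' := σ₃.tprod σ₄)
      (GLCompat.exists_isPieriTarget_det_sym hn0 k₁ k₂)
      (GLCompat.exists_isPieriTarget_sym_det hn0 k₃ k₄)
      (by
        simp only [hleft, sub_zero, hsum]
        rw [← ha]
        ring)
      (by
        simp only [hright μ w hμ, hright ν w' hν, Finset.sum_sub_distrib, Finset.sum_const,
          Finset.card_univ, Fintype.card_fin, nsmul_eq_mul]
        rw [← hb, ← hsum]
        ring)
    refine ⟨hle, hiff.trans ?_⟩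
    rw [GLCompat.pieriCondition_iff hn μ ν (hleft μ) (hleft ν),
      GLCompat.pieriCondition_iff hn μ ν (hright μ w hμ) (hright ν w' hν)]
    rw [add_zero]
    norm_cast
    constructor
    · rintro ⟨⟨h1, h2⟩, h3, h4⟩
      refine ⟨⟨?_, ?_⟩, ?_, ?_⟩ <;> linarith
    · rintro ⟨⟨h1, h2⟩, h3, h4⟩
      refine ⟨⟨?_, ?_⟩, ?_, ?_⟩ <;> linarith
  · rintro ⟨hj1, hj2, h₁, h₂, h₃, h₄⟩
    have hA : 0 ≤ n * j + GLCompat.kEta μ ν - n := by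
      rw [sub_le_comm, le_div_iff₀ hnQ] at hj1
      have : (0 : ℚ) ≤ ((n * j + GLCompat.kEta μ ν - n : ℤ) : ℚ) := by push_cast; linarith
      exact_mod_cast this
    have hB : n * j + n * (w + w') - GLCompat.kEta μ ν ≤ 0 := by
      rw [← sub_le_iff_le_add', le_div_iff₀ hnQ] at hj2
      have : ((n * j + n * (w + w') - GLCompat.kEta μ ν : ℤ) : ℚ) ≤ 0 := by
        push_cast at hj2 ⊢
        linarith
      exact_mod_cast this
    obtain ⟨a, ha⟩ := Int.eq_ofNat_of_zero_le hA
    obtain ⟨b, hb⟩ := Int.eq_ofNat_of_zero_le (neg_nonneg.mpr hB)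
    -- Here the signs are opposite, so the first factor is twisted. Both factors now carry reversed,
    -- negated weights up to a constant, which is why the sums for `n + 1` and `n + 2` appear.
    have k₁ := h₁.twist true
    have k₂ := h₂.twist true
    have k₃ := h₃.twist false
    have k₄ := h₄.twist false
    rw [GLCompat.twistWeight_true_detWeight] at k₂
    rw [GLCompat.twistWeight_false_detWeight] at k₃
    rw [GLCompat.symWeight_of_nonneg (a := a) ha] at k₁
    rw [GLCompat.symWeight_of_nonpos (a := b) (by omega)] at k₄
    obtain ⟨hle, hiff⟩ := GLCompat.homDim_outerTensor hn hρμ hρν true false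
      (τ := σ₁.tprod σ₂) (τ' := σ₃.tprod σ₄)
      (GLCompat.exists_isPieriTarget_sym_det hn0 k₁ k₂)
      (GLCompat.exists_isPieriTarget_det_sym hn0 k₃ k₄)
      (by
        simp only [hleft', zero_sub, Finset.sum_neg_distrib, GLCompat.sum_rev]
        rw [← ha, ← hsum]
        ring)
      (by
        simp only [hright' μ w hμ, hright' ν w' hν, Finset.sum_sub_distrib, Finset.sum_const,
          Finset.card_univ, Fintype.card_fin, nsmul_eq_mul, GLCompat.sum_rev]
        rw [← hb, ← hsum]
        ring)
    refine ⟨hle, hiff.trans ?_⟩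
    rw [GLCompat.pieriCondition_rev_iff hn μ ν (hleft' μ) (hleft' ν),
      GLCompat.pieriCondition_rev_iff hn μ ν (hright' μ w hμ) (hright' ν w' hν)]
    rw [add_zero]
    norm_cast
    constructor
    · rintro ⟨⟨h1, h2⟩, h3, h4⟩
      refine ⟨⟨?_, ?_⟩, ?_, ?_⟩ <;> linarith
    · rintro ⟨⟨h1, h2⟩, h3, h4⟩
      refine ⟨⟨?_, ?_⟩, ?_, ?_⟩ <;> linarith
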